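/- Let $\delta\ge\rho>0$ and $\pi>0$, let $u=\ln$, let $f:(0,\infty)\to\mathbb R$ be twice continuously differentiable, and let $$h(t)=\frac{\delta-\rho}{\pi+\delta-\rho}e^{-(\delta+\pi)t}+\frac{\pi}{\pi+\delta-\rho}e^{-\rho t},\qquad t\ge 0 .$$ *Definitions.* A strategy is a $C^1$ function $\sigma>0$ on an open set $U\subset(0,\infty)$. It converges to $\bar k\in U$ if for every $k\in U$ the Cauchy problem $\dot k_0=f(k_0)-\sigma(k_0)$, $k_0(0)=k$, has a solution $k_0(t)=\mathcal K(\sigma;t,k)$ that stays in $U$ for all $t\ge0$ and tends to $\bar k$ as $t\to\infty$. It is then an equilibrium strategy converging to $\bar k$ if for every $k\in U$ the choice $c=\sigma(k)$ maximizes over $c>0$ $$P_1(k,\sigma,c)=u(c)-u(\sigma(k))+\int_0^\infty h(t)\,u'(\sigma(k_0(t)))\,\sigma'(k_0(t))\,k_1(t)\,dt ,$$ where $\dot k_1=(f'(k_0)-\sigma'(k_0))k_1$, $k_1(0)=\sigma(k)-c$. The welfare of the metaplanner who has capital $k\in U$ is $V_\sigma(k)=\int_0^\infty h(t)\,u(\sigma(\mathcal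 K(\sigma;t,k)))\,dt$. An equilibrium strategy $\bar\sigma$ converging to $\bar k$ is locally renegotiation-proof if $\bar k$ has an open neighbourhood $\Omega$, contained in the domain of $\bar\sigma$, such that for all $k^*\in\Omega\setminus\{\bar k\}$, every equilibrium strategy $\sigma^*$ converging to $k^*$ satisfies $V_{\sigma^*}(k_0)\le V_{\bar\sigma}(k_0)$ for all $k_0\in\Omega$ in the domain of $\sigma^*$. *Proposition.* Let $\bar\sigma$ be an equilibrium strategy, with domain $\bar U$, converging to some $\bar k$ with $f'(\bar k)>\rho\frac{\pi+\delta}{\pi+\rho}$. Then: 1. $\bar\sigma$ is not locally renegotiation-proof. 2. Distant metaplanners agree to switch to an equilibrium converging to a slightly higher steady state. Namely, there is $\varepsilon>0$ with $(\bar k-\varepsilon,\bar k+\varepsilon)\subset\bar U$ such that for every $k^*\in(\bar k,\bar k+\varepsilon)$: (a) there is an equilibrium strategy $\sigma^*$ converging to $k^*$, defined at least on $(\bar k-\varepsilon,\bar k+\varepsilon)$, with $V_{\sigma^*}(k_0)>V_{\bar\sigma}(k_0)$ for all $k_0\in(\bar k-\varepsilon,\bar k+\varepsilon)$; (b) for every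 equilibrium strategy $\sigma^*$ converging to $k^*$ whose domain $U^*$ contains $\bar k$, and for every initial capital $k_0\in\bar U$, there is $T\ge0$ such that for all $t\ge T$ the capital $k=\mathcal K(\bar\sigma;t,k_0)$ lies in $U^*$ and $V_{\sigma^*}(k)>V_{\bar\sigma}(k)$. 3. The marginal value of a higher steady state is positive: if for each $k^*$ near $\bar k$ an equilibrium strategy $\sigma_{k^*}$ converging to $k^*$ and defined at $\bar k$ is selected, and $V(k_0,k^*)=V_{\sigma_{k^*}}(k_0)$, then $k^*\mapsto V(\bar k,k^*)$ is differentiable at $\bar k$, with $$\frac{\partial V}{\partial k^*}(\bar k,\bar k)=\frac1{f(\bar k)}\left(\frac{\pi+\rho}{\rho(\pi+\delta)}f'(\bar k)-1\right)>0 .$$ -/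

import Mathlib

open Set Filter Topology MeasureTheory

namespace RamseyGame

/-- A Markov consumption strategy `c = σ(k)`, possibly only defined on a set `dom` of capital
levels; the values of `rate` outside `dom` are irrelevant. -/
structure Strategy where
  dom : Set ℝ
  rate : ℝ → ℝ

/-- `γ` is a capital path on `[0, ∞)` induced by `S` from the initial capital `k`: it stays in the
domain of `S`, `γ' = f(γ) - σ(γ)` and `γ(0) = k`. -/
def IsPath (f : ℝ → ℝ) (S : Strategy) (k : ℝ) (γ : ℝ → ℝ) : Prop :=
  γ 0 = k ∧ ∀ t, 0 ≤ t →
    γ t ∈ S.dom ∧ HasDerivWithinAt γ (f (γ t) - S.rate (γ t)) (Ici 0) t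

/-- The flow `𝒦(σ; t, k)`, as a function of `t ≥ 0`. It is only used where a path exists; the path
is then unique on `[0, ∞)`, because `f` and `σ` are continuously differentiable. -/
noncomputable def flow (f : ℝ → ℝ) (S : Strategy) (k : ℝ) : ℝ → ℝ :=
  Classical.epsilon (IsPath f S k)

/-- `S` is a continuously differentiable strategy with positive consumption on an open set of
positive capital levels. -/
structure IsMarkov (S : Strategy) : Prop where
  isOpen : IsOpen S.dom
  dom_pos : S.dom ⊆ Ioi 0
  contDiffOn : ContDiffOn ℝ 1 S.rate S.dom
  rate_pos : ∀ k ∈ S.dom, 0 < S.rate k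

/-- `S` converges to the steady state `kbar`: `kbar` lies in the (open) domain, and from every
initial capital in the domain the induced path exists for all times and tends to `kbar`. -/
def ConvergesTo (f : ℝ → ℝ) (S : Strategy) (kbar : ℝ) : Prop :=
  kbar ∈ S.dom ∧
    ∀ k ∈ S.dom, (∃ γ, IsPath f S k γ) ∧ Tendsto (flow f S k) atTop (𝓝 kbar)

/-- `κ` solves on `[0, ∞)` the equation linearized along the path from `k`, with initial value
`a`: `κ' = (f'(k₀) - σ'(k₀)) κ`, `κ(0) = a`, where `k₀(t) = 𝒦(σ; t, k)`. -/
def IsVariation (f : ℝ → ℝ) (S : Strategy) (k a : ℝ) (κ : ℝ → ℝ) : Prop :=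
  κ 0 = a ∧ ∀ t, 0 ≤ t →
    HasDerivWithinAt κ
      ((deriv f (flow f S k t) - deriv S.rate (flow f S k t)) * κ t) (Ici 0) t

/-- The solution `k₁` of the linearized equation (a linear Cauchy problem with continuous
coefficient, so it exists and is unique on `[0, ∞)`). -/
noncomputable def variation (f : ℝ → ℝ) (S : Strategy) (k a : ℝ) : ℝ → ℝ :=
  Classical.epsilon (IsVariation f S k a)

/-- The first-order gain `P₁(k, σ, c)` of the decision-maker who consumes `c` during a vanishingly
small time when the capital is `k`, all her successors using `S`. -/
noncomputable def P1 (f u h : ℝ → ℝ) (S : Strategy) (k c : ℝ) : ℝ :=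
  u c - u (S.rate k) +
    ∫ t in Ioi (0 : ℝ), h t * deriv u (S.rate (flow f S k t)) *
      deriv S.rate (flow f S k t) * variation f S k (S.rate k - c) t

/-- `S` is an equilibrium strategy converging to `kbar`: a convergent Markov strategy such that, at
every capital level `k` of its domain, `c = σ(k)` maximizes `P₁(k, σ, c)` over the positive
consumption rates. -/
structure IsEquilibrium (f u h : ℝ → ℝ) (S : Strategy) (kbar : ℝ) : Prop where
  isMarkov : IsMarkov S
  convergesTo : ConvergesTo f S kbar
  isMaxOn : ∀ k ∈ S.dom, IsMaxOn (P1 f u h S k) (Ioi 0) (S.rate k)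

/-- The welfare `∫₀^∞ h(t) u(σ(𝒦(σ; t, k))) dt` of the decision-maker at capital `k` under `S`. -/
noncomputable def welfare (f u h : ℝ → ℝ) (S : Strategy) (k : ℝ) : ℝ :=
  ∫ t in Ioi (0 : ℝ), h t * u (S.rate (flow f S k t))

/-- The strategy `S`, converging to `kbar`, is locally renegotiation-proof: on some open
neighbourhood `Ω` of `kbar`, no equilibrium strategy whose steady state is shifted to another
point `kstar` of `Ω` gives more welfare than `S`, at any capital level of `Ω` where it is defined.
(For `kstar = kbar` the comparison is that of the status quo with itself.) -/
def LocallyRenegotiationProof (f u h : ℝ → ℝ) (S : Strategy) (kbar : ℝ) : Prop :=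
  ∃ Ω : Set ℝ, IsOpen Ω ∧ kbar ∈ Ω ∧ Ω ⊆ S.dom ∧
    ∀ kstar ∈ Ω, kstar ≠ kbar → ∀ S' : Strategy, IsEquilibrium f u h S' kstar →
      ∀ k₀ ∈ Ω ∩ S'.dom, welfare f u h S' k₀ ≤ welfare f u h S k₀

/-- The metaplanner's discount function, for the individual discount rate `δ`, the death rate `p`
and the social discount rate `ρ`. -/
noncomputable def discount (δ p ρ t : ℝ) : ℝ :=
  (δ - ρ) / (p + δ - ρ) * Real.exp (-(δ + p) * t) + p / (p + δ - ρ) * Real.exp (-ρ * t)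

end RamseyGame

/-!
Write `g = f - σ` for the drift of a strategy `σ`, and `A e^{-r₁ t} + B e^{-r₂ t}` for the discount
function, with `r₂ < r₁` and `A + B = 1`. The logarithmic utility discounted at the single rate `rᵢ`
is a function `Wᵢ` of the capital with `g Wᵢ' = rᵢ Wᵢ - log σ`, and an integration by parts along the
path turns the equilibrium condition into `A r₁ W₁ + B r₂ W₂ = log σ + g / σ`, so that the welfare
`V = A W₁ + B W₂` satisfies `V' = 1 / σ` (`IsEquilibrium.hasDerivAt_welfare`). With the share
`y = B σ W₂'`, an equilibrium solves the planar system
`g σ' / σ = f' - r₁ + (r₁ - r₂) y`, `g y' = -(r₁ - r₂) y (1 - y) + σ' (y - B)`, equivalently the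
second-order equation `σ'' = σ α / g² (σ' - ζ + g Q)` with `α = A r₁ + B r₂ - f'`, which is singular
at the steady state and forces the slope `ζ` there (`IsEquilibrium.steady_state`).

*Value of the steady state.* At its steady state `kstar` an equilibrium has the welfare
`(A / r₁ + B / r₂) log f(kstar)`. Along the path from `kbar` to `kstar` the share stays above `B`,
and below `1` if the path increases, because these levels cannot be crossed backwards. Hence `g`
is small between `kbar` and `kstar`, `V'` is close to `1 / f(kbar)` there, and the welfare at `kbar`
is `(A / r₁ + B / r₂) log f(kstar) - (kstar - kbar) / f(kbar)` up to `o(kstar - kbar)`, uniformly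
over all equilibria (`exists_welfare_close`). This gives the derivative of the welfare at `kbar`
with respect to the steady state, and the preference of distant metaplanners.

*A better equilibrium.* Given an equilibrium `σ` converging to `kbar`, the singular equation is
solved on a fixed interval around `kbar`, with the singular point moved to `kstar` and the slope of
`σ` kept at the right end. The solution is the fixed point of the map that freezes the coefficients
and solves the remaining linear singular equation. The maximum principle keeps that map in a ball
and makes it a contraction, as the linear equation is solved from the right to the left, the
direction in which it is damped (`IsSingularField.exists_solution`). The same principle gives the
distance `O(kstar - kbar)` to `σ` (`solution_comparison`), and the share recovered from the solution
shows that it is an equilibrium (`IsSingularSolution.isEquilibrium`). As `V' = 1 / σ`, the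
difference of the two welfares has a derivative `O(kstar - kbar)`, while at `kbar` it is at least a
positive multiple of `kstar - kbar`, so it is positive on a neighbourhood of `kbar` that does not
depend on `kstar` (`IsEquilibrium.exists_welfare_lt`).
-/

namespace RamseyGame

/-! ### Capital paths -/

/-- Net investment `f(k) - σ(k)`, the velocity of the capital at the level `k` under `S`. -/
def drift (f : ℝ → ℝ) (S : Strategy) (k : ℝ) : ℝ := f k - S.rate k

section Smoothness

variable {f : ℝ → ℝ} {S : Strategy} {k : ℝ}

lemma hasDerivAt_of_contDiffOn (hf : ContDiffOn ℝ 2 f (Ioi 0)) (hk : 0 < k) :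
    HasDerivAt f (deriv f k) k :=
  ((hf.contDiffAt (Ioi_mem_nhds hk)).differentiableAt (by norm_num)).hasDerivAt

lemma contDiffOn_deriv_of_contDiffOn (hf : ContDiffOn ℝ 2 f (Ioi 0)) :
    ContDiffOn ℝ 1 (deriv f) (Ioi 0) :=
  hf.deriv_of_isOpen isOpen_Ioi (by norm_num)

lemma continuousOn_deriv_of_contDiffOn (hf : ContDiffOn ℝ 2 f (Ioi 0)) :
    ContinuousOn (deriv f) (Ioi 0) :=
  (contDiffOn_deriv_of_contDiffOn hf).continuousOn

lemma hasDerivAt_deriv_of_contDiffOn (hf : ContDiffOn ℝ 2 f (Ioi 0)) (hk : 0 < k) :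
    HasDerivAt (deriv f) (deriv (deriv f) k) k :=
  (((contDiffOn_deriv_of_contDiffOn hf).contDiffAt (Ioi_mem_nhds hk)).differentiableAt
    (by norm_num)).hasDerivAt

lemma continuousOn_deriv_deriv_of_contDiffOn (hf : ContDiffOn ℝ 2 f (Ioi 0)) :
    ContinuousOn (deriv (deriv f)) (Ioi 0) :=
  (contDiffOn_deriv_of_contDiffOn hf).continuousOn_deriv_of_isOpen isOpen_Ioi (by norm_num)

namespace IsMarkov

lemma hasDerivAt (hM : IsMarkov S) (hk : k ∈ S.dom) : HasDerivAt S.rate (deriv S.rate k) k :=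
  ((hM.contDiffOn.contDiffAt (hM.isOpen.mem_nhds hk)).differentiableAt (by norm_num)).hasDerivAt

lemma continuousOn_deriv (hM : IsMarkov S) : ContinuousOn (deriv S.rate) S.dom :=
  hM.contDiffOn.continuousOn_deriv_of_isOpen hM.isOpen (by norm_num)

lemma pos (hM : IsMarkov S) (hk : k ∈ S.dom) : 0 < k := hM.dom_pos hk

lemma hasDerivAt_drift (hM : IsMarkov S) (hf : ContDiffOn ℝ 2 f (Ioi 0)) (hk : k ∈ S.dom) :
    HasDerivAt (drift f S) (deriv f k - deriv S.rate k) k :=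
  (hasDerivAt_of_contDiffOn hf (hM.pos hk)).sub (hM.hasDerivAt hk)

lemma contDiffOn_drift (hM : IsMarkov S) (hf : ContDiffOn ℝ 2 f (Ioi 0)) :
    ContDiffOn ℝ 1 (drift f S) S.dom :=
  ((hf.of_le (by norm_num)).mono hM.dom_pos).sub hM.contDiffOn

lemma continuousOn_drift (hM : IsMarkov S) (hf : ContDiffOn ℝ 2 f (Ioi 0)) :
    ContinuousOn (drift f S) S.dom := (hM.contDiffOn_drift hf).continuousOn

end IsMarkov

end Smoothness

section Paths

variable {f : ℝ → ℝ} {S : Strategy} {k kstar : ℝ} {γ γ' : ℝ → ℝ}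

namespace IsPath

lemma continuousOn (h : IsPath f S k γ) : ContinuousOn γ (Ici 0) :=
  fun t ht => (h.2 t ht).2.continuousWithinAt

lemma hasDerivAt (h : IsPath f S k γ) {t : ℝ} (ht : 0 < t) :
    HasDerivAt γ (drift f S (γ t)) t :=
  (h.2 t ht.le).2.hasDerivAt (Ici_mem_nhds ht)

lemma mem (h : IsPath f S k γ) {t : ℝ} (ht : 0 ≤ t) : γ t ∈ S.dom := (h.2 t ht).1

lemma hasDerivWithinAt (h : IsPath f S k γ) {t : ℝ} (ht : 0 ≤ t) :
    HasDerivWithinAt γ (drift f S (γ t)) (Ici 0) t := (h.2 t ht).2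

/-- The equation of the paths is autonomous. -/
lemma shift (h : IsPath f S k γ) {s : ℝ} (hs : 0 ≤ s) : IsPath f S (γ s) (fun t => γ (s + t)) := by
  refine ⟨by simp, fun t ht => ⟨h.mem (by positivity), ?_⟩⟩
  have h1 := h.hasDerivWithinAt (add_nonneg hs ht)
  have h2 : HasDerivWithinAt (fun t => s + t) 1 (Ici 0) t := by
    simpa using ((hasDerivAt_id t).const_add s).hasDerivWithinAt
  have h3 := h1.comp t h2 (fun x hx => add_nonneg hs hx)
  simpa [drift, Function.comp_def] using h3

/-- Uniqueness of the paths: the drift is Lipschitz on the convex hull of two paths over a compact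
interval of time, which lies in the domain when the domain is an interval. -/
lemma eqOn (hM : IsMarkov S) (hf : ContDiffOn ℝ 2 f (Ioi 0)) (hd : S.dom.OrdConnected)
    (h : IsPath f S k γ) (h' : IsPath f S k γ') : EqOn γ γ' (Ici 0) := by
  intro T hT
  have hT' : (0 : ℝ) ≤ T := hT
  have hsub : Icc (0 : ℝ) T ⊆ Ici 0 := Icc_subset_Ici_self
  have hc : IsCompact (γ '' Icc 0 T ∪ γ' '' Icc 0 T) :=
    (isCompact_Icc.image_of_continuousOn (h.continuousOn.mono hsub)).union
      (isCompact_Icc.image_of_continuousOn (h'.continuousOn.mono hsub))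
  have hne : (γ '' Icc 0 T ∪ γ' '' Icc 0 T).Nonempty :=
    ⟨γ 0, Or.inl ⟨0, left_mem_Icc.2 hT', rfl⟩⟩
  have hin : γ '' Icc 0 T ∪ γ' '' Icc 0 T ⊆ S.dom := by
    rintro _ (⟨t, ht, rfl⟩ | ⟨t, ht, rfl⟩)
    exacts [h.mem ht.1, h'.mem ht.1]
  obtain ⟨m, hm, hm'⟩ := hc.exists_isLeast hne
  obtain ⟨M, hM1, hM2⟩ := hc.exists_isGreatest hne
  have hI : Icc m M ⊆ S.dom := hd.out (hin hm) (hin hM1)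
  obtain ⟨K, hK⟩ := ((hM.contDiffOn_drift hf).mono hI).exists_lipschitzOnWith (by norm_num)
    (convex_Icc m M) isCompact_Icc
  refine ODE_solution_unique_of_mem_Icc_right (v := fun _ => drift f S) (s := fun _ => Icc m M)
    (K := K) (a := 0) (b := T) (fun _ _ => hK) (h.continuousOn.mono hsub) ?_ ?_
    (h'.continuousOn.mono hsub) ?_ ?_ (h.1.trans h'.1.symm) (right_mem_Icc.2 hT')
  · exact fun t ht => (h.hasDerivWithinAt ht.1).mono (Ici_subset_Ici.2 ht.1)
  · exact fun t ht => ⟨hm' (Or.inl ⟨t, Ico_subset_Icc_self ht, rfl⟩),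
      hM2 (Or.inl ⟨t, Ico_subset_Icc_self ht, rfl⟩)⟩
  · exact fun t ht => (h'.hasDerivWithinAt ht.1).mono (Ici_subset_Ici.2 ht.1)
  · exact fun t ht => ⟨hm' (Or.inr ⟨t, Ico_subset_Icc_self ht, rfl⟩),
      hM2 (Or.inr ⟨t, Ico_subset_Icc_self ht, rfl⟩)⟩

lemma flow_eqOn (hM : IsMarkov S) (hf : ContDiffOn ℝ 2 f (Ioi 0)) (hd : S.dom.OrdConnected)
    (h : IsPath f S k γ) : EqOn (flow f S k) γ (Ici 0) :=
  eqOn hM hf hd (Classical.epsilon_spec ⟨γ, h⟩) h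

end IsPath

namespace ConvergesTo

lemma isPath_flow (hC : ConvergesTo f S kstar) (hk : k ∈ S.dom) : IsPath f S k (flow f S k) :=
  Classical.epsilon_spec (hC.2 k hk).1

lemma tendsto_flow (hC : ConvergesTo f S kstar) (hk : k ∈ S.dom) :
    Tendsto (flow f S k) atTop (𝓝 kstar) := (hC.2 k hk).2

/-- By continuity, the path from `k` visits all levels between `k` and the steady state. -/
lemma uIcc_subset_range (hC : ConvergesTo f S kstar) (hk : k ∈ S.dom) {c : ℝ}
    (hc : c ∈ uIcc k kstar) (hne : c ≠ kstar) : ∃ t, 0 ≤ t ∧ flow f S k t = c := by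
  have hP := hC.isPath_flow hk
  have hT := hC.tendsto_flow hk
  rcases le_total k kstar with h | h
  · rw [uIcc_of_le h] at hc
    have hlt : c < kstar := lt_of_le_of_ne hc.2 hne
    obtain ⟨T, hT1, hT2⟩ := ((hT.eventually (lt_mem_nhds hlt)).and (eventually_ge_atTop 0)).exists
    obtain ⟨t, ht, ht'⟩ := intermediate_value_Icc hT2
      (hP.continuousOn.mono Icc_subset_Ici_self) ⟨hP.1.le.trans hc.1, hT1.le⟩
    exact ⟨t, ht.1, ht'⟩
  · rw [uIcc_of_ge h] at hc
    have hlt : kstar < c := lt_of_le_of_ne hc.1 (Ne.symm hne)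
    obtain ⟨T, hT1, hT2⟩ := ((hT.eventually (gt_mem_nhds hlt)).and (eventually_ge_atTop 0)).exists
    obtain ⟨t, ht, ht'⟩ := intermediate_value_Icc' hT2
      (hP.continuousOn.mono Icc_subset_Ici_self) ⟨hT1.le, hc.2.trans hP.1.ge⟩
    exact ⟨t, ht.1, ht'⟩

lemma uIcc_subset_dom (hC : ConvergesTo f S kstar) (hk : k ∈ S.dom) : uIcc k kstar ⊆ S.dom := by
  intro c hc
  by_cases hne : c = kstar
  · exact hne ▸ hC.1
  · obtain ⟨t, ht, rfl⟩ := hC.uIcc_subset_range hk hc hne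
    exact (hC.isPath_flow hk).mem ht

/-- The domain of a convergent strategy is an interval. -/
lemma ordConnected (hC : ConvergesTo f S kstar) : S.dom.OrdConnected := by
  refine ordConnected_iff.2 fun x hx y hy _ c hc => ?_
  rcases le_total c kstar with h | h
  · exact hC.uIcc_subset_dom hx (by rw [uIcc_of_le (hc.1.trans h)]; exact ⟨hc.1, h⟩)
  · exact hC.uIcc_subset_dom hy (by rw [uIcc_of_ge (h.trans hc.2)]; exact ⟨h, hc.2⟩)

lemma flow_eqOn (hM : IsMarkov S) (hf : ContDiffOn ℝ 2 f (Ioi 0)) (hC : ConvergesTo f S kstar)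
    (h : IsPath f S k γ) : EqOn (flow f S k) γ (Ici 0) :=
  h.flow_eqOn hM hf hC.ordConnected

lemma flow_add (hM : IsMarkov S) (hf : ContDiffOn ℝ 2 f (Ioi 0)) (hC : ConvergesTo f S kstar)
    (hk : k ∈ S.dom) {s t : ℝ} (hs : 0 ≤ s) (ht : 0 ≤ t) :
    flow f S (flow f S k s) t = flow f S k (s + t) :=
  hC.flow_eqOn hM hf ((hC.isPath_flow hk).shift hs) ht

/-- The limit of a path of an autonomous equation is a stationary point. -/
lemma drift_kstar (hM : IsMarkov S) (hf : ContDiffOn ℝ 2 f (Ioi 0)) (hC : ConvergesTo f S kstar) :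
    drift f S kstar = 0 := by
  have hP := hC.isPath_flow hC.1
  have hT := hC.tendsto_flow hC.1
  set γ := flow f S kstar
  have hgc : ContinuousAt (drift f S) kstar :=
    (hM.continuousOn_drift hf).continuousAt (hM.isOpen.mem_nhds hC.1)
  -- by the mean value theorem the velocity is small at some time in each unit interval
  have hmv : ∀ n : ℕ, ∃ ξ ∈ Ioo (n : ℝ) (n + 1), drift f S (γ ξ) = γ (n + 1) - γ n := by
    intro n
    have hn : (0 : ℝ) ≤ n := n.cast_nonneg
    obtain ⟨c, hc, hc'⟩ := exists_hasDerivAt_eq_slope γ (fun t => drift f S (γ t))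
      (lt_add_one (n : ℝ)) (hP.continuousOn.mono fun x hx => hn.trans hx.1)
      (fun x hx => hP.hasDerivAt (hn.trans_lt hx.1))
    exact ⟨c, hc, by rw [hc']; simp⟩
  choose ξ hξ hξ' using hmv
  have h1 : Tendsto ξ atTop atTop :=
    tendsto_atTop_mono (fun n => (hξ n).1.le) tendsto_natCast_atTop_atTop
  have h2 : Tendsto (fun n => drift f S (γ (ξ n))) atTop (𝓝 (drift f S kstar)) :=
    hgc.tendsto.comp (hT.comp h1)
  have h3 : Tendsto (fun n : ℕ => γ ((n : ℝ) + 1) - γ n) atTop (𝓝 (kstar - kstar)) :=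
    (hT.comp (tendsto_atTop_add_const_right _ _ tendsto_natCast_atTop_atTop)).sub
      (hT.comp tendsto_natCast_atTop_atTop)
  simp only [hξ'] at h2
  simpa using tendsto_nhds_unique h2 h3

lemma flow_kstar (hM : IsMarkov S) (hf : ContDiffOn ℝ 2 f (Ioi 0)) (hC : ConvergesTo f S kstar)
    {t : ℝ} (ht : 0 ≤ t) : flow f S kstar t = kstar := by
  have h0 := hC.drift_kstar hM hf
  refine hC.flow_eqOn hM hf (γ := fun _ => kstar) ⟨rfl, fun t _ => ⟨hC.1, ?_⟩⟩ ht
  rw [drift] at h0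
  simpa [h0] using (hasDerivAt_const t kstar).hasDerivWithinAt

/-- A second stationary point would be the starting point of a path that does not converge to the
steady state. -/
lemma drift_ne_zero (hM : IsMarkov S) (hf : ContDiffOn ℝ 2 f (Ioi 0)) (hC : ConvergesTo f S kstar)
    (hk : k ∈ S.dom) (hne : k ≠ kstar) : drift f S k ≠ 0 := by
  intro h0
  have hP : IsPath f S k (fun _ => k) := by
    refine ⟨rfl, fun t _ => ⟨hk, ?_⟩⟩
    rw [drift] at h0
    simpa [h0] using (hasDerivAt_const t k).hasDerivWithinAt
  have h1 : (fun _ => k) =ᶠ[atTop] flow f S k := by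
    filter_upwards [eventually_ge_atTop 0] with t ht
    exact (hC.flow_eqOn hM hf hP ht).symm
  exact hne (tendsto_nhds_unique (tendsto_const_nhds.congr' h1) (hC.tendsto_flow hk))

lemma drift_pos (hM : IsMarkov S) (hf : ContDiffOn ℝ 2 f (Ioi 0)) (hC : ConvergesTo f S kstar)
    (hk : k ∈ S.dom) (hlt : k < kstar) : 0 < drift f S k := by
  by_contra hneg
  have hneg' : drift f S k < 0 :=
    lt_of_le_of_ne (not_lt.1 hneg) (hC.drift_ne_zero hM hf hk hlt.ne)
  have hP := hC.isPath_flow hk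
  have hle : ∀ T, 0 ≤ T → flow f S k T ≤ k := by
    intro T hT
    refine image_le_of_deriv_right_lt_deriv_boundary (f := flow f S k)
      (f' := fun t => drift f S (flow f S k t)) (a := 0) (b := T) (B := fun _ => k)
      (B' := fun _ => 0) (hP.continuousOn.mono Icc_subset_Ici_self)
      (fun t ht => (hP.hasDerivWithinAt ht.1).mono (Ici_subset_Ici.2 ht.1)) hP.1.le
      (fun t => hasDerivAt_const t k) (fun t _ h => ?_) (right_mem_Icc.2 hT)
    simpa [h] using hneg'
  exact absurd (le_of_tendsto (hC.tendsto_flow hk) ((eventually_ge_atTop 0).mono hle)) hlt.not_ge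

lemma drift_neg (hM : IsMarkov S) (hf : ContDiffOn ℝ 2 f (Ioi 0)) (hC : ConvergesTo f S kstar)
    (hk : k ∈ S.dom) (hlt : kstar < k) : drift f S k < 0 := by
  by_contra hneg
  have hneg' : 0 < drift f S k :=
    lt_of_le_of_ne (not_lt.1 hneg) (hC.drift_ne_zero hM hf hk hlt.ne').symm
  have hP := hC.isPath_flow hk
  have hle : ∀ T, 0 ≤ T → k ≤ flow f S k T := by
    intro T hT
    have := image_le_of_deriv_right_lt_deriv_boundary (f := fun t => -flow f S k t)
      (f' := fun t => -drift f S (flow f S k t)) (a := 0) (b := T) (B := fun _ => -k)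
      (B' := fun _ => 0) (hP.continuousOn.mono Icc_subset_Ici_self).neg
      (fun t ht => ((hP.hasDerivWithinAt ht.1).mono (Ici_subset_Ici.2 ht.1)).neg)
      (neg_le_neg hP.1.ge)
      (fun t => hasDerivAt_const t (-k)) (fun t _ h => ?_) (right_mem_Icc.2 hT)
    · simpa using this
    · simpa [neg_inj.1 h] using hneg'
  exact absurd (ge_of_tendsto (hC.tendsto_flow hk) ((eventually_ge_atTop 0).mono hle)) hlt.not_ge

/-- The steady state is attractive, so the drift cannot have a positive slope there. -/
lemma slope_nonpos (hM : IsMarkov S) (hf : ContDiffOn ℝ 2 f (Ioi 0)) (hC : ConvergesTo f S kstar) :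
    deriv f kstar - deriv S.rate kstar ≤ 0 := by
  have h := (hasDerivAt_iff_tendsto_slope.1 (hM.hasDerivAt_drift hf hC.1))
  have h' := h.mono_left (nhdsWithin_mono kstar (fun x (hx : x ∈ Ioi kstar) => ne_of_gt hx))
  refine le_of_tendsto h' ?_
  have hev : ∀ᶠ x in 𝓝[>] kstar, x ∈ S.dom :=
    mem_nhdsWithin_of_mem_nhds (hM.isOpen.mem_nhds hC.1)
  filter_upwards [hev, self_mem_nhdsWithin] with x hx hx'
  rw [slope_def_field, hC.drift_kstar hM hf, sub_zero]
  exact div_nonpos_of_nonpos_of_nonneg (hC.drift_neg hM hf hx hx').le (sub_pos.2 hx').le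

end ConvergesTo

end Paths

/-! ### Exponentially discounted integrals -/

section Discounting

variable {r : ℝ} {ℓ U : ℝ → ℝ}

lemma integrableOn_exp_mul (hr : 0 < r) (hℓ : ContinuousOn ℓ (Ici 0)) {M : ℝ}
    (hM : ∀ t, 0 ≤ t → |ℓ t| ≤ M) :
    IntegrableOn (fun t => Real.exp (-r * t) * ℓ t) (Ioi 0) := by
  refine (exp_neg_integrableOn_Ioi 0 hr).mul_bdd (c := M)
    ((hℓ.mono Ioi_subset_Ici_self).aestronglyMeasurable measurableSet_Ioi) ?_
  filter_upwards [ae_restrict_mem measurableSet_Ioi] with t ht using hM t (le_of_lt ht)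

lemma tendsto_exp_neg_mul (hr : 0 < r) : Tendsto (fun t : ℝ => Real.exp (-r * t)) atTop (𝓝 0) :=
  Real.tendsto_exp_atBot.comp (tendsto_id.const_mul_atTop_of_neg (neg_lt_zero.2 hr))

lemma integral_exp_neg_mul (hr : 0 < r) : ∫ t in Ioi (0 : ℝ), Real.exp (-r * t) = 1 / r := by
  rw [integral_exp_mul_Ioi (neg_lt_zero.2 hr)]
  simp

lemma tendsto_exp_neg_mul_mul_bdd (hr : 0 < r) {M : ℝ} (hM : ∀ t, 0 ≤ t → |U t| ≤ M) :
    Tendsto (fun t => Real.exp (-r * t) * U t) atTop (𝓝 0) := by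
  refine squeeze_zero_norm' (a := fun t => Real.exp (-r * t) * M) ?_ ?_
  · filter_upwards [eventually_ge_atTop 0] with t ht
    rw [norm_mul, Real.norm_of_nonneg (Real.exp_nonneg _)]
    exact mul_le_mul_of_nonneg_left (hM t ht) (Real.exp_nonneg _)
  · simpa using (tendsto_exp_neg_mul hr).mul_const M

/-- The only solution of `U' = r U - ℓ` which does not grow as `e^{rt}` is the discounted
integral of `ℓ`. -/
lemma eq_integral_of_hasDerivAt (hr : 0 < r) (hℓ : ContinuousOn ℓ (Ici 0)) {M : ℝ}
    (hM : ∀ t, 0 ≤ t → |ℓ t| ≤ M) (hUc : ContinuousOn U (Ici 0))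
    (hU : ∀ t, 0 < t → HasDerivAt U (r * U t - ℓ t) t)
    (hlim : Tendsto (fun t => Real.exp (-r * t) * U t) atTop (𝓝 0)) :
    U 0 = ∫ t in Ioi (0 : ℝ), Real.exp (-r * t) * ℓ t := by
  have h := integral_Ioi_of_hasDerivAt_of_tendsto (a := 0)
    (f := fun t => Real.exp (-r * t) * U t) (f' := fun t => -(Real.exp (-r * t) * ℓ t)) (m := 0)
    ?_ ?_ (integrableOn_exp_mul hr hℓ hM).neg hlim
  · rw [integral_neg] at h
    simpa [eq_comm] using h
  · exact (by fun_prop : Continuous fun t : ℝ => Real.exp (-r * t)).continuousWithinAt.mul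
      (hUc 0 self_mem_Ici)
  · intro t ht
    have h1 : HasDerivAt (fun t : ℝ => Real.exp (-r * t)) (Real.exp (-r * t) * -r) t := by
      simpa using ((hasDerivAt_id t).const_mul (-r)).exp
    exact (h1.mul (hU t ht)).congr_deriv (by ring)

end Discounting

section AlongPaths

variable {f : ℝ → ℝ} {S : Strategy} {k kstar : ℝ}

namespace ConvergesTo

/-- The linearized equation is solved by an exponential, and by nothing else. -/
lemma exists_exp_eq_isVariation (hM : IsMarkov S) (hf : ContDiffOn ℝ 2 f (Ioi 0))
    (hC : ConvergesTo f S kstar) (hk : k ∈ S.dom) :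
    ∃ E : ℝ → ℝ, (∀ t, 0 < E t) ∧ ∀ a, IsVariation f S k a (fun t => a * E t) ∧
      ∀ κ, IsVariation f S k a κ → ∀ t, 0 ≤ t → κ t = a * E t := by
  have hP := hC.isPath_flow hk
  set m : ℝ → ℝ := fun t => deriv f (flow f S k (max t 0)) - deriv S.rate (flow f S k (max t 0))
  have hflow : Continuous fun t : ℝ => flow f S k (max t 0) :=
    hP.continuousOn.comp_continuous (by fun_prop) fun t => le_max_right t 0
  have hmc : Continuous m :=
    ((continuousOn_deriv_of_contDiffOn hf).comp_continuous hflow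
      fun t => hM.dom_pos (hP.mem (le_max_right t 0))).sub
    (hM.continuousOn_deriv.comp_continuous hflow fun t => hP.mem (le_max_right t 0))
  have hm : ∀ t, 0 ≤ t → m t = deriv f (flow f S k t) - deriv S.rate (flow f S k t) := by
    intro t ht
    simp [m, max_eq_left ht]
  have hI : ∀ t, HasDerivAt (fun t => ∫ s in (0 : ℝ)..t, m s) (m t) t := fun t =>
    (hmc.integral_hasStrictDerivAt 0 t).hasDerivAt
  refine ⟨fun t => Real.exp (∫ s in (0 : ℝ)..t, m s), fun t => Real.exp_pos _, fun a =>
    ⟨⟨by simp, fun t ht => ?_⟩, fun κ hκ t ht => ?_⟩⟩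
  · rw [← hm t ht]
    exact (((hI t).exp.const_mul a).congr_deriv (by ring)).hasDerivWithinAt
  · have hder : ∀ t, HasDerivAt (fun t => Real.exp (-∫ s in (0 : ℝ)..t, m s))
        (Real.exp (-∫ s in (0 : ℝ)..t, m s) * -m t) t := fun t => (hI t).neg.exp
    have hcst := constant_of_has_deriv_right_zero
      (f := fun t => κ t * Real.exp (-∫ s in (0 : ℝ)..t, m s)) (a := 0) (b := t)
      (fun s hs => ((hκ.2 s hs.1).continuousWithinAt.mono Icc_subset_Ici_self).mul
        (hder s).continuousAt.continuousWithinAt)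
      (fun s hs => ?_) t (right_mem_Icc.2 ht)
    · simp only [hκ.1, intervalIntegral.integral_same, neg_zero, Real.exp_zero, mul_one] at hcst
      rw [← hcst, mul_assoc, ← Real.exp_add]
      simp
    · have h1 := ((hκ.2 s hs.1).mono (Ici_subset_Ici.2 hs.1)).mul (hder s).hasDerivWithinAt
      rw [← hm s hs.1] at h1
      exact h1.congr_deriv (by ring)

lemma isVariation_variation (hM : IsMarkov S) (hf : ContDiffOn ℝ 2 f (Ioi 0))
    (hC : ConvergesTo f S kstar) (hk : k ∈ S.dom) (a : ℝ) :
    IsVariation f S k a (variation f S k a) := by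
  obtain ⟨E, _, hE⟩ := hC.exists_exp_eq_isVariation hM hf hk
  exact Classical.epsilon_spec ⟨_, (hE a).1⟩

lemma variation_eq_mul (hM : IsMarkov S) (hf : ContDiffOn ℝ 2 f (Ioi 0))
    (hC : ConvergesTo f S kstar) (hk : k ∈ S.dom) (a : ℝ) {t : ℝ} (ht : 0 ≤ t) :
    variation f S k a t = a * variation f S k 1 t := by
  obtain ⟨E, _, hE⟩ := hC.exists_exp_eq_isVariation hM hf hk
  rw [(hE a).2 _ (hC.isVariation_variation hM hf hk a) t ht,
    (hE 1).2 _ (hC.isVariation_variation hM hf hk 1) t ht, one_mul]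

lemma variation_one_pos (hM : IsMarkov S) (hf : ContDiffOn ℝ 2 f (Ioi 0))
    (hC : ConvergesTo f S kstar) (hk : k ∈ S.dom) {t : ℝ} (ht : 0 ≤ t) :
    0 < variation f S k 1 t := by
  obtain ⟨E, hE0, hE⟩ := hC.exists_exp_eq_isVariation hM hf hk
  rw [(hE 1).2 _ (hC.isVariation_variation hM hf hk 1) t ht, one_mul]
  exact hE0 t

/-- The velocity of the path solves the linearized equation. -/
lemma drift_flow (hM : IsMarkov S) (hf : ContDiffOn ℝ 2 f (Ioi 0))
    (hC : ConvergesTo f S kstar) (hk : k ∈ S.dom) {t : ℝ} (ht : 0 ≤ t) :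
    drift f S (flow f S k t) = drift f S k * variation f S k 1 t := by
  obtain ⟨E, _, hE⟩ := hC.exists_exp_eq_isVariation hM hf hk
  have hP := hC.isPath_flow hk
  have hv : IsVariation f S k (drift f S k) (fun t => drift f S (flow f S k t)) := by
    refine ⟨by simp [hP.1], fun t ht => ?_⟩
    exact (hM.hasDerivAt_drift hf (hP.mem ht)).comp_hasDerivWithinAt t (hP.hasDerivWithinAt ht)
  rw [(hE _).2 _ hv t ht, (hE 1).2 _ (hC.isVariation_variation hM hf hk 1) t ht, one_mul]

lemma flow_mem_Ico (hM : IsMarkov S) (hf : ContDiffOn ℝ 2 f (Ioi 0))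
    (hC : ConvergesTo f S kstar) (hk : k ∈ S.dom) (hlt : k < kstar) {t : ℝ} (ht : 0 ≤ t) :
    flow f S k t ∈ Ico k kstar := by
  have hP := hC.isPath_flow hk
  have hpos : ∀ s, 0 ≤ s → 0 < drift f S (flow f S k s) := fun s hs => by
    rw [hC.drift_flow hM hf hk hs]
    exact mul_pos (hC.drift_pos hM hf hk hlt) (hC.variation_one_pos hM hf hk hs)
  constructor
  · have hmono : MonotoneOn (flow f S k) (Ici 0) :=
      monotoneOn_of_hasDerivWithinAt_nonneg (convex_Ici 0) hP.continuousOn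
        (f' := fun s => drift f S (flow f S k s))
        (fun s hs => (hP.hasDerivAt (by simpa using hs)).hasDerivWithinAt)
        (fun s hs => (hpos s (interior_subset hs)).le)
    exact hP.1.ge.trans (hmono self_mem_Ici ht ht)
  · by_contra hge
    rcases (not_lt.1 hge).eq_or_lt with h | h
    · have := hpos t ht
      rw [← h, hC.drift_kstar hM hf] at this
      exact lt_irrefl _ this
    · exact lt_asymm (hpos t ht) (hC.drift_neg hM hf (hP.mem ht) h)

lemma flow_mem_Ioc (hM : IsMarkov S) (hf : ContDiffOn ℝ 2 f (Ioi 0))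
    (hC : ConvergesTo f S kstar) (hk : k ∈ S.dom) (hlt : kstar < k) {t : ℝ} (ht : 0 ≤ t) :
    flow f S k t ∈ Ioc kstar k := by
  have hP := hC.isPath_flow hk
  have hneg : ∀ s, 0 ≤ s → drift f S (flow f S k s) < 0 := fun s hs => by
    rw [hC.drift_flow hM hf hk hs]
    exact mul_neg_of_neg_of_pos (hC.drift_neg hM hf hk hlt) (hC.variation_one_pos hM hf hk hs)
  constructor
  · by_contra hge
    rcases (not_lt.1 hge).eq_or_lt with h | h
    · have := hneg t ht
      rw [h, hC.drift_kstar hM hf] at this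
      exact lt_irrefl _ this
    · exact lt_asymm (hneg t ht) (hC.drift_pos hM hf (hP.mem ht) h)
  · have hmono : AntitoneOn (flow f S k) (Ici 0) :=
      antitoneOn_of_hasDerivWithinAt_nonpos (convex_Ici 0) hP.continuousOn
        (f' := fun s => drift f S (flow f S k s))
        (fun s hs => (hP.hasDerivAt (by simpa using hs)).hasDerivWithinAt)
        (fun s hs => (hneg s (interior_subset hs)).le)
    exact (hmono self_mem_Ici ht ht).trans hP.1.le

lemma flow_mem_uIcc (hM : IsMarkov S) (hf : ContDiffOn ℝ 2 f (Ioi 0))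
    (hC : ConvergesTo f S kstar) (hk : k ∈ S.dom) {t : ℝ} (ht : 0 ≤ t) :
    flow f S k t ∈ uIcc k kstar := by
  rcases lt_trichotomy k kstar with h | rfl | h
  · rw [uIcc_of_le h.le]
    exact Ico_subset_Icc_self (hC.flow_mem_Ico hM hf hk h ht)
  · simp [hC.flow_kstar hM hf ht]
  · rw [uIcc_of_ge h.le]
    exact Ioc_subset_Icc_self (hC.flow_mem_Ioc hM hf hk h ht)

lemma flow_ne (hM : IsMarkov S) (hf : ContDiffOn ℝ 2 f (Ioi 0))
    (hC : ConvergesTo f S kstar) (hk : k ∈ S.dom) (hne : k ≠ kstar) {t : ℝ} (ht : 0 ≤ t) :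
    flow f S k t ≠ kstar := by
  rcases lt_or_gt_of_ne hne with h | h
  · exact (hC.flow_mem_Ico hM hf hk h ht).2.ne
  · exact (hC.flow_mem_Ioc hM hf hk h ht).1.ne'

/-- A continuous function on the domain is bounded and continuous along each path. -/
lemma continuousOn_bounded_comp_flow (hM : IsMarkov S) (hf : ContDiffOn ℝ 2 f (Ioi 0))
    (hC : ConvergesTo f S kstar) (hk : k ∈ S.dom) {F : ℝ → ℝ} (hF : ContinuousOn F S.dom) :
    ContinuousOn (fun t => F (flow f S k t)) (Ici 0) ∧
      ∃ M, ∀ t, 0 ≤ t → |F (flow f S k t)| ≤ M := by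
  have hP := hC.isPath_flow hk
  refine ⟨hF.comp hP.continuousOn fun t ht => hP.mem ht, ?_⟩
  obtain ⟨M, hM'⟩ := isCompact_uIcc.exists_bound_of_continuousOn
    (hF.mono (hC.uIcc_subset_dom hk))
  exact ⟨M, fun t ht => hM' _ (hC.flow_mem_uIcc hM hf hk ht)⟩

/-- A function whose derivative along the paths is `D` has the derivative `D / drift` in the
capital: away from the steady state, the travel time `∫ dk / drift` inverts the path. -/
lemma hasDerivAt_of_hasDerivAt_flow (hM : IsMarkov S) (hf : ContDiffOn ℝ 2 f (Ioi 0))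
    (hC : ConvergesTo f S kstar) {F D : ℝ → ℝ}
    (hF : ∀ k₀ ∈ S.dom, k₀ ≠ kstar → ∀ t, 0 < t →
      HasDerivAt (fun s => F (flow f S k₀ s)) (D (flow f S k₀ t)) t)
    (hk : k ∈ S.dom) (hne : k ≠ kstar) : HasDerivAt F (D k / drift f S k) k := by
  -- a starting point, farther from the steady state
  obtain ⟨k₀, hk₀, hk₀k, hcase⟩ : ∃ k₀ ∈ S.dom, k₀ ≠ k ∧
      (k₀ < k ∧ k < kstar ∨ kstar < k ∧ k < k₀) := by
    obtain ⟨ε, hε, hball⟩ := Metric.isOpen_iff.1 hM.isOpen k hk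
    rcases lt_or_gt_of_ne hne with h | h
    · exact ⟨k - ε / 2, hball (by simp [abs_of_pos, hε]),
        by linarith, Or.inl ⟨by linarith, h⟩⟩
    · exact ⟨k + ε / 2, hball (by simp [abs_of_pos, hε]),
        by linarith, Or.inr ⟨h, by linarith⟩⟩
  set I : Set ℝ := {x | x ∈ S.dom ∧ (x < kstar ↔ k < kstar) ∧ x ≠ kstar} with hI
  have hI_open : IsOpen I := by
    rcases hcase with h | h
    · have : I = S.dom ∩ Iio kstar := by
        ext x; simp only [hI, h.2, iff_true, mem_ofPred_eq, mem_inter_iff, mem_Iio]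
        exact ⟨fun hx => ⟨hx.1, hx.2.1⟩, fun hx => ⟨hx.1, hx.2, hx.2.ne⟩⟩
      rw [this]; exact hM.isOpen.inter isOpen_Iio
    · have : I = S.dom ∩ Ioi kstar := by
        ext x
        simp only [hI, h.1.not_gt, iff_false, not_lt, mem_ofPred_eq, mem_inter_iff, mem_Ioi]
        exact ⟨fun hx => ⟨hx.1, lt_of_le_of_ne hx.2.1 (Ne.symm hx.2.2)⟩,
          fun hx => ⟨hx.1, hx.2.le, hx.2.ne'⟩⟩
      rw [this]; exact hM.isOpen.inter isOpen_Ioi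
  have hkI : k ∈ I := ⟨hk, Iff.rfl, hne⟩
  have hk₀ne : k₀ ≠ kstar := by rcases hcase with h | h <;> [exact (h.1.trans h.2).ne;
    exact (h.1.trans h.2).ne']
  have hk₀I : k₀ ∈ I := ⟨hk₀, by rcases hcase with h | h <;> constructor <;> intro <;> linarith,
    hk₀ne⟩
  have huIcc : ∀ x ∈ I, uIcc k₀ x ⊆ I := by
    intro x hx c hc
    have hd := hC.ordConnected.uIcc_subset hk₀ hx.1 hc
    rcases hcase with h | h
    · have hx' := hx.2.1.2 h.2
      have : c < kstar := hc.2.trans_lt (max_lt (h.1.trans h.2) hx')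
      exact ⟨hd, by simp [this, h.2], this.ne⟩
    · have hx' : kstar < x := lt_of_le_of_ne
        (not_lt.1 fun hlt => absurd (hx.2.1.1 hlt) h.1.not_gt) (Ne.symm hx.2.2)
      have : kstar < c := (lt_min (h.1.trans h.2) hx').trans_le hc.1
      exact ⟨hd, by simp [this.not_gt, h.1.not_gt], this.ne'⟩
  set T : ℝ → ℝ := fun x => ∫ c in k₀..x, (drift f S c)⁻¹ with hTdef
  have hinv : ContinuousOn (fun c => (drift f S c)⁻¹) I :=
    ((hM.continuousOn_drift hf).mono fun x hx => hx.1).inv₀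
      fun x hx => hC.drift_ne_zero hM hf hx.1 hx.2.2
  have hT : ∀ x ∈ I, HasDerivAt T (drift f S x)⁻¹ x := fun x hx =>
    intervalIntegral.integral_hasDerivAt_right
      ((hinv.mono (huIcc x hx)).intervalIntegrable)
      (hinv.stronglyMeasurableAtFilter hI_open x hx) (hinv.continuousAt (hI_open.mem_nhds hx))
  have hP := hC.isPath_flow hk₀
  have hflowI : ∀ t, 0 ≤ t → flow f S k₀ t ∈ I := by
    intro t ht
    refine ⟨hP.mem ht, ?_, hC.flow_ne hM hf hk₀ hk₀ne ht⟩
    rcases hcase with h | h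
    · simp [h.2, (hC.flow_mem_Ico hM hf hk₀ (h.1.trans h.2) ht).2]
    · simp [h.1.not_gt, (hC.flow_mem_Ioc hM hf hk₀ (h.1.trans h.2) ht).1.not_gt]
  have hTflow : ∀ t, 0 ≤ t → T (flow f S k₀ t) = t := by
    intro t ht
    have hd : ∀ s, 0 ≤ s → HasDerivWithinAt (fun s => T (flow f S k₀ s) - s) 0 (Ici 0) s := by
      intro s hs
      have h1 := (hT _ (hflowI s hs)).comp_hasDerivWithinAt s (hP.hasDerivWithinAt hs)
      have h2 := h1.sub (hasDerivAt_id s).hasDerivWithinAt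
      refine h2.congr_deriv ?_
      rw [inv_mul_cancel₀ (hC.drift_ne_zero hM hf (hflowI s hs).1 (hflowI s hs).2.2), sub_self]
    have := constant_of_has_deriv_right_zero (f := fun s => T (flow f S k₀ s) - s) (a := 0) (b := t)
      (fun s hs => (hd s hs.1).continuousWithinAt.mono Icc_subset_Ici_self)
      (fun s hs => (hd s hs.1).mono (Ici_subset_Ici.2 hs.1)) t (right_mem_Icc.2 ht)
    simp only [hP.1, hTdef, intervalIntegral.integral_same, sub_zero] at this
    exact sub_eq_zero.1 this
  have hbetween : ∀ x, (k₀ < x ∧ x < kstar ∨ kstar < x ∧ x < k₀) →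
      0 < T x ∧ flow f S k₀ (T x) = x := by
    intro x hx
    obtain ⟨t, ht, htx⟩ := hC.uIcc_subset_range hk₀ (c := x) (by
      rcases hx with h | h
      · rw [uIcc_of_le (h.1.trans h.2).le]; exact ⟨h.1.le, h.2.le⟩
      · rw [uIcc_of_ge (h.1.trans h.2).le]; exact ⟨h.1.le, h.2.le⟩)
      (by rcases hx with h | h <;> [exact h.2.ne; exact h.1.ne'])
    have hTx : T x = t := by rw [← htx, hTflow t ht]
    refine ⟨hTx ▸ lt_of_le_of_ne ht ?_, by rw [hTx, htx]⟩
    rintro rfl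
    rw [hP.1] at htx
    rcases hx with h | h <;> linarith
  have hev : F =ᶠ[𝓝 k] fun x => F (flow f S k₀ (T x)) := by
    rcases hcase with h | h
    · filter_upwards [Ioo_mem_nhds h.1 h.2] with x hx
      rw [(hbetween x (Or.inl hx)).2]
    · filter_upwards [Ioo_mem_nhds h.1 h.2] with x hx
      rw [(hbetween x (Or.inr hx)).2]
  have hk' := hbetween k hcase
  refine HasDerivAt.congr_of_eventuallyEq ?_ hev
  have h1 := (hF k₀ hk₀ hk₀ne (T k) hk'.1).comp k (hT k hkI)
  rw [hk'.2] at h1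
  simpa [div_eq_mul_inv, Function.comp_def] using h1

end ConvergesTo

end AlongPaths

/-! ### Welfare components and the equilibrium condition -/

/-- The utility of the consumption stream induced by `S` from `k`, discounted at the single
constant rate `r`. -/
noncomputable def discountedUtility (f : ℝ → ℝ) (S : Strategy) (r k : ℝ) : ℝ :=
  ∫ t in Ioi (0 : ℝ), Real.exp (-r * t) * Real.log (S.rate (flow f S k t))

/-- The marginal effect of the initial capital on the utility discounted at the rate `r`, computed
by differentiating under the integral. -/
noncomputable def discountedMarginal (f : ℝ → ℝ) (S : Strategy) (r k : ℝ) : ℝ :=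
  ∫ t in Ioi (0 : ℝ), Real.exp (-r * t) *
    (deriv S.rate (flow f S k t) / S.rate (flow f S k t) * variation f S k 1 t)

/-- The discount function `A e^{-r₁ t} + B e^{-r₂ t}`. -/
noncomputable def mixedDiscount (A B r₁ r₂ t : ℝ) : ℝ :=
  A * Real.exp (-r₁ * t) + B * Real.exp (-r₂ * t)

/-- Weights and rates of a proper mixture of two exponential discount functions. The weight of the
larger rate may vanish. -/
structure IsMixture (A B r₁ r₂ : ℝ) : Prop where
  add_eq : A + B = 1
  left_nonneg : 0 ≤ A
  right_pos : 0 < B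
  rate_pos : 0 < r₂
  rate_lt : r₂ < r₁

section

variable {f : ℝ → ℝ} {S : Strategy} {k kstar r A B r₁ r₂ : ℝ}

lemma IsMarkov.continuousOn_log (hM : IsMarkov S) :
    ContinuousOn (fun x => Real.log (S.rate x)) S.dom :=
  hM.contDiffOn.continuousOn.log fun x hx => (hM.rate_pos x hx).ne'

namespace ConvergesTo

lemma discountedUtility_kstar (hM : IsMarkov S) (hf : ContDiffOn ℝ 2 f (Ioi 0))
    (hC : ConvergesTo f S kstar) (hr : 0 < r) :
    discountedUtility f S r kstar = Real.log (S.rate kstar) / r := by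
  rw [discountedUtility, setIntegral_congr_fun (g := fun t =>
    Real.exp (-r * t) * Real.log (S.rate kstar)) measurableSet_Ioi
    (fun t ht => by simp only [hC.flow_kstar hM hf (le_of_lt ht)]), integral_mul_const,
    integral_exp_neg_mul hr]
  ring

lemma hasDerivAt_discountedUtility_flow (hM : IsMarkov S) (hf : ContDiffOn ℝ 2 f (Ioi 0))
    (hC : ConvergesTo f S kstar) (hr : 0 < r) (hk : k ∈ S.dom) {t : ℝ} (ht : 0 < t) :
    HasDerivAt (fun s => discountedUtility f S r (flow f S k s))
      (r * discountedUtility f S r (flow f S k t) - Real.log (S.rate (flow f S k t))) t := by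
  obtain ⟨hℓc, M, hM'⟩ := hC.continuousOn_bounded_comp_flow hM hf hk hM.continuousOn_log
  set ℓ : ℝ → ℝ := fun t => Real.log (S.rate (flow f S k t)) with hℓ
  set ℓ' : ℝ → ℝ := fun t => ℓ (max t 0) with hℓ'
  have hℓ'c : Continuous ℓ' := hℓc.comp_continuous (by fun_prop) fun t => le_max_right t 0
  have hℓ'eq : ∀ t, 0 ≤ t → ℓ' t = ℓ t := fun t ht => by simp [hℓ', max_eq_left ht]
  set J := discountedUtility f S r k with hJ
  set P : ℝ → ℝ := fun s => ∫ u in (0 : ℝ)..s, Real.exp (-r * u) * ℓ' u with hPdef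
  have hP : ∀ s, HasDerivAt P (Real.exp (-r * s) * ℓ' s) s := fun s =>
    ((by fun_prop : Continuous fun u => Real.exp (-r * u) * ℓ' u).integral_hasStrictDerivAt
      0 s).hasDerivAt
  have hPlim : Tendsto P atTop (𝓝 J) := by
    refine (intervalIntegral_tendsto_integral_Ioi 0 (integrableOn_exp_mul hr hℓc hM')
      tendsto_id).congr' ?_
    filter_upwards [eventually_ge_atTop 0] with s hs
    refine intervalIntegral.integral_congr fun u hu => ?_
    rw [id, uIcc_of_le hs] at hu
    simp only [hℓ'eq u hu.1]
  set U : ℝ → ℝ := fun s => Real.exp (r * s) * (J - P s) with hUdef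
  have hU : ∀ s, HasDerivAt U (r * U s - ℓ' s) s := by
    intro s
    have h1 : HasDerivAt (fun s : ℝ => Real.exp (r * s)) (Real.exp (r * s) * r) s := by
      simpa using ((hasDerivAt_id s).const_mul r).exp
    refine (h1.mul ((hP s).const_sub J)).congr_deriv ?_
    have : Real.exp (r * s) * Real.exp (-r * s) = 1 := by rw [← Real.exp_add]; simp
    simp only [hUdef]
    linear_combination (-ℓ' s) * this
  -- `U` is the discounted utility along the path
  have hkey : ∀ s, 0 ≤ s → discountedUtility f S r (flow f S k s) = U s := by
    intro s hs
    have h1 := eq_integral_of_hasDerivAt (ℓ := fun u => ℓ (s + u)) (U := fun u => U (s + u)) hr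
      (hℓc.comp (by fun_prop) fun u hu => add_nonneg hs hu)
      (fun u hu => hM' _ (add_nonneg hs hu))
      (fun u _ => ((hU (s + u)).continuousAt.comp (by fun_prop)).continuousWithinAt)
      (fun u hu => by
        rw [← hℓ'eq _ (add_nonneg hs hu.le)]
        simpa using (hU (s + u)).comp_const_add s u) ?_
    · simp only [add_zero] at h1
      rw [h1, discountedUtility]
      refine setIntegral_congr_fun measurableSet_Ioi fun u hu => ?_
      simp only [hC.flow_add hM hf hk hs (le_of_lt hu), hℓ]
    · have h2 : Tendsto (fun u => Real.exp (r * s) * (J - P (s + u))) atTop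
          (𝓝 (Real.exp (r * s) * (J - J))) :=
        ((hPlim.comp (tendsto_atTop_add_const_left _ s tendsto_id)).const_sub J).const_mul _
      rw [sub_self, mul_zero] at h2
      refine h2.congr fun u => ?_
      simp only [hUdef]
      rw [← mul_assoc, ← Real.exp_add]
      ring_nf
  have hev : (fun s => discountedUtility f S r (flow f S k s)) =ᶠ[𝓝 t] U := by
    filter_upwards [lt_mem_nhds ht] with s hs using hkey s (le_of_lt hs)
  rw [hkey t ht.le]
  have := (hU t).congr_of_eventuallyEq hev
  rwa [hℓ'eq t ht.le] at this

lemma hasDerivAt_discountedUtility (hM : IsMarkov S) (hf : ContDiffOn ℝ 2 f (Ioi 0))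
    (hC : ConvergesTo f S kstar) (hr : 0 < r) (hk : k ∈ S.dom) (hne : k ≠ kstar) :
    HasDerivAt (discountedUtility f S r)
      ((r * discountedUtility f S r k - Real.log (S.rate k)) / drift f S k) k :=
  hC.hasDerivAt_of_hasDerivAt_flow hM hf
    (D := fun k => r * discountedUtility f S r k - Real.log (S.rate k))
    (fun _ hk₀ _ _ ht => hC.hasDerivAt_discountedUtility_flow hM hf hr hk₀ ht) hk hne

/-- A solution `F` of `F' drift = r F - log σ` that is continuous on the domain is the discounted
utility. -/
lemma discountedUtility_eq_of_hasDerivAt (hM : IsMarkov S) (hf : ContDiffOn ℝ 2 f (Ioi 0))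
    (hC : ConvergesTo f S kstar) (hr : 0 < r) {F F' : ℝ → ℝ} (hFc : ContinuousOn F S.dom)
    (hF : ∀ x ∈ S.dom, x ≠ kstar → HasDerivAt F (F' x) x ∧
      F' x * drift f S x = r * F x - Real.log (S.rate x))
    (hk : k ∈ S.dom) (hne : k ≠ kstar) : discountedUtility f S r k = F k := by
  obtain ⟨hℓc, M, hM'⟩ := hC.continuousOn_bounded_comp_flow hM hf hk hM.continuousOn_log
  obtain ⟨hFc', N, hN⟩ := hC.continuousOn_bounded_comp_flow hM hf hk hFc
  have hP := hC.isPath_flow hk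
  have h := eq_integral_of_hasDerivAt (U := fun t => F (flow f S k t)) hr hℓc hM' hFc' ?_
    (tendsto_exp_neg_mul_mul_bdd hr hN)
  · rw [hP.1] at h
    exact h.symm
  · intro t ht
    have hF' := hF _ (hP.mem ht.le) (hC.flow_ne hM hf hk hne ht.le)
    rw [← hF'.2]
    exact hF'.1.comp t (hP.hasDerivAt ht)

lemma continuousAt_discountedUtility_kstar (hM : IsMarkov S) (hf : ContDiffOn ℝ 2 f (Ioi 0))
    (hC : ConvergesTo f S kstar) (hr : 0 < r) : ContinuousAt (discountedUtility f S r) kstar := by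
  rw [Metric.continuousAt_iff]
  intro ε hε
  have hlog := hM.continuousOn_log.continuousAt (hM.isOpen.mem_nhds hC.1)
  have hε' : 0 < r * (ε / 2) := by positivity
  obtain ⟨η, hη, hball⟩ := Metric.continuousAt_iff.1 hlog _ hε'
  obtain ⟨η', hη', hdom⟩ := Metric.isOpen_iff.1 hM.isOpen kstar hC.1
  refine ⟨min η η', lt_min hη hη', fun x hx => ?_⟩
  have hxd : x ∈ S.dom := hdom (lt_of_lt_of_le hx (min_le_right _ _))
  obtain ⟨hℓc, M, hM'⟩ := hC.continuousOn_bounded_comp_flow hM hf hxd hM.continuousOn_log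
  rw [Real.dist_eq, hC.discountedUtility_kstar hM hf hr, discountedUtility]
  have h1 : Real.log (S.rate kstar) / r =
      ∫ t in Ioi (0 : ℝ), Real.exp (-r * t) * Real.log (S.rate kstar) := by
    rw [integral_mul_const, integral_exp_neg_mul hr]; ring
  rw [h1, ← integral_sub (integrableOn_exp_mul hr hℓc hM')
    ((exp_neg_integrableOn_Ioi 0 hr).mul_const _)]
  have h2 : ∫ t in Ioi (0 : ℝ), Real.exp (-r * t) * (r * (ε / 2)) = ε / 2 := by
    rw [integral_mul_const, integral_exp_neg_mul hr]; field_simp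
  have h3 : |∫ t in Ioi (0 : ℝ), (Real.exp (-r * t) * Real.log (S.rate (flow f S x t)) -
      Real.exp (-r * t) * Real.log (S.rate kstar))| ≤ ε / 2 := by
    rw [← h2, ← Real.norm_eq_abs]
    refine norm_integral_le_of_norm_le ((exp_neg_integrableOn_Ioi 0 hr).mul_const _) ?_
    filter_upwards [ae_restrict_mem measurableSet_Ioi] with t ht
    rw [← mul_sub, norm_mul, Real.norm_of_nonneg (Real.exp_nonneg _)]
    refine mul_le_mul_of_nonneg_left (le_of_lt (hball ?_)) (Real.exp_nonneg _)
    have hmem := hC.flow_mem_uIcc hM hf hxd (le_of_lt ht)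
    calc dist (flow f S x t) kstar ≤ dist x kstar := Real.dist_right_le_of_mem_uIcc hmem
      _ < η := lt_of_lt_of_le hx (min_le_left _ _)
  linarith

/-- The variation is the ratio of the velocities at the times `t` and `0`, hence bounded. -/
lemma exists_variation_bound (hM : IsMarkov S) (hf : ContDiffOn ℝ 2 f (Ioi 0))
    (hC : ConvergesTo f S kstar) (hk : k ∈ S.dom) (hne : k ≠ kstar) :
    ∃ M, ∀ t, 0 ≤ t → |variation f S k 1 t| ≤ M := by
  obtain ⟨_, M, hM'⟩ := hC.continuousOn_bounded_comp_flow hM hf hk (hM.continuousOn_drift hf)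
  have hg := hC.drift_ne_zero hM hf hk hne
  refine ⟨M / |drift f S k|, fun t ht => ?_⟩
  rw [le_div_iff₀ (abs_pos.2 hg), mul_comm, ← abs_mul, ← hC.drift_flow hM hf hk ht]
  exact hM' t ht

lemma variation_kstar (hM : IsMarkov S) (hf : ContDiffOn ℝ 2 f (Ioi 0))
    (hC : ConvergesTo f S kstar) {t : ℝ} (ht : 0 ≤ t) :
    variation f S kstar 1 t = Real.exp ((deriv f kstar - deriv S.rate kstar) * t) := by
  obtain ⟨E, _, hE⟩ := hC.exists_exp_eq_isVariation hM hf hC.1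
  rw [(hE 1).2 _ (hC.isVariation_variation hM hf hC.1 1) t ht]
  refine ((hE 1).2 (fun t => Real.exp ((deriv f kstar - deriv S.rate kstar) * t))
    ⟨by simp, fun t ht => ?_⟩ t ht).symm
  rw [hC.flow_kstar hM hf ht]
  have h := ((hasDerivAt_id t).const_mul (deriv f kstar - deriv S.rate kstar)).exp
  simp only [id, mul_one] at h
  exact (h.congr_deriv (mul_comm _ _)).hasDerivWithinAt

lemma integrableOn_marginal (hM : IsMarkov S) (hf : ContDiffOn ℝ 2 f (Ioi 0))
    (hC : ConvergesTo f S kstar) (hk : k ∈ S.dom) (hr : 0 < r) :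
    IntegrableOn (fun t => Real.exp (-r * t) *
      (deriv S.rate (flow f S k t) / S.rate (flow f S k t) * variation f S k 1 t)) (Ioi 0) := by
  have hbd : ∃ N, ∀ t, 0 ≤ t → |variation f S k 1 t| ≤ N := by
    by_cases hne : k = kstar
    · subst hne
      refine ⟨1, fun t ht => ?_⟩
      rw [hC.variation_kstar hM hf ht, abs_of_pos (Real.exp_pos _)]
      exact Real.exp_le_one_iff.2 (mul_nonpos_of_nonpos_of_nonneg (hC.slope_nonpos hM hf) ht)
    · exact hC.exists_variation_bound hM hf hk hne
  obtain ⟨N, hN⟩ := hbd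
  obtain ⟨hc, M, hM'⟩ := hC.continuousOn_bounded_comp_flow hM hf hk
    (F := fun x => deriv S.rate x / S.rate x)
    (hM.continuousOn_deriv.div hM.contDiffOn.continuousOn fun x hx => (hM.rate_pos x hx).ne')
  have hv := hC.isVariation_variation hM hf hk 1
  refine integrableOn_exp_mul hr (M := M * N)
    (hc.mul fun t ht => (hv.2 t ht).continuousWithinAt) fun t ht => ?_
  rw [abs_mul]
  exact mul_le_mul (hM' t ht) (hN t ht) (abs_nonneg _) ((abs_nonneg _).trans (hM' t ht))

/-- Integration by parts along the path. -/
lemma drift_mul_discountedMarginal (hM : IsMarkov S) (hf : ContDiffOn ℝ 2 f (Ioi 0))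
    (hC : ConvergesTo f S kstar) (hk : k ∈ S.dom) (hr : 0 < r) :
    drift f S k * discountedMarginal f S r k =
      r * discountedUtility f S r k - Real.log (S.rate k) := by
  have hP := hC.isPath_flow hk
  obtain ⟨hℓc, M, hM'⟩ := hC.continuousOn_bounded_comp_flow hM hf hk hM.continuousOn_log
  have hi1 := (integrableOn_exp_mul hr hℓc hM').const_mul r
  have hi2 := (hC.integrableOn_marginal hM hf hk hr).const_mul (drift f S k)
  have h := integral_Ioi_of_hasDerivAt_of_tendsto (a := 0) (m := 0)
    (f := fun t => Real.exp (-r * t) * Real.log (S.rate (flow f S k t)))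
    (f' := fun t => drift f S k * (Real.exp (-r * t) *
        (deriv S.rate (flow f S k t) / S.rate (flow f S k t) * variation f S k 1 t)) -
      r * (Real.exp (-r * t) * Real.log (S.rate (flow f S k t))))
    ?_ ?_ (hi2.sub hi1) (tendsto_exp_neg_mul_mul_bdd hr hM')
  · rw [integral_sub hi2 hi1, integral_const_mul, integral_const_mul] at h
    simp only [hP.1, mul_zero, Real.exp_zero, one_mul] at h
    rw [discountedMarginal, discountedUtility]
    linarith
  · exact (by fun_prop : Continuous fun t : ℝ => Real.exp (-r * t)).continuousWithinAt.mul
      (hℓc 0 self_mem_Ici)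
  · intro t ht
    have ht' : (0 : ℝ) ≤ t := le_of_lt ht
    have h1 : HasDerivAt (fun t : ℝ => Real.exp (-r * t)) (Real.exp (-r * t) * -r) t := by
      simpa using ((hasDerivAt_id t).const_mul (-r)).exp
    have h2 := ((hM.hasDerivAt (hP.mem ht')).comp t (hP.hasDerivAt ht)).log
      (hM.rate_pos _ (hP.mem ht')).ne'
    refine (h1.mul h2).congr_deriv ?_
    rw [hC.drift_flow hM hf hk ht']
    simp only [Function.comp_apply]
    ring

lemma discountedMarginal_kstar (hM : IsMarkov S) (hf : ContDiffOn ℝ 2 f (Ioi 0))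
    (hC : ConvergesTo f S kstar) (hr : 0 < r) :
    discountedMarginal f S r kstar = deriv S.rate kstar / S.rate kstar /
      (r - (deriv f kstar - deriv S.rate kstar)) := by
  have hm := hC.slope_nonpos hM hf
  set m := deriv f kstar - deriv S.rate kstar with hmdef
  rw [discountedMarginal, setIntegral_congr_fun (g := fun t =>
    Real.exp (-(r - m) * t) * (deriv S.rate kstar / S.rate kstar)) measurableSet_Ioi
    (fun t ht => ?_), integral_mul_const, integral_exp_neg_mul (by linarith)]
  · ring
  · simp only [hC.flow_kstar hM hf (le_of_lt ht), hC.variation_kstar hM hf (le_of_lt ht)]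
    rw [show -(r - m) * t = -r * t + m * t by ring, Real.exp_add]
    ring

lemma P1_eq (hM : IsMarkov S) (hf : ContDiffOn ℝ 2 f (Ioi 0))
    (hC : ConvergesTo f S kstar) (hk : k ∈ S.dom) (hr₁ : 0 < r₁) (hr₂ : 0 < r₂) (c : ℝ) :
    P1 f Real.log (mixedDiscount A B r₁ r₂) S k c =
      Real.log c - Real.log (S.rate k) + (S.rate k - c) *
        (A * discountedMarginal f S r₁ k + B * discountedMarginal f S r₂ k) := by
  rw [P1, discountedMarginal, discountedMarginal, ← integral_const_mul, ← integral_const_mul,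
    ← integral_add ((hC.integrableOn_marginal hM hf hk hr₁).const_mul A)
      ((hC.integrableOn_marginal hM hf hk hr₂).const_mul B), ← integral_const_mul]
  congr 1
  refine setIntegral_congr_fun measurableSet_Ioi fun t ht => ?_
  simp only [hC.variation_eq_mul hM hf hk (S.rate k - c) (le_of_lt ht), Real.deriv_log,
    mixedDiscount]
  ring

/-- The first-order condition: the marginal utility of consumption equals the marginal value of
capital. -/
lemma isMaxOn_P1_iff (hM : IsMarkov S) (hf : ContDiffOn ℝ 2 f (Ioi 0))
    (hC : ConvergesTo f S kstar) (hk : k ∈ S.dom) (hr₁ : 0 < r₁) (hr₂ : 0 < r₂) :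
    IsMaxOn (P1 f Real.log (mixedDiscount A B r₁ r₂) S k) (Ioi 0) (S.rate k) ↔
      A * discountedMarginal f S r₁ k + B * discountedMarginal f S r₂ k = 1 / S.rate k := by
  set I := A * discountedMarginal f S r₁ k + B * discountedMarginal f S r₂ k with hI
  have hσ := hM.rate_pos k hk
  have hP : P1 f Real.log (mixedDiscount A B r₁ r₂) S k = fun c =>
      Real.log c - Real.log (S.rate k) + (S.rate k - c) * I :=
    funext fun c => hC.P1_eq hM hf hk hr₁ hr₂ c
  rw [hP]
  constructor
  · intro hmax
    have hd : HasDerivAt (fun c => Real.log c - Real.log (S.rate k) + (S.rate k - c) * I)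
        ((S.rate k)⁻¹ + -1 * I) (S.rate k) :=
      ((Real.hasDerivAt_log hσ.ne').sub_const _).add
        (((hasDerivAt_id (S.rate k)).const_sub (S.rate k)).mul_const I)
    have := (hmax.isLocalMax (Ioi_mem_nhds hσ)).hasDerivAt_eq_zero hd
    rw [one_div]; linarith
  · intro h c hc
    have hc' : (0 : ℝ) < c := hc
    have hlog := Real.log_le_sub_one_of_pos (div_pos hc' hσ)
    rw [Real.log_div hc'.ne' hσ.ne'] at hlog
    simp only [mem_ofPred_eq, h, sub_self, zero_mul, add_zero]
    have : (S.rate k - c) * (1 / S.rate k) = 1 - c / S.rate k := by field_simp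
    linarith

/-- The first-order condition away from the steady state, in terms of discounted utilities. -/
lemma isMaxOn_P1_iff_of_ne (hM : IsMarkov S) (hf : ContDiffOn ℝ 2 f (Ioi 0))
    (hC : ConvergesTo f S kstar) (hw : IsMixture A B r₁ r₂) (hk : k ∈ S.dom) (hne : k ≠ kstar) :
    IsMaxOn (P1 f Real.log (mixedDiscount A B r₁ r₂) S k) (Ioi 0) (S.rate k) ↔
      A * (r₁ * discountedUtility f S r₁ k) + B * (r₂ * discountedUtility f S r₂ k) =
        Real.log (S.rate k) + drift f S k / S.rate k := by
  have hr₁ := hw.rate_pos.trans hw.rate_lt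
  rw [hC.isMaxOn_P1_iff hM hf hk hr₁ hw.rate_pos]
  have hg := hC.drift_ne_zero hM hf hk hne
  have h1 := hC.drift_mul_discountedMarginal hM hf hk hr₁
  have h2 := hC.drift_mul_discountedMarginal hM hf hk hw.rate_pos
  rw [← mul_right_inj' hg, mul_add, mul_left_comm, h1, mul_left_comm, h2, mul_one_div]
  have hAB := hw.add_eq
  constructor <;> intro h
  · linear_combination h + Real.log (S.rate k) * hAB
  · linear_combination h - Real.log (S.rate k) * hAB

/-- The first-order condition at the steady state: the path is constant and the variation is an
exponential, so that it is a quadratic relation for the slope of the strategy. -/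
lemma isMaxOn_P1_kstar_iff (hM : IsMarkov S) (hf : ContDiffOn ℝ 2 f (Ioi 0))
    (hC : ConvergesTo f S kstar) (hw : IsMixture A B r₁ r₂) :
    IsMaxOn (P1 f Real.log (mixedDiscount A B r₁ r₂) S kstar) (Ioi 0) (S.rate kstar) ↔
      deriv S.rate kstar * (A * (r₂ - (deriv f kstar - deriv S.rate kstar)) +
          B * (r₁ - (deriv f kstar - deriv S.rate kstar))) =
        (r₁ - (deriv f kstar - deriv S.rate kstar)) *
          (r₂ - (deriv f kstar - deriv S.rate kstar)) := by
  have hr₁ := hw.rate_pos.trans hw.rate_lt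
  rw [hC.isMaxOn_P1_iff hM hf hC.1 hr₁ hw.rate_pos, hC.discountedMarginal_kstar hM hf hr₁,
    hC.discountedMarginal_kstar hM hf hw.rate_pos]
  have hm := hC.slope_nonpos hM hf
  have hr₂ := hw.rate_pos
  set m := deriv f kstar - deriv S.rate kstar with hmdef
  have h1 : r₁ - m ≠ 0 := by linarith
  have h2 : r₂ - m ≠ 0 := by linarith
  have h3 := (hM.rate_pos kstar hC.1).ne'
  rw [eq_div_iff h3]
  constructor
  · intro h
    field_simp at h
    linear_combination h
  · intro h
    field_simp
    linear_combination h

lemma welfare_eq (hM : IsMarkov S) (hf : ContDiffOn ℝ 2 f (Ioi 0))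
    (hC : ConvergesTo f S kstar) (hk : k ∈ S.dom) (hr₁ : 0 < r₁) (hr₂ : 0 < r₂) :
    welfare f Real.log (mixedDiscount A B r₁ r₂) S k =
      A * discountedUtility f S r₁ k + B * discountedUtility f S r₂ k := by
  obtain ⟨hℓc, M, hM'⟩ := hC.continuousOn_bounded_comp_flow hM hf hk hM.continuousOn_log
  rw [welfare, discountedUtility, discountedUtility, ← integral_const_mul, ← integral_const_mul,
    ← integral_add ((integrableOn_exp_mul hr₁ hℓc hM').const_mul A)
      ((integrableOn_exp_mul hr₂ hℓc hM').const_mul B)]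
  refine setIntegral_congr_fun measurableSet_Ioi fun t _ => ?_
  simp only [mixedDiscount]
  ring

end ConvergesTo

/-- A function continuous at a point, whose derivative extends continuously to that point, is
differentiable there. -/
lemma hasDerivAt_of_eventually_ne {F D : ℝ → ℝ} {x : ℝ}
    (hF : ∀ᶠ y in 𝓝[≠] x, HasDerivAt F (D y) y) (hFc : ContinuousAt F x)
    (hD : ContinuousAt D x) : HasDerivAt F (D x) x := by
  have hlim : Tendsto (deriv F) (𝓝[≠] x) (𝓝 (D x)) :=
    (hD.tendsto.mono_left nhdsWithin_le_nhds).congr' (hF.mono fun y hy => hy.deriv.symm)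
  have hr : 𝓝[>] x ≤ 𝓝[≠] x := nhdsWithin_mono x fun y (hy : x < y) => hy.ne'
  have hl : 𝓝[<] x ≤ 𝓝[≠] x := nhdsWithin_mono x fun y (hy : y < x) => hy.ne
  have h1 : HasDerivWithinAt F (D x) (Ici x) x :=
    hasDerivWithinAt_Ici_of_tendsto_deriv (s := {y | HasDerivAt F (D y) y})
      (fun y hy => (HasDerivAt.differentiableAt hy).differentiableWithinAt)
      hFc.continuousWithinAt (hr hF) (hlim.mono_left hr)
  have h2 : HasDerivWithinAt F (D x) (Iic x) x :=
    hasDerivWithinAt_Iic_of_tendsto_deriv (s := {y | HasDerivAt F (D y) y})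
      (fun y hy => (HasDerivAt.differentiableAt hy).differentiableWithinAt)
      hFc.continuousWithinAt (hl hF) (hlim.mono_left hl)
  have := h1.union h2
  rwa [Ici_union_Iic, hasDerivWithinAt_univ] at this

namespace IsEquilibrium

/-- Along an equilibrium the marginal value of capital is the marginal utility of consumption. -/
lemma hasDerivAt_welfare (hw : IsMixture A B r₁ r₂) (hf : ContDiffOn ℝ 2 f (Ioi 0))
    (hS : IsEquilibrium f Real.log (mixedDiscount A B r₁ r₂) S kstar) (hk : k ∈ S.dom) :
    HasDerivAt (welfare f Real.log (mixedDiscount A B r₁ r₂) S) (1 / S.rate k) k := by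
  have hM := hS.isMarkov
  have hC := hS.convergesTo
  have hr₂ := hw.rate_pos
  have hr₁ := hr₂.trans hw.rate_lt
  have hev : ∀ x ∈ S.dom, welfare f Real.log (mixedDiscount A B r₁ r₂) S =ᶠ[𝓝 x]
      fun k => A * discountedUtility f S r₁ k + B * discountedUtility f S r₂ k := fun x hx => by
    filter_upwards [hM.isOpen.mem_nhds hx] with y hy using hC.welfare_eq hM hf hy hr₁ hr₂
  have hne : ∀ x ∈ S.dom, x ≠ kstar →
      HasDerivAt (welfare f Real.log (mixedDiscount A B r₁ r₂) S) (1 / S.rate x) x := by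
    intro x hx hxne
    refine HasDerivAt.congr_of_eventuallyEq ?_ (hev x hx)
    refine (((hC.hasDerivAt_discountedUtility hM hf hr₁ hx hxne).const_mul A).add
      ((hC.hasDerivAt_discountedUtility hM hf hr₂ hx hxne).const_mul B)).congr_deriv ?_
    have h1 := (hC.isMaxOn_P1_iff_of_ne hM hf hw hx hxne).1 (hS.isMaxOn x hx)
    have hg := hC.drift_ne_zero hM hf hx hxne
    have hσ := (hM.rate_pos x hx).ne'
    have h2 : A * ((r₁ * discountedUtility f S r₁ x - Real.log (S.rate x)) / drift f S x) +
        B * ((r₂ * discountedUtility f S r₂ x - Real.log (S.rate x)) / drift f S x) =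
        (A * (r₁ * discountedUtility f S r₁ x) + B * (r₂ * discountedUtility f S r₂ x) -
          Real.log (S.rate x) * (A + B)) / drift f S x := by ring
    rw [h2, h1, hw.add_eq]
    field_simp
    ring
  by_cases h : k = kstar
  · subst h
    refine hasDerivAt_of_eventually_ne (D := fun x => 1 / S.rate x) ?_ ?_ ?_
    · filter_upwards [mem_nhdsWithin_of_mem_nhds (hM.isOpen.mem_nhds hk), self_mem_nhdsWithin]
        with x hx hx' using hne x hx hx'
    · refine ContinuousAt.congr ?_ (hev k hk).symm
      exact ((hC.continuousAt_discountedUtility_kstar hM hf hr₁).const_mul A).add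
        ((hC.continuousAt_discountedUtility_kstar hM hf hr₂).const_mul B)
    · exact continuousAt_const.div (hM.hasDerivAt hk).continuousAt (hM.rate_pos k hk).ne'
  · exact hne k hk h

lemma rate_kstar (hf : ContDiffOn ℝ 2 f (Ioi 0)) {h : ℝ → ℝ}
    (hS : IsEquilibrium f Real.log h S kstar) : S.rate kstar = f kstar := by
  have := hS.convergesTo.drift_kstar hS.isMarkov hf
  rw [drift] at this
  linarith

/-- At its steady state the consumption of an equilibrium is `f`, for ever. -/
lemma welfare_kstar (hw : IsMixture A B r₁ r₂) (hf : ContDiffOn ℝ 2 f (Ioi 0))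
    (hS : IsEquilibrium f Real.log (mixedDiscount A B r₁ r₂) S kstar) :
    welfare f Real.log (mixedDiscount A B r₁ r₂) S kstar =
      (A / r₁ + B / r₂) * Real.log (f kstar) := by
  have hM := hS.isMarkov
  have hC := hS.convergesTo
  have hr₁ := hw.rate_pos.trans hw.rate_lt
  rw [hC.welfare_eq hM hf hC.1 hr₁ hw.rate_pos, hC.discountedUtility_kstar hM hf hr₁,
    hC.discountedUtility_kstar hM hf hw.rate_pos, hS.rate_kstar hf]
  ring

end IsEquilibrium

end

/-! ### The differential equations of an equilibrium -/

/-- The share, in the marginal utility of consumption, of the marginal value of capital that is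
discounted at the rate `r₂`. It is meaningful away from the steady state. -/
noncomputable def valueShare (f : ℝ → ℝ) (S : Strategy) (B r₂ k : ℝ) : ℝ :=
  B * S.rate k * (r₂ * discountedUtility f S r₂ k - Real.log (S.rate k)) / drift f S k

/-- The slope of an equilibrium strategy at a steady state `k`. -/
noncomputable def steadySlope (f : ℝ → ℝ) (A B r₁ r₂ k : ℝ) : ℝ :=
  (r₁ - deriv f k) * (deriv f k - r₂) / (A * r₁ + B * r₂ - deriv f k)

/-- The regular part of the second-order equation of an equilibrium, at the capital `k`, the
consumption `c` and the slope `z` of the strategy. -/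
noncomputable def slopeCorrection (f : ℝ → ℝ) (A B r₁ r₂ k c z : ℝ) : ℝ :=
  (2 * f k * (z / c) ^ 2 + (r₁ + r₂ - 3 * deriv f k) * (z / c) + deriv (deriv f) k) /
    (A * r₁ + B * r₂ - deriv f k)

section

variable {f : ℝ → ℝ} {S : Strategy} {k kstar A B r₁ r₂ : ℝ}

namespace IsEquilibrium

/-- The Euler equation. -/
lemma drift_mul_deriv_rate (hw : IsMixture A B r₁ r₂) (hf : ContDiffOn ℝ 2 f (Ioi 0))
    (hS : IsEquilibrium f Real.log (mixedDiscount A B r₁ r₂) S kstar) (hk : k ∈ S.dom)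
    (hne : k ≠ kstar) :
    drift f S k * deriv S.rate k =
      S.rate k * (deriv f k - r₁ + (r₁ - r₂) * valueShare f S B r₂ k) := by
  have hM := hS.isMarkov
  have hC := hS.convergesTo
  have hr₂ := hw.rate_pos
  have hr₁ := hr₂.trans hw.rate_lt
  have hσ := (hM.rate_pos k hk).ne'
  have hg := hC.drift_ne_zero hM hf hk hne
  have heq : ∀ x ∈ S.dom, x ≠ kstar →
      A * (r₁ * discountedUtility f S r₁ x) + B * (r₂ * discountedUtility f S r₂ x) =
        Real.log (S.rate x) + drift f S x / S.rate x := fun x hx hxne =>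
    (hC.isMaxOn_P1_iff_of_ne hM hf hw hx hxne).1 (hS.isMaxOn x hx)
  have hL := ((((hC.hasDerivAt_discountedUtility hM hf hr₁ hk hne).const_mul r₁).const_mul A).add
      (((hC.hasDerivAt_discountedUtility hM hf hr₂ hk hne).const_mul r₂).const_mul B))
  have hR := ((hM.hasDerivAt hk).log hσ).add
    ((hM.hasDerivAt_drift hf hk).div (hM.hasDerivAt hk) hσ)
  have hev : (fun x => Real.log (S.rate x) + drift f S x / S.rate x) =ᶠ[𝓝 k]
      fun x => A * (r₁ * discountedUtility f S r₁ x) + B * (r₂ * discountedUtility f S r₂ x) := by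
    filter_upwards [hM.isOpen.mem_nhds hk, isOpen_ne.mem_nhds hne] with x hx hx'
      using (heq x hx hx').symm
  have hd := (hL.congr_of_eventuallyEq hev).unique hR
  have h0 := heq k hk hne
  rw [valueShare]
  have hAB := hw.add_eq
  set g := drift f S k
  set σ := S.rate k
  set z := deriv S.rate k
  set φ := deriv f k
  set U₁ := discountedUtility f S r₁ k
  set U₂ := discountedUtility f S r₂ k
  set L := Real.log σ
  field_simp at hd h0 ⊢
  -- eliminate the first component of the value by the equilibrium condition
  have hA : A = 1 - B := by linarith
  subst hA
  linear_combination hd - r₁ * σ * h0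

/-- With the Euler equation, this is a first-order system for the strategy and the share. -/
lemma hasDerivAt_valueShare (hw : IsMixture A B r₁ r₂) (hf : ContDiffOn ℝ 2 f (Ioi 0))
    (hS : IsEquilibrium f Real.log (mixedDiscount A B r₁ r₂) S kstar) (hk : k ∈ S.dom)
    (hne : k ≠ kstar) :
    HasDerivAt (valueShare f S B r₂)
      ((-(r₁ - r₂) * valueShare f S B r₂ k * (1 - valueShare f S B r₂ k) +
        deriv S.rate k * (valueShare f S B r₂ k - B)) / drift f S k) k := by
  have hM := hS.isMarkov
  have hC := hS.convergesTo
  have hr₂ := hw.rate_pos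
  have hσ := (hM.rate_pos k hk).ne'
  have hg := hC.drift_ne_zero hM hf hk hne
  have hE := hS.drift_mul_deriv_rate hw hf hk hne
  have h := ((((hM.hasDerivAt hk).const_mul B).mul
    (((hC.hasDerivAt_discountedUtility hM hf hr₂ hk hne).const_mul r₂).sub
      ((hM.hasDerivAt hk).log hσ))).div (hM.hasDerivAt_drift hf hk) hg)
  refine h.congr_deriv ?_
  have hy : r₂ * discountedUtility f S r₂ k - Real.log (S.rate k) =
      valueShare f S B r₂ k * drift f S k / (B * S.rate k) := by
    have := hw.right_pos.ne'
    rw [valueShare]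
    field_simp
  have hB := hw.right_pos.ne'
  simp only [Pi.sub_apply, Pi.mul_apply] at *
  rw [hy]
  set y := valueShare f S B r₂ k
  set g := drift f S k
  set σ := S.rate k
  set z := deriv S.rate k
  set φ := deriv f k
  field_simp
  linear_combination y * hE

lemma tendsto_valueShare (hw : IsMixture A B r₁ r₂) (hf : ContDiffOn ℝ 2 f (Ioi 0))
    (hS : IsEquilibrium f Real.log (mixedDiscount A B r₁ r₂) S kstar) :
    Tendsto (valueShare f S B r₂) (𝓝[≠] kstar) (𝓝 ((r₁ - deriv f kstar) / (r₁ - r₂))) := by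
  have hM := hS.isMarkov
  have hC := hS.convergesTo
  have hΔ : r₁ - r₂ ≠ 0 := (sub_pos.2 hw.rate_lt).ne'
  have hnhds := hM.isOpen.mem_nhds hC.1
  have hσ := hM.rate_pos kstar hC.1
  have hcont : ContinuousAt
      (fun k => (drift f S k * deriv S.rate k / S.rate k + r₁ - deriv f k) / (r₁ - r₂)) kstar :=
    (((((hM.continuousOn_drift hf).continuousAt hnhds).mul
      (hM.continuousOn_deriv.continuousAt hnhds)).div (hM.hasDerivAt hC.1).continuousAt
        hσ.ne').add_const r₁ |>.sub ((continuousOn_deriv_of_contDiffOn hf).continuousAt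
          (Ioi_mem_nhds (hM.pos hC.1)))).div_const _
  have h := hcont.tendsto
  simp only [hC.drift_kstar hM hf, zero_mul, zero_div, zero_add] at h
  refine (h.mono_left nhdsWithin_le_nhds).congr' ?_
  filter_upwards [mem_nhdsWithin_of_mem_nhds hnhds, self_mem_nhdsWithin] with x hx hx'
  have hσx := (hM.rate_pos x hx).ne'
  rw [hS.drift_mul_deriv_rate hw hf hx hx']
  field_simp
  ring

/-- The second-order equation of an equilibrium, singular at the steady state. -/
lemma hasDerivAt_deriv_rate (hw : IsMixture A B r₁ r₂) (hf : ContDiffOn ℝ 2 f (Ioi 0))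
    (hS : IsEquilibrium f Real.log (mixedDiscount A B r₁ r₂) S kstar) (hk : k ∈ S.dom)
    (hne : k ≠ kstar) (hα : deriv f k < A * r₁ + B * r₂) :
    HasDerivAt (deriv S.rate)
      (S.rate k * (A * r₁ + B * r₂ - deriv f k) / drift f S k ^ 2 *
        (deriv S.rate k - steadySlope f A B r₁ r₂ k +
          drift f S k * slopeCorrection f A B r₁ r₂ k (S.rate k) (deriv S.rate k))) k := by
  have hM := hS.isMarkov
  have hC := hS.convergesTo
  have hσ := (hM.rate_pos k hk).ne'
  have hg := hC.drift_ne_zero hM hf hk hne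
  have hE := hS.drift_mul_deriv_rate hw hf hk hne
  have hev : deriv S.rate =ᶠ[𝓝 k] fun x =>
      S.rate x * (deriv f x - r₁ + (r₁ - r₂) * valueShare f S B r₂ x) / drift f S x := by
    filter_upwards [hM.isOpen.mem_nhds hk, isOpen_ne.mem_nhds hne] with x hx hx'
    rw [← hS.drift_mul_deriv_rate hw hf hx hx',
      mul_div_cancel_left₀ _ (hC.drift_ne_zero hM hf hx hx')]
  have h := ((hM.hasDerivAt hk).mul (((hasDerivAt_deriv_of_contDiffOn hf (hM.pos hk)).sub_const
    r₁).add ((hS.hasDerivAt_valueShare hw hf hk hne).const_mul (r₁ - r₂)))).div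
      (hM.hasDerivAt_drift hf hk) hg
  refine (HasDerivAt.congr_of_eventuallyEq h hev).congr_deriv ?_
  have hα' : A * r₁ + B * r₂ - deriv f k ≠ 0 := by linarith
  have hΔ : r₁ - r₂ ≠ 0 := (sub_pos.2 hw.rate_lt).ne'
  have hy : valueShare f S B r₂ k =
      (drift f S k * deriv S.rate k / S.rate k + r₁ - deriv f k) / (r₁ - r₂) := by
    rw [hE]; field_simp; ring
  rw [steadySlope, slopeCorrection]
  simp only [Pi.add_apply, Pi.mul_apply]
  rw [hy]
  have hfk : f k = drift f S k + S.rate k := by rw [drift]; ring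
  rw [hfk]
  have hclear : ∀ a N R : ℝ, a ≠ 0 → S.rate k * a / drift f S k ^ 2 *
      (deriv S.rate k - N / a + drift f S k * (R / a)) =
      S.rate k / drift f S k ^ 2 * (a * deriv S.rate k - N + drift f S k * R) := by
    intro a N R ha
    field_simp
  rw [hclear _ _ _ hα']
  have hA : A = 1 - B := by linarith [hw.add_eq]
  subst hA
  set g := drift f S k
  set σ := S.rate k
  set z := deriv S.rate k
  set φ := deriv f k
  field_simp
  ring

/-- A steady state where the marginal product of capital exceeds the long-run discount rate:
the marginal product is below the mean of the rates, and the slope of the strategy is determined. -/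
lemma steady_state (hw : IsMixture A B r₁ r₂) (hf : ContDiffOn ℝ 2 f (Ioi 0))
    (hS : IsEquilibrium f Real.log (mixedDiscount A B r₁ r₂) S kstar)
    (hφ : r₁ * r₂ < (A * r₂ + B * r₁) * deriv f kstar) :
    0 < A ∧ r₂ < deriv f kstar ∧ deriv f kstar < A * r₁ + B * r₂ ∧
      deriv S.rate kstar = steadySlope f A B r₁ r₂ kstar ∧ deriv f kstar < deriv S.rate kstar := by
  have hM := hS.isMarkov
  have hC := hS.convergesTo
  have hm := hC.slope_nonpos hM hf
  have h := (hC.isMaxOn_P1_kstar_iff hM hf hw).1 (hS.isMaxOn kstar hC.1)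
  have hAB := hw.add_eq
  have hA0 := hw.left_nonneg
  have hB := hw.right_pos
  have hr₂ := hw.rate_pos
  have hlt := hw.rate_lt
  have hr₁ := hr₂.trans hlt
  set φ := deriv f kstar with hφdef
  set z := deriv S.rate kstar with hzdef
  have hA : A = 1 - B := by linarith
  -- the condition is linear in the slope `φ - z` of the drift
  have hlin : (A * r₂ + B * r₁) * φ - r₁ * r₂ = (φ - z) * (φ - (A * r₁ + B * r₂)) := by
    subst hA
    linear_combination h
  have hpos : 0 < (φ - z) * (φ - (A * r₁ + B * r₂)) := by linarith
  have hneg : φ - z < 0 := lt_of_le_of_ne hm (fun h0 => by rw [h0, zero_mul] at hpos; exact hpos.false)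
  have hφδ : φ - (A * r₁ + B * r₂) < 0 := by
    by_contra hge
    exact absurd hpos (not_lt.2 (mul_nonpos_of_nonpos_of_nonneg hneg.le (not_lt.1 hge)))
  have hφr : r₂ < φ := by
    by_contra hge
    have h1 : (A * r₂ + B * r₁) * φ ≤ (A * r₂ + B * r₁) * r₂ :=
      mul_le_mul_of_nonneg_left (not_lt.1 hge) (by positivity)
    have h2 : A * r₂ + B * r₁ ≤ r₁ := by subst hA; nlinarith
    nlinarith
  refine ⟨?_, hφr, by linarith, ?_, by linarith⟩
  · by_contra hA'
    have : A = 0 := le_antisymm (not_lt.1 hA') hA0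
    subst hA
    nlinarith
  · rw [steadySlope, ← hφdef, eq_div_iff (by linarith)]
    subst hA
    linear_combination -h

end IsEquilibrium

end

/-! ### Equilibria with nearby steady states -/

section

variable {f : ℝ → ℝ} {S : Strategy} {k kbar kstar A B r₁ r₂ : ℝ}

namespace IsEquilibrium

lemma hasDerivWithinAt_valueShare_flow (hw : IsMixture A B r₁ r₂) (hf : ContDiffOn ℝ 2 f (Ioi 0))
    (hS : IsEquilibrium f Real.log (mixedDiscount A B r₁ r₂) S kstar) (hk : k ∈ S.dom)
    (hne : k ≠ kstar) {t : ℝ} (ht : 0 ≤ t) :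
    HasDerivWithinAt (fun s => valueShare f S B r₂ (flow f S k s))
      (-(r₁ - r₂) * valueShare f S B r₂ (flow f S k t) *
          (1 - valueShare f S B r₂ (flow f S k t)) +
        deriv S.rate (flow f S k t) * (valueShare f S B r₂ (flow f S k t) - B)) (Ici 0) t := by
  have hM := hS.isMarkov
  have hC := hS.convergesTo
  have hP := hC.isPath_flow hk
  have hne' := hC.flow_ne hM hf hk hne ht
  have h := (hS.hasDerivAt_valueShare hw hf (hP.mem ht) hne').comp_hasDerivWithinAt t
    (hP.hasDerivWithinAt ht)
  exact h.congr_deriv (div_mul_cancel₀ _ (hC.drift_ne_zero hM hf (hP.mem ht) hne'))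

lemma tendsto_valueShare_flow (hw : IsMixture A B r₁ r₂) (hf : ContDiffOn ℝ 2 f (Ioi 0))
    (hS : IsEquilibrium f Real.log (mixedDiscount A B r₁ r₂) S kstar) (hk : k ∈ S.dom)
    (hne : k ≠ kstar) :
    Tendsto (fun s => valueShare f S B r₂ (flow f S k s)) atTop
      (𝓝 ((r₁ - deriv f kstar) / (r₁ - r₂))) := by
  refine (hS.tendsto_valueShare hw hf).comp (tendsto_nhdsWithin_iff.2
    ⟨hS.convergesTo.tendsto_flow hk, ?_⟩)
  filter_upwards [eventually_ge_atTop 0] with t ht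
  exact hS.convergesTo.flow_ne hS.isMarkov hf hk hne ht

/-- The share cannot fall to the weight `B`: it would stay below it along the path, whereas it is
larger at the steady state. -/
lemma lt_valueShare (hw : IsMixture A B r₁ r₂) (hf : ContDiffOn ℝ 2 f (Ioi 0))
    (hS : IsEquilibrium f Real.log (mixedDiscount A B r₁ r₂) S kstar) (hk : k ∈ S.dom)
    (hne : k ≠ kstar) (hA : 0 < A) (hφ : deriv f kstar < A * r₁ + B * r₂) :
    B < valueShare f S B r₂ k := by
  by_contra hle
  have hΔ : 0 < r₁ - r₂ := sub_pos.2 hw.rate_lt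
  have hAB := hw.add_eq
  have hB := hw.right_pos
  have hP := hS.convergesTo.isPath_flow hk
  have hd := fun t ht => hS.hasDerivWithinAt_valueShare_flow hw hf hk hne (t := t) ht
  have hbd : ∀ T, 0 ≤ T → valueShare f S B r₂ (flow f S k T) ≤ B := by
    intro T hT
    refine image_le_of_deriv_right_lt_deriv_boundary (a := 0) (b := T) (B := fun _ => B)
      (B' := fun _ => 0) (fun t ht => (hd t ht.1).continuousWithinAt.mono Icc_subset_Ici_self)
      (fun t ht => (hd t ht.1).mono (Ici_subset_Ici.2 ht.1)) (by rw [hP.1]; exact not_lt.1 hle)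
      (fun t => hasDerivAt_const t B) (fun t _ h => ?_) (right_mem_Icc.2 hT)
    rw [h, sub_self, mul_zero, add_zero]
    have : 0 < (r₁ - r₂) * B * A := by positivity
    rw [show A = 1 - B by linarith] at this
    linarith
  have hlim := le_of_tendsto (hS.tendsto_valueShare_flow hw hf hk hne)
    ((eventually_ge_atTop 0).mono hbd)
  rw [div_le_iff₀ hΔ] at hlim
  have : A = 1 - B := by linarith
  subst this
  nlinarith

/-- Below the steady state the share cannot reach `1`: it would stay above it along the path,
whereas it is smaller at the steady state. -/
lemma valueShare_lt (hw : IsMixture A B r₁ r₂) (hf : ContDiffOn ℝ 2 f (Ioi 0))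
    (hS : IsEquilibrium f Real.log (mixedDiscount A B r₁ r₂) S kstar) (hk : k ∈ S.dom)
    (hlt : k < kstar) (hA : 0 < A) (hφ : ∀ x ∈ Icc k kstar, r₂ < deriv f x) :
    valueShare f S B r₂ k < 1 := by
  by_contra hle
  have hM := hS.isMarkov
  have hC := hS.convergesTo
  have hΔ : 0 < r₁ - r₂ := sub_pos.2 hw.rate_lt
  have hAB := hw.add_eq
  have hP := hC.isPath_flow hk
  have hd := fun t ht => (hS.hasDerivWithinAt_valueShare_flow hw hf hk hlt.ne (t := t) ht).neg
  have hbd : ∀ T, 0 ≤ T → -valueShare f S B r₂ (flow f S k T) ≤ -1 := by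
    intro T hT
    refine image_le_of_deriv_right_lt_deriv_boundary (a := 0) (b := T) (B := fun _ => -1)
      (B' := fun _ => 0) (fun t ht => (hd t ht.1).continuousWithinAt.mono Icc_subset_Ici_self)
      (fun t ht => (hd t ht.1).mono (Ici_subset_Ici.2 ht.1))
      (by simpa [hP.1] using not_lt.1 hle)
      (fun t => hasDerivAt_const t (-1)) (fun t ht h => ?_) (right_mem_Icc.2 hT)
    have h1 : valueShare f S B r₂ (flow f S k t) = 1 := neg_inj.1 h
    rw [h1, sub_self, mul_zero, zero_add, neg_lt_zero]
    have hmem := hC.flow_mem_Ico hM hf hk hlt ht.1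
    have hE := hS.drift_mul_deriv_rate hw hf (hP.mem ht.1) hmem.2.ne
    rw [h1, mul_one] at hE
    have hg := hC.drift_pos hM hf (hP.mem ht.1) hmem.2
    have hpos : 0 < drift f S (flow f S k t) * deriv S.rate (flow f S k t) := by
      rw [hE]
      refine mul_pos (hM.rate_pos _ (hP.mem ht.1)) ?_
      linarith [hφ _ (Ico_subset_Icc_self hmem)]
    exact mul_pos ((mul_pos_iff_of_pos_left hg).1 hpos) (by linarith)
  have hlim := le_of_tendsto (hS.tendsto_valueShare_flow hw hf hk hlt.ne).neg
    ((eventually_ge_atTop 0).mono hbd)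
  rw [neg_le_neg_iff, le_div_iff₀ hΔ] at hlim
  linarith [hφ kstar (right_mem_Icc.2 hlt.le)]

/-- The distance of an equilibrium strategy to the graph of `f` is controlled by the distance to
the steady state, uniformly over all equilibrium strategies. -/
lemma drift_sq_le (hw : IsMixture A B r₁ r₂) (hf : ContDiffOn ℝ 2 f (Ioi 0))
    (hS : IsEquilibrium f Real.log (mixedDiscount A B r₁ r₂) S kstar) (hk : k ∈ S.dom)
    (hA : 0 < A) (hφ : ∀ x ∈ uIcc k kstar, r₂ < deriv f x ∧ deriv f x < A * r₁ + B * r₂)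
    {F : ℝ} (hF0 : 0 ≤ F) (hF : ∀ x ∈ uIcc k kstar, f x ≤ F) :
    drift f S k ^ 2 ≤
      (F + 1) * (Real.exp (2 * (A * r₁ + B * r₂) * |k - kstar|) - 1) := by
  have hM := hS.isMarkov
  have hC := hS.convergesTo
  have hr₂ := hw.rate_pos
  have hsub := hC.uIcc_subset_dom hk
  set d := A * r₁ + B * r₂ with hd
  set ψ : ℝ → ℝ := fun x => Real.log (F + 1 + drift f S x ^ 2) with hψ
  have hpos : ∀ x, 0 < F + 1 + drift f S x ^ 2 := fun x => by positivity
  have hψ' : ∀ x ∈ uIcc k kstar, HasDerivAt ψ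
      (2 * drift f S x * (deriv f x - deriv S.rate x) / (F + 1 + drift f S x ^ 2)) x := by
    intro x hx
    refine ((((hM.hasDerivAt_drift hf (hsub hx)).pow 2).const_add (F + 1)).log
      (hpos x).ne').congr_deriv ?_
    simp
  -- away from the steady state the logarithmic growth rate is at most `2 d`
  have hright : ∀ x ∈ uIcc k kstar, kstar < x →
      2 * drift f S x * (deriv f x - deriv S.rate x) / (F + 1 + drift f S x ^ 2) ≤ 2 * d := by
    intro x hx hlt
    rw [div_le_iff₀ (hpos x)]
    have hE := hS.drift_mul_deriv_rate hw hf (hsub hx) hlt.ne'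
    have hy := hS.lt_valueShare hw hf (hsub hx) hlt.ne' hA (hφ kstar right_mem_uIcc).2
    have hg := hC.drift_neg hM hf (hsub hx) hlt
    have hσ := hM.rate_pos x (hsub hx)
    have hσe : S.rate x = f x - drift f S x := by rw [drift]; ring
    have h1 : S.rate x * (deriv f x - d) ≤ drift f S x * deriv S.rate x := by
      rw [hE]
      refine mul_le_mul_of_nonneg_left ?_ hσ.le
      have : (r₁ - r₂) * B ≤ (r₁ - r₂) * valueShare f S B r₂ x :=
        mul_le_mul_of_nonneg_left hy.le (sub_pos.2 hw.rate_lt).le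
      have hA' : A = 1 - B := by linarith [hw.add_eq]
      rw [hd, hA']
      linarith
    have h2 : drift f S x * deriv f x ≤ 0 :=
      mul_nonpos_of_nonpos_of_nonneg hg.le (hr₂.trans (hφ x hx).1).le
    have h3 : S.rate x ≤ F + 1 + drift f S x ^ 2 := by
      nlinarith [hF x hx, sq_nonneg (drift f S x + 1)]
    have h4 : 0 ≤ S.rate x * deriv f x := mul_nonneg hσ.le (hr₂.trans (hφ x hx).1).le
    have hd0 : 0 < d := (hr₂.trans (hφ x hx).1).trans (hφ x hx).2
    nlinarith [mul_le_mul_of_nonneg_left h3 hd0.le]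
  have hleft : ∀ x ∈ uIcc k kstar, x < kstar →
      -(2 * d) ≤ 2 * drift f S x * (deriv f x - deriv S.rate x) / (F + 1 + drift f S x ^ 2) := by
    intro x hx hlt
    rw [le_div_iff₀ (hpos x)]
    have hE := hS.drift_mul_deriv_rate hw hf (hsub hx) hlt.ne
    have hy := hS.valueShare_lt hw hf (hsub hx) hlt hA fun c hc => (hφ c
      (uIcc_subset_uIcc_right hx (by rw [uIcc_of_le hlt.le]; exact hc))).1
    have hg := hC.drift_pos hM hf (hsub hx) hlt
    have hσ := hM.rate_pos x (hsub hx)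
    have hσe : S.rate x = f x - drift f S x := by rw [drift]; ring
    have hd0 : 0 < d := (hr₂.trans (hφ x hx).1).trans (hφ x hx).2
    have h1 : drift f S x * deriv S.rate x ≤ S.rate x * d := by
      rw [hE]
      refine mul_le_mul_of_nonneg_left ?_ hσ.le
      have : (r₁ - r₂) * valueShare f S B r₂ x ≤ (r₁ - r₂) * 1 :=
        mul_le_mul_of_nonneg_left hy.le (sub_pos.2 hw.rate_lt).le
      linarith [(hφ x hx).2]
    have h2 : 0 ≤ drift f S x * deriv f x := mul_nonneg hg.le (hr₂.trans (hφ x hx).1).le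
    have h3 : S.rate x ≤ F + 1 + drift f S x ^ 2 := by
      nlinarith [hF x hx, sq_nonneg (drift f S x)]
    nlinarith [mul_le_mul_of_nonneg_left h3 hd0.le]
  have hgrow : ψ k - ψ kstar ≤ 2 * d * |k - kstar| := by
    rcases lt_trichotomy k kstar with h | h | h
    · obtain ⟨c, hc, hc'⟩ := exists_hasDerivAt_eq_slope ψ _ h
        (fun x hx => (hψ' x (by rwa [uIcc_of_le h.le])).continuousAt.continuousWithinAt)
        (fun x hx => hψ' x (by rw [uIcc_of_le h.le]; exact Ioo_subset_Icc_self hx))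
      have h1 := hleft c (by rw [uIcc_of_le h.le]; exact Ioo_subset_Icc_self hc) hc.2
      rw [hc', le_div_iff₀ (sub_pos.2 h)] at h1
      rw [abs_of_neg (sub_neg.2 h)]
      linarith
    · simp [h]
    · obtain ⟨c, hc, hc'⟩ := exists_hasDerivAt_eq_slope ψ _ h
        (fun x hx => (hψ' x (by rwa [uIcc_of_ge h.le])).continuousAt.continuousWithinAt)
        (fun x hx => hψ' x (by rw [uIcc_of_ge h.le]; exact Ioo_subset_Icc_self hx))
      have h1 := hright c (by rw [uIcc_of_ge h.le]; exact Ioo_subset_Icc_self hc) hc.1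
      rw [hc', div_le_iff₀ (sub_pos.2 h)] at h1
      rw [abs_of_pos (sub_pos.2 h)]
      linarith
  have hk0 : ψ kstar = Real.log (F + 1) := by simp [hψ, hC.drift_kstar hM hf]
  rw [hk0, hψ] at hgrow
  have h1 : Real.log (F + 1 + drift f S k ^ 2) ≤
      Real.log ((F + 1) * Real.exp (2 * d * |k - kstar|)) := by
    rw [Real.log_mul (by positivity) (Real.exp_pos _).ne', Real.log_exp]
    linarith
  have h2 := (Real.log_le_log_iff (hpos k) (by positivity)).1 h1
  linarith

end IsEquilibrium

/-- The equilibrium strategies defined at `kbar`, whose steady states tend to `kbar`, tend to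
`f(kbar)` uniformly between `kbar` and their steady state. -/
lemma exists_rate_close (hw : IsMixture A B r₁ r₂) (hf : ContDiffOn ℝ 2 f (Ioi 0))
    (hkbar : 0 < kbar) (hA : 0 < A)
    (hφ : r₂ < deriv f kbar ∧ deriv f kbar < A * r₁ + B * r₂) {ε : ℝ} (hε : 0 < ε) :
    ∃ η > 0, ∀ kstar, |kstar - kbar| < η → ∀ S : Strategy,
      IsEquilibrium f Real.log (mixedDiscount A B r₁ r₂) S kstar → kbar ∈ S.dom →
      ∀ x ∈ uIcc kbar kstar, |S.rate x - f kbar| < ε := by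
  have hfc : ContinuousAt f kbar := (hasDerivAt_of_contDiffOn hf hkbar).continuousAt
  have hφc : ContinuousAt (deriv f) kbar := (hasDerivAt_deriv_of_contDiffOn hf hkbar).continuousAt
  set d := A * r₁ + B * r₂ with hd
  set F := |f kbar| + ε with hFdef
  have hF0 : 0 ≤ F := by positivity
  have hev : ∀ᶠ x in 𝓝 kbar, |f x - f kbar| < ε / 2 ∧ r₂ < deriv f x ∧ deriv f x < d ∧
      (F + 1) * (Real.exp (2 * d * |x - kbar|) - 1) < (ε / 2) ^ 2 := by
    refine ((Metric.tendsto_nhds.1 hfc _ (half_pos hε)).mono fun x hx => by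
      rwa [Real.dist_eq] at hx).and ((hφc.eventually (lt_mem_nhds hφ.1)).and
        ((hφc.eventually (gt_mem_nhds hφ.2)).and ?_))
    have hc : ContinuousAt (fun x => (F + 1) * (Real.exp (2 * d * |x - kbar|) - 1)) kbar := by
      fun_prop
    have h0 : (F + 1) * (Real.exp (2 * d * |kbar - kbar|) - 1) < (ε / 2) ^ 2 := by
      simp only [sub_self, abs_zero, mul_zero, Real.exp_zero]
      positivity
    exact hc.eventually (gt_mem_nhds h0)
  obtain ⟨η, hη, hball⟩ := Metric.eventually_nhds_iff.1 hev
  refine ⟨η, hη, fun kstar hkstar S hS hkS x hx => ?_⟩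
  have hloc : ∀ c ∈ uIcc kbar kstar, |f c - f kbar| < ε / 2 ∧ r₂ < deriv f c ∧ deriv f c < d ∧
      (F + 1) * (Real.exp (2 * d * |c - kbar|) - 1) < (ε / 2) ^ 2 := fun c hc => by
    refine hball (lt_of_le_of_lt ?_ hkstar)
    rw [Real.dist_eq, ← Real.dist_eq, ← Real.dist_eq]
    exact Real.dist_left_le_of_mem_uIcc hc |>.trans_eq (dist_comm _ _) |> fun h => by
      rwa [dist_comm c kbar]
  have hxd : x ∈ S.dom := hS.convergesTo.uIcc_subset_dom hkS hx
  have hsub : uIcc x kstar ⊆ uIcc kbar kstar := uIcc_subset_uIcc_right hx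
  have hg := hS.drift_sq_le hw hf hxd hA (fun c hc => ⟨(hloc c (hsub hc)).2.1,
    (hloc c (hsub hc)).2.2.1⟩) hF0 (fun c hc => by
      have := (abs_lt.1 (hloc c (hsub hc)).1).2
      have h2 := le_abs_self (f kbar)
      linarith)
  have hd0 : 0 < d := hw.rate_pos.trans (hφ.1.trans hφ.2)
  have h1 : (F + 1) * (Real.exp (2 * d * |x - kstar|) - 1) ≤
      (F + 1) * (Real.exp (2 * d * |kstar - kbar|) - 1) := by
    have : |x - kstar| ≤ |kstar - kbar| := by
      rw [← Real.dist_eq, ← Real.dist_eq, dist_comm kstar]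
      exact Real.dist_right_le_of_mem_uIcc hx
    gcongr
  have h2 : drift f S x ^ 2 < (ε / 2) ^ 2 :=
    (hg.trans h1).trans_lt (hloc kstar right_mem_uIcc).2.2.2
  have h3 := abs_lt_of_sq_lt_sq h2 (half_pos hε).le
  have h4 := abs_lt.1 (hloc x hx).1
  rw [abs_lt] at h3
  rw [drift] at h3
  rw [abs_lt]
  constructor <;> linarith [h3.1, h3.2, h4.1, h4.2]

/-- The marginal value of the steady state at `kbar`, uniformly over all equilibrium strategies. -/
lemma exists_welfare_close (hw : IsMixture A B r₁ r₂) (hf : ContDiffOn ℝ 2 f (Ioi 0))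
    (hkbar : 0 < kbar) (hA : 0 < A) (hfk : 0 < f kbar)
    (hφ : r₂ < deriv f kbar ∧ deriv f kbar < A * r₁ + B * r₂) {ε : ℝ} (hε : 0 < ε) :
    ∃ η > 0, ∀ kstar, |kstar - kbar| < η → ∀ S : Strategy,
      IsEquilibrium f Real.log (mixedDiscount A B r₁ r₂) S kstar → kbar ∈ S.dom →
      |welfare f Real.log (mixedDiscount A B r₁ r₂) S kbar -
        (A / r₁ + B / r₂) * Real.log (f kbar) -
        ((A / r₁ + B / r₂) * deriv f kbar - 1) / f kbar * (kstar - kbar)| ≤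
      ε * |kstar - kbar| := by
  -- on the segment, `1 / σ` is close to `1 / f(kbar)`
  have hinv : ContinuousAt (fun c : ℝ => 1 / c) (f kbar) :=
    continuousAt_const.div continuousAt_id hfk.ne'
  obtain ⟨ε', hε', hinv'⟩ := Metric.continuousAt_iff.1 hinv _ (half_pos hε)
  obtain ⟨η₁, hη₁, hrate⟩ := exists_rate_close hw hf hkbar hA hφ hε'
  set H := A / r₁ + B / r₂ with hH
  have hlog : HasDerivAt (fun x => H * Real.log (f x)) (H * (deriv f kbar / f kbar)) kbar :=
    ((hasDerivAt_of_contDiffOn hf hkbar).log hfk.ne').const_mul H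
  have hlo := (hasDerivAt_iff_isLittleO.1 hlog).def (half_pos hε)
  obtain ⟨η₂, hη₂, hlo'⟩ := Metric.eventually_nhds_iff.1 hlo
  refine ⟨min η₁ η₂, lt_min hη₁ hη₂, fun kstar hk S hS hkS => ?_⟩
  have h1 := hlo' (y := kstar) (by rw [Real.dist_eq]; exact hk.trans_le (min_le_right _ _))
  simp only [smul_eq_mul, Real.norm_eq_abs] at h1
  have hW := hS.welfare_kstar hw hf
  have hsub := hS.convergesTo.uIcc_subset_dom hkS
  have hclose := hrate kstar (hk.trans_le (min_le_left _ _)) S hS hkS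
  set V := welfare f Real.log (mixedDiscount A B r₁ r₂) S with hV
  have hmv : ∃ x ∈ uIcc kbar kstar, V kstar - V kbar = 1 / S.rate x * (kstar - kbar) := by
    rcases lt_trichotomy kbar kstar with h | h | h
    · obtain ⟨c, hc, hc'⟩ := exists_hasDerivAt_eq_slope V (fun x => 1 / S.rate x) h
        (fun x hx => (hS.hasDerivAt_welfare hw hf
          (hsub (by rwa [uIcc_of_le h.le]))).continuousAt.continuousWithinAt)
        (fun x hx => hS.hasDerivAt_welfare hw hf
          (hsub (by rw [uIcc_of_le h.le]; exact Ioo_subset_Icc_self hx)))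
      refine ⟨c, by rw [uIcc_of_le h.le]; exact Ioo_subset_Icc_self hc, ?_⟩
      rw [hc', div_mul_cancel₀ _ (sub_pos.2 h).ne']
    · exact ⟨kbar, left_mem_uIcc, by simp [h]⟩
    · obtain ⟨c, hc, hc'⟩ := exists_hasDerivAt_eq_slope V (fun x => 1 / S.rate x) h
        (fun x hx => (hS.hasDerivAt_welfare hw hf
          (hsub (by rwa [uIcc_of_ge h.le]))).continuousAt.continuousWithinAt)
        (fun x hx => hS.hasDerivAt_welfare hw hf
          (hsub (by rw [uIcc_of_ge h.le]; exact Ioo_subset_Icc_self hx)))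
      refine ⟨c, by rw [uIcc_of_ge h.le]; exact Ioo_subset_Icc_self hc, ?_⟩
      rw [hc', ← neg_sub (V kbar), ← neg_sub kbar, mul_neg, div_mul_cancel₀ _ (sub_pos.2 h).ne']
  obtain ⟨x, hx, hmv⟩ := hmv
  have h2 : |1 / S.rate x - 1 / f kbar| < ε / 2 := hinv' (hclose x hx)
  have h3 : V kbar - H * Real.log (f kbar) -
      (H * deriv f kbar - 1) / f kbar * (kstar - kbar) =
      (H * Real.log (f kstar) - H * Real.log (f kbar) -
        (kstar - kbar) * (H * (deriv f kbar / f kbar))) -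
      (1 / S.rate x - 1 / f kbar) * (kstar - kbar) := by
    rw [← hW]
    linear_combination -hmv
  rw [h3]
  refine (abs_sub _ _).trans ?_
  rw [abs_mul]
  have h4 := mul_le_mul_of_nonneg_right h2.le (abs_nonneg (kstar - kbar))
  linarith

end

/-! ### A singular second-order equation: a priori estimates -/

/-- Maximum principle for a function that increases wherever it is above the level `M`: on an
interval it is at most `M` as soon as it is at the right end. -/
lemma le_of_forall_deriv_pos {v : ℝ → ℝ} {l r M : ℝ} (hv : ContinuousOn v (Icc l r))
    (hd : ∀ k ∈ Ioo l r, M < v k → ∃ v', 0 < v' ∧ HasDerivAt v v' k) (hr : v r ≤ M) :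
    ∀ k ∈ Icc l r, v k ≤ M := by
  intro k hk
  by_contra hlt
  rw [not_le] at hlt
  obtain ⟨m, hm, hmax⟩ := isCompact_Icc.exists_isMaxOn ⟨k, hk⟩ hv
  have hmM : M < v m := hlt.trans_le (hmax hk)
  have hmr : m < r := lt_of_le_of_ne hm.2 (by rintro rfl; exact absurd hr (not_le.2 hmM))
  -- just to the right of the maximum the function is still above the level, hence increases
  have hev : ∀ᶠ x in 𝓝[Icc l r] m, M < v x := (hv m hm).eventually (lt_mem_nhds hmM)
  obtain ⟨ε, hε, hball⟩ := Metric.mem_nhdsWithin_iff.1 hev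
  set n := min r (m + ε / 2) with hn
  have hmn : m < n := lt_min hmr (by linarith)
  have hsub : Icc m n ⊆ Icc l r := Icc_subset_Icc hm.1 (min_le_left _ _)
  have habove : ∀ x ∈ Icc m n, M < v x := by
    intro x hx
    refine hball ⟨?_, hsub hx⟩
    rw [Metric.mem_ball, Real.dist_eq, abs_of_nonneg (sub_nonneg.2 hx.1)]
    linarith [hx.2.trans (min_le_right r (m + ε / 2))]
  have hstrict : StrictMonoOn v (Icc m n) := by
    refine strictMonoOn_of_deriv_pos (convex_Icc _ _) (hv.mono hsub) fun x hx => ?_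
    rw [interior_Icc] at hx
    obtain ⟨v', hv', hder⟩ := hd x ⟨hm.1.trans_lt hx.1, hx.2.trans_le (min_le_left _ _)⟩
      (habove x (Ioo_subset_Icc_self hx))
    rwa [hder.deriv]
  have h1 := hstrict (left_mem_Icc.2 hmn.le) (right_mem_Icc.2 hmn.le) hmn
  exact absurd (hmax (hsub (right_mem_Icc.2 hmn.le))) (not_le.2 h1)

/-- Two-sided maximum principle for an equation `v' = c (v + e)` with `c > 0`. -/
lemma abs_le_of_forall_hasDerivAt {v : ℝ → ℝ} {l r M : ℝ} (hv : ContinuousOn v (Icc l r))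
    (hd : ∀ k ∈ Ioo l r, M < |v k| → ∃ c e, 0 < c ∧ |e| < |v k| ∧
      HasDerivAt v (c * (v k + e)) k) (hr : |v r| ≤ M) :
    ∀ k ∈ Icc l r, |v k| ≤ M := by
  have hr' := abs_le.1 hr
  have h1 := le_of_forall_deriv_pos hv (fun k hk hM => by
    have hM0 : 0 ≤ M := (abs_nonneg _).trans hr
    obtain ⟨c, e, hc, he, hder⟩ := hd k hk (hM.trans_le (le_abs_self _))
    rw [abs_of_pos (hM0.trans_lt hM)] at he
    exact ⟨_, mul_pos hc (by linarith [(abs_lt.1 he).1]), hder⟩) hr'.2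
  have h2 := le_of_forall_deriv_pos (v := fun k => -v k) hv.neg (fun k hk hM => by
    have hM0 : 0 ≤ M := (abs_nonneg _).trans hr
    obtain ⟨c, e, hc, he, hder⟩ := hd k hk (hM.trans_le (neg_le_abs _))
    rw [abs_of_neg (show v k < 0 by linarith)] at he
    refine ⟨c * (-v k - e), mul_pos hc (by linarith [(abs_lt.1 he).2]), ?_⟩
    exact hder.neg.congr_deriv (by ring)) (by linarith)
  intro k hk
  exact abs_le.2 ⟨by linarith [h2 k hk], h1 k hk⟩

/-- Bounds on the coefficients of the singular equation
`z' = σ α / g² * (z - ζ + g Q(k, σ, z))`, where `σ' = z` and `g = f - σ`, for the points `(k, σ, z)`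
at distance at most `η` from `(k₀, f(k₀), ζ(k₀))`. A single constant `K` bounds all coefficients
and the inverses of those that stay away from zero. -/
structure IsSingularField (f φ α ζ : ℝ → ℝ) (Q : ℝ → ℝ → ℝ → ℝ) (k₀ η K : ℝ) : Prop where
  pos : 0 < η
  one_le : 1 ≤ K
  hasDerivAt : ∀ k, |k - k₀| ≤ η → HasDerivAt f (φ k) k
  continuousOn_α : ContinuousOn α (Icc (k₀ - η) (k₀ + η))
  α_lower : ∀ k, |k - k₀| ≤ η → 1 ≤ K * α k
  ζ_lipschitz : ∀ k k', |k - k₀| ≤ η → |k' - k₀| ≤ η → |ζ k - ζ k'| ≤ K * |k - k'|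
  continuousOn_Q : ContinuousOn (fun x : ℝ × ℝ × ℝ => Q x.1 x.2.1 x.2.2)
    {x | |x.1 - k₀| ≤ η ∧ |x.2.1 - f k₀| ≤ η ∧ |x.2.2 - ζ k₀| ≤ η}
  Q_le : ∀ k c z, |k - k₀| ≤ η → |c - f k₀| ≤ η → |z - ζ k₀| ≤ η → |Q k c z| ≤ K
  Q_lipschitz : ∀ k c z c' z', |k - k₀| ≤ η → |c - f k₀| ≤ η → |z - ζ k₀| ≤ η →
    |c' - f k₀| ≤ η → |z' - ζ k₀| ≤ η → |Q k c z - Q k c' z'| ≤ K * (|c - c'| + |z - z'|)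
  rate_lower : ∀ c, |c - f k₀| ≤ η → 1 ≤ K * c
  rate_upper : ∀ c, |c - f k₀| ≤ η → c ≤ K
  slope_upper : ∀ z, |z - ζ k₀| ≤ η → |z| ≤ K
  gap_lower : ∀ k z, |k - k₀| ≤ η → |z - ζ k₀| ≤ η → 1 ≤ K * (z - φ k)
  gap_upper : ∀ k z, |k - k₀| ≤ η → |z - ζ k₀| ≤ η → z - φ k ≤ K

/-- A solution `(σ, z)` on `[a, b]` of the singular equation whose graph meets that of `f`
at `s`. -/
structure IsSingularSolution (f α ζ : ℝ → ℝ) (Q : ℝ → ℝ → ℝ → ℝ) (k₀ η s a b : ℝ)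
    (σ z : ℝ → ℝ) : Prop where
  mem : s ∈ Icc a b
  le_left : k₀ - η ≤ a
  right_le : b ≤ k₀ + η
  continuousOn : ContinuousOn z (Icc a b)
  continuousOn_rate : ContinuousOn σ (Icc a b)
  hasDerivAt_rate : ∀ k ∈ Ioo a b, HasDerivAt σ (z k) k
  rate_eq : σ s = f s
  slope_eq : z s = ζ s
  rate_mem : ∀ k ∈ Icc a b, |σ k - f k₀| ≤ η
  slope_mem : ∀ k ∈ Icc a b, |z k - ζ k₀| ≤ η
  hasDerivAt : ∀ k ∈ Ioo a b, k ≠ s → HasDerivAt z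
    (σ k * α k / (f k - σ k) ^ 2 * (z k - ζ k + (f k - σ k) * Q k (σ k) (z k))) k

section

variable {f φ α ζ : ℝ → ℝ} {Q : ℝ → ℝ → ℝ → ℝ} {k₀ η K s a b : ℝ} {σ z : ℝ → ℝ}

namespace IsSingularField

lemma K_pos (hF : IsSingularField f φ α ζ Q k₀ η K) : 0 < K := one_pos.trans_le hF.one_le

lemma α_pos (hF : IsSingularField f φ α ζ Q k₀ η K) {k : ℝ} (hk : |k - k₀| ≤ η) : 0 < α k :=
  (mul_pos_iff_of_pos_left hF.K_pos).1 (one_pos.trans_le (hF.α_lower k hk))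

lemma rate_pos (hF : IsSingularField f φ α ζ Q k₀ η K) {c : ℝ} (hc : |c - f k₀| ≤ η) : 0 < c :=
  (mul_pos_iff_of_pos_left hF.K_pos).1 (one_pos.trans_le (hF.rate_lower c hc))

/-- The gap between `f` and a curve of slope close to `ζ(k₀)` that meets it at `s` is
comparable with the distance to `s`. -/
lemma gap_bounds (hF : IsSingularField f φ α ζ Q k₀ η K) (hs : s ∈ Icc a b) (ha : k₀ - η ≤ a)
    (hb : b ≤ k₀ + η) (hσc : ContinuousOn σ (Icc a b))
    (hσ : ∀ k ∈ Ioo a b, HasDerivAt σ (z k) k) (hσs : σ s = f s)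
    (hz : ∀ k ∈ Icc a b, |z k - ζ k₀| ≤ η) {k : ℝ} (hk : k ∈ Icc a b) :
    (k ≤ s → (s - k) ≤ K * (f k - σ k) ∧ f k - σ k ≤ K * (s - k)) ∧
    (s ≤ k → (k - s) ≤ K * (σ k - f k) ∧ σ k - f k ≤ K * (k - s)) := by
  have hnear : ∀ x ∈ Icc a b, |x - k₀| ≤ η := fun x hx =>
    abs_le.2 ⟨by linarith [hx.1], by linarith [hx.2]⟩
  have hcont : ContinuousOn (fun x => f x - σ x) (Icc a b) :=
    ContinuousOn.sub (fun x hx => (hF.hasDerivAt x (hnear x hx)).continuousAt.continuousWithinAt)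
      hσc
  have hder : ∀ x ∈ Ioo a b, HasDerivAt (fun x => f x - σ x) (φ x - z x) x := fun x hx =>
    (hF.hasDerivAt x (hnear x (Ioo_subset_Icc_self hx))).sub (hσ x hx)
  constructor
  · intro hks
    rcases hks.eq_or_lt with h | h
    · simp [h, hσs]
    obtain ⟨c, hc, hc'⟩ := exists_hasDerivAt_eq_slope _ _ h
      (hcont.mono (Icc_subset_Icc hk.1 hs.2))
      (fun x hx => hder x ⟨hk.1.trans_lt hx.1, hx.2.trans_le hs.2⟩)
    have hcI : c ∈ Icc a b := ⟨hk.1.trans hc.1.le, hc.2.le.trans hs.2⟩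
    rw [hσs, sub_self, zero_sub, eq_div_iff (sub_pos.2 h).ne'] at hc'
    have h1 := hF.gap_lower c (z c) (hnear c hcI) (hz c hcI)
    have h2 := hF.gap_upper c (z c) (hnear c hcI) (hz c hcI)
    have h3 : f k - σ k = (z c - φ c) * (s - k) := by linarith
    rw [h3]
    have h4 := sub_pos.2 h
    exact ⟨by rw [← mul_assoc]; exact le_mul_of_one_le_left h4.le h1,
      mul_le_mul_of_nonneg_right h2 h4.le⟩
  · intro hks
    rcases hks.eq_or_lt with h | h
    · simp [← h, hσs]
    obtain ⟨c, hc, hc'⟩ := exists_hasDerivAt_eq_slope _ _ h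
      (hcont.mono (Icc_subset_Icc hs.1 hk.2))
      (fun x hx => hder x ⟨hs.1.trans_lt hx.1, hx.2.trans_le hk.2⟩)
    have hcI : c ∈ Icc a b := ⟨hs.1.trans hc.1.le, hc.2.le.trans hk.2⟩
    rw [hσs, sub_self, sub_zero, eq_div_iff (sub_pos.2 h).ne'] at hc'
    have h1 := hF.gap_lower c (z c) (hnear c hcI) (hz c hcI)
    have h2 := hF.gap_upper c (z c) (hnear c hcI) (hz c hcI)
    have h3 : σ k - f k = (z c - φ c) * (k - s) := by linarith
    rw [h3]
    have h4 := sub_pos.2 h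
    exact ⟨by rw [← mul_assoc]; exact le_mul_of_one_le_left h4.le h1,
      mul_le_mul_of_nonneg_right h2 h4.le⟩

lemma abs_gap_bounds (hF : IsSingularField f φ α ζ Q k₀ η K) (hs : s ∈ Icc a b) (ha : k₀ - η ≤ a)
    (hb : b ≤ k₀ + η) (hσc : ContinuousOn σ (Icc a b))
    (hσ : ∀ k ∈ Ioo a b, HasDerivAt σ (z k) k) (hσs : σ s = f s)
    (hz : ∀ k ∈ Icc a b, |z k - ζ k₀| ≤ η) {k : ℝ} (hk : k ∈ Icc a b) :
    |k - s| ≤ K * |f k - σ k| ∧ |f k - σ k| ≤ K * |k - s| := by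
  have h := hF.gap_bounds hs ha hb hσc hσ hσs hz hk
  have hK := hF.K_pos
  rcases le_total k s with hks | hks
  · have h' := h.1 hks
    have hg : 0 ≤ f k - σ k := (mul_nonneg_iff_of_pos_left hK).1 ((sub_nonneg.2 hks).trans h'.1)
    rw [abs_of_nonneg hg, abs_of_nonpos (sub_nonpos.2 hks), neg_sub]
    exact h'
  · have h' := h.2 hks
    have hg : 0 ≤ σ k - f k := (mul_nonneg_iff_of_pos_left hK).1 ((sub_nonneg.2 hks).trans h'.1)
    rw [abs_sub_comm (f k), abs_of_nonneg hg, abs_of_nonneg (sub_nonneg.2 hks)]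
    exact h'

end IsSingularField

namespace IsSingularSolution

lemma near (h : IsSingularSolution f α ζ Q k₀ η s a b σ z) {k : ℝ} (hk : k ∈ Icc a b) :
    |k - k₀| ≤ η :=
  abs_le.2 ⟨by linarith [hk.1, h.le_left], by linarith [hk.2, h.right_le]⟩

lemma gap_bounds (hF : IsSingularField f φ α ζ Q k₀ η K)
    (h : IsSingularSolution f α ζ Q k₀ η s a b σ z) {k : ℝ} (hk : k ∈ Icc a b) :
    |k - s| ≤ K * |f k - σ k| ∧ |f k - σ k| ≤ K * |k - s| :=
  hF.abs_gap_bounds h.mem h.le_left h.right_le h.continuousOn_rate h.hasDerivAt_rate h.rate_eq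
    h.slope_mem hk

/-- To the left of the singular point the slope is Lipschitz at that point: with `M = 2 K²`, the
difference `±(z - ζ(s)) - M (s - k)` increases wherever it is positive. -/
lemma left_barrier (hF : IsSingularField f φ α ζ Q k₀ η K)
    (h : IsSingularSolution f α ζ Q k₀ η s a b σ z) {k : ℝ} (hk : k ∈ Icc a s) :
    |z k - ζ s| ≤ 2 * K ^ 2 * (s - k) := by
  have hK := hF.K_pos
  have hK1 := hF.one_le
  have hsub : Icc a s ⊆ Icc a b := Icc_subset_Icc_right h.mem.2
  -- where `|z - ζ(s)|` is large, the sign of `z'` is that of `z - ζ(s)`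
  have hmain : ∀ x ∈ Ioo a s, 2 * K ^ 2 * (s - x) < |z x - ζ s| →
      |(ζ s - ζ x) + (f x - σ x) * Q x (σ x) (z x)| < |z x - ζ s| ∧
      0 < σ x * α x / (f x - σ x) ^ 2 := by
    intro x hx hlt
    have hxI := hsub (Ioo_subset_Icc_self hx)
    have hg := h.gap_bounds hF hxI
    have hxs : |x - s| = s - x := by rw [abs_of_neg (sub_neg.2 hx.2), neg_sub]
    have h1 := hF.ζ_lipschitz s x (h.near h.mem) (h.near hxI)
    rw [abs_sub_comm s x, hxs] at h1
    have h2 := hF.Q_le x (σ x) (z x) (h.near hxI) (h.rate_mem x hxI) (h.slope_mem x hxI)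
    have hpos : 0 < s - x := sub_pos.2 hx.2
    have hg0 : f x - σ x ≠ 0 := by
      intro h0
      rw [h0, abs_zero, mul_zero, hxs] at hg
      linarith [hg.1]
    constructor
    · refine lt_of_le_of_lt (abs_add_le _ _) (lt_of_le_of_lt ?_ hlt)
      rw [abs_mul]
      have h3 : |f x - σ x| * |Q x (σ x) (z x)| ≤ K * (s - x) * K :=
        mul_le_mul (hxs ▸ hg.2) h2 (abs_nonneg _) (by positivity)
      have h4 : K * (s - x) ≤ K ^ 2 * (s - x) := by
        refine mul_le_mul_of_nonneg_right ?_ hpos.le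
        nlinarith
      nlinarith
    · have := hF.rate_pos (h.rate_mem x hxI)
      have := hF.α_pos (h.near hxI)
      positivity
  have hode := fun x (hx : x ∈ Ioo a s) =>
    h.hasDerivAt x ⟨hx.1, hx.2.trans_le h.mem.2⟩ hx.2.ne
  have hlin : ∀ x, HasDerivAt (fun x => 2 * K ^ 2 * (s - x)) (-(2 * K ^ 2)) x := fun x => by
    simpa using ((hasDerivAt_id x).const_sub s).const_mul (2 * K ^ 2)
  have hup := le_of_forall_deriv_pos (v := fun x => z x - ζ s - 2 * K ^ 2 * (s - x)) (l := a)
    (r := s) (M := 0) (((h.continuousOn.mono hsub).sub continuousOn_const).sub (by fun_prop))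
    (fun x hx hlt => by
      have hlt' : 2 * K ^ 2 * (s - x) < z x - ζ s := by linarith
      have h0 : 0 ≤ 2 * K ^ 2 * (s - x) := by have := sub_pos.2 hx.2; positivity
      obtain ⟨h1, h2⟩ := hmain x hx (hlt'.trans_le (le_abs_self _))
      rw [abs_of_pos (h0.trans_lt hlt')] at h1
      refine ⟨_, ?_, ((hode x hx).sub_const _).sub (hlin x)⟩
      have h3 := (abs_lt.1 h1).1
      have h4 : 0 < z x - ζ x + (f x - σ x) * Q x (σ x) (z x) := by linarith
      have := mul_pos h2 h4
      have : 0 < 2 * K ^ 2 := by positivity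
      linarith) (by simp [h.slope_eq])
  have hdown := le_of_forall_deriv_pos (v := fun x => -(z x - ζ s) - 2 * K ^ 2 * (s - x)) (l := a)
    (r := s) (M := 0) (((h.continuousOn.mono hsub).sub continuousOn_const).neg.sub (by fun_prop))
    (fun x hx hlt => by
      have hlt' : 2 * K ^ 2 * (s - x) < -(z x - ζ s) := by linarith
      have h0 : 0 ≤ 2 * K ^ 2 * (s - x) := by have := sub_pos.2 hx.2; positivity
      obtain ⟨h1, h2⟩ := hmain x hx (hlt'.trans_le (neg_le_abs _))
      rw [abs_of_neg (show z x - ζ s < 0 by linarith)] at h1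
      refine ⟨_, ?_, (((hode x hx).sub_const _).neg).sub (hlin x)⟩
      have h3 := (abs_lt.1 h1).2
      have h4 : z x - ζ x + (f x - σ x) * Q x (σ x) (z x) < 0 := by linarith
      have := mul_neg_of_pos_of_neg h2 h4
      have : 0 < 2 * K ^ 2 := by positivity
      linarith) (by simp [h.slope_eq])
  exact abs_le.2 ⟨by linarith [hdown k hk], by linarith [hup k hk]⟩

/-- To the right of the singular point the slope is Lipschitz at that point too, on an interval
that is short in terms of `K`, but with a constant `M` that depends on the value of the slope at
the right end. -/
lemma right_barrier (hF : IsSingularField f φ α ζ Q k₀ η K)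
    (h : IsSingularSolution f α ζ Q k₀ η s a b σ z) {M : ℝ} (hM : 4 * K ^ 2 ≤ M)
    (hMb : |z b - ζ s| ≤ M * (b - s)) (hshort : 2 * K ^ 4 * (b - s) < 1) {k : ℝ}
    (hk : k ∈ Icc s b) : |z k - ζ s| ≤ M * (k - s) := by
  have hK := hF.K_pos
  have hK1 := hF.one_le
  have hM0 : 0 < M := lt_of_lt_of_le (by positivity) hM
  have hsub : Icc s b ⊆ Icc a b := Icc_subset_Icc_left h.mem.1
  have hmain : ∀ x ∈ Ioo s b, M * (x - s) < |z x - ζ s| →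
      |(ζ s - ζ x) + (f x - σ x) * Q x (σ x) (z x)| ≤ M / 2 * (x - s) ∧
      2 < σ x * α x / (f x - σ x) ^ 2 * (x - s) := by
    intro x hx hlt
    have hxI := hsub (Ioo_subset_Icc_self hx)
    have hg := h.gap_bounds hF hxI
    have hpos : 0 < x - s := sub_pos.2 hx.1
    have hxs : |x - s| = x - s := abs_of_pos hpos
    rw [hxs] at hg
    have h1 := hF.ζ_lipschitz x s (h.near hxI) (h.near h.mem)
    rw [hxs, abs_sub_comm] at h1
    have h2 := hF.Q_le x (σ x) (z x) (h.near hxI) (h.rate_mem x hxI) (h.slope_mem x hxI)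
    have hg0 : f x - σ x ≠ 0 := by
      intro h0
      rw [h0, abs_zero, mul_zero] at hg
      linarith [hg.1]
    constructor
    · refine (abs_add_le _ _).trans ?_
      rw [abs_mul]
      have h3 : |f x - σ x| * |Q x (σ x) (z x)| ≤ K * (x - s) * K :=
        mul_le_mul hg.2 h2 (abs_nonneg _) (by positivity)
      have h4 : K * (x - s) ≤ K ^ 2 * (x - s) := by
        refine mul_le_mul_of_nonneg_right ?_ hpos.le
        nlinarith
      have h5 : 4 * K ^ 2 * (x - s) ≤ M * (x - s) := mul_le_mul_of_nonneg_right hM hpos.le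
      nlinarith
    · have hg2 : (f x - σ x) ^ 2 ≤ (K * (x - s)) ^ 2 := by
        rw [← sq_abs]; exact pow_le_pow_left₀ (abs_nonneg _) hg.2 2
      have hσ := hF.rate_lower _ (h.rate_mem x hxI)
      have hα := hF.α_lower _ (h.near hxI)
      have hg2pos : 0 < (f x - σ x) ^ 2 := by positivity
      rw [div_mul_eq_mul_div, lt_div_iff₀ hg2pos]
      have h6 : 1 ≤ K ^ 2 * (σ x * α x) := by
        have := mul_le_mul hσ hα zero_le_one (zero_le_one.trans hσ)
        nlinarith
      have h7 : 2 * K ^ 4 * (x - s) < 1 := lt_of_le_of_lt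
        (mul_le_mul_of_nonneg_left (by linarith [hx.2]) (by positivity)) hshort
      have h8 : 2 * (f x - σ x) ^ 2 * K ^ 2 < (x - s) * 1 := by
        calc 2 * (f x - σ x) ^ 2 * K ^ 2 ≤ 2 * (K * (x - s)) ^ 2 * K ^ 2 := by gcongr
          _ = (x - s) * (2 * K ^ 4 * (x - s)) := by ring
          _ < (x - s) * 1 := mul_lt_mul_of_pos_left h7 hpos
      have h9 : (x - s) * 1 ≤ (x - s) * (K ^ 2 * (σ x * α x)) :=
        mul_le_mul_of_nonneg_left h6 hpos.le
      have h10 : (2 * (f x - σ x) ^ 2) * K ^ 2 < (σ x * α x * (x - s)) * K ^ 2 := by linarith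
      exact lt_of_mul_lt_mul_right h10 (by positivity)
  have hode := fun x (hx : x ∈ Ioo s b) =>
    h.hasDerivAt x ⟨h.mem.1.trans_lt hx.1, hx.2⟩ hx.1.ne'
  have hlin : ∀ x, HasDerivAt (fun x => M * (x - s)) M x := fun x => by
    simpa using ((hasDerivAt_id x).sub_const s).const_mul M
  have hMb' := abs_le.1 hMb
  -- a lower bound on the growth
  have hgrow : ∀ x ∈ Ioo s b, ∀ y, M / 2 * (x - s) < y →
      2 < σ x * α x / (f x - σ x) ^ 2 * (x - s) → M < σ x * α x / (f x - σ x) ^ 2 * y := by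
    intro x hx y hy hc
    have hpos : 0 < x - s := sub_pos.2 hx.1
    have hc0 : 0 < σ x * α x / (f x - σ x) ^ 2 :=
      (mul_pos_iff_of_pos_right hpos).1 (two_pos.trans hc)
    have h1 := mul_lt_mul_of_pos_left hy hc0
    nlinarith
  have hup := le_of_forall_deriv_pos (v := fun x => z x - ζ s - M * (x - s)) (l := s)
    (r := b) (M := 0) (((h.continuousOn.mono hsub).sub continuousOn_const).sub (by fun_prop))
    (fun x hx hlt => by
      have hlt' : M * (x - s) < z x - ζ s := by linarith
      obtain ⟨h1, h2⟩ := hmain x hx (hlt'.trans_le (le_abs_self _))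
      refine ⟨_, ?_, ((hode x hx).sub_const _).sub (hlin x)⟩
      have h3 := (abs_le.1 h1).1
      have := hgrow x hx (z x - ζ x + (f x - σ x) * Q x (σ x) (z x)) (by linarith) h2
      linarith) (by linarith)
  have hdown := le_of_forall_deriv_pos (v := fun x => -(z x - ζ s) - M * (x - s)) (l := s)
    (r := b) (M := 0) (((h.continuousOn.mono hsub).sub continuousOn_const).neg.sub (by fun_prop))
    (fun x hx hlt => by
      have hlt' : M * (x - s) < -(z x - ζ s) := by linarith
      obtain ⟨h1, h2⟩ := hmain x hx (hlt'.trans_le (neg_le_abs _))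
      refine ⟨_, ?_, ((hode x hx).sub_const _).neg.sub (hlin x)⟩
      have h3 := (abs_le.1 h1).2
      have := hgrow x hx (-(z x - ζ x + (f x - σ x) * Q x (σ x) (z x))) (by linarith) h2
      linarith) (by linarith)
  exact abs_le.2 ⟨by linarith [hdown k hk], by linarith [hup k hk]⟩

end IsSingularSolution

end

/-! ### Comparison of two solutions of the singular equation -/

lemma abs_sub_le_of_hasDerivAt {u v : ℝ → ℝ} {l r W : ℝ} (hu : ContinuousOn u (Icc l r))
    (hd : ∀ k ∈ Ioo l r, HasDerivAt u (v k) k) (hv : ∀ k ∈ Ioo l r, |v k| ≤ W) {x y : ℝ}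
    (hx : x ∈ Icc l r) (hy : y ∈ Icc l r) : |u x - u y| ≤ W * |x - y| := by
  wlog hxy : x < y generalizing x y
  · rcases (not_lt.1 hxy).eq_or_lt with h | h
    · simp [h]
    · rw [abs_sub_comm, abs_sub_comm x]
      exact this hy hx h
  obtain ⟨c, hc, hc'⟩ := exists_hasDerivAt_eq_slope u v hxy
    (hu.mono (Icc_subset_Icc hx.1 hy.2)) fun t ht => hd t ⟨hx.1.trans_lt ht.1, ht.2.trans_le hy.2⟩
  have h1 := hv c ⟨hx.1.trans_lt hc.1, hc.2.trans_le hy.2⟩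
  rw [hc', abs_div, div_le_iff₀ (abs_pos.2 (sub_pos.2 hxy).ne')] at h1
  rwa [abs_sub_comm, abs_sub_comm x]

/-- If the derivative of `u` is at most `V + N sup |u|` on a short interval, then `u` is
controlled by `V` and its value at one point. -/
lemma abs_le_of_derivative_bound {u v : ℝ → ℝ} {l r D V N p : ℝ} (hu : ContinuousOn u (Icc l r))
    (hd : ∀ k ∈ Ioo l r, HasDerivAt u (v k) k) (hp : p ∈ Icc l r) (hD : |u p| ≤ D)
    (hV : 0 ≤ V) (hN : 0 ≤ N)
    (hv : ∀ U, (∀ k ∈ Icc l r, |u k| ≤ U) → ∀ k ∈ Icc l r, |v k| ≤ max V (N * U))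
    (hshort : (r - l) * N ≤ 1 / 2) :
    ∀ k ∈ Icc l r, |u k| ≤ 2 * D + 2 * (r - l) * V := by
  obtain ⟨m, hm, hmax⟩ := isCompact_Icc.exists_isMaxOn ⟨p, hp⟩ hu.abs
  have hv' := hv _ fun k hk => hmax hk
  have hlr : 0 ≤ r - l := sub_nonneg.2 (hp.1.trans hp.2)
  have h1 := abs_sub_le_of_hasDerivAt hu hd (fun k hk => hv' k (Ioo_subset_Icc_self hk)) hm hp
  have h2 : |m - p| ≤ r - l := by
    rw [abs_le]; constructor <;> linarith [hm.1, hm.2, hp.1, hp.2]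
  have h3 : max V (N * |u m|) ≤ V + N * |u m| :=
    max_le (by have := mul_nonneg hN (abs_nonneg (u m)); linarith) (by linarith)
  have h4 : max V (N * |u m|) * |m - p| ≤ (V + N * |u m|) * (r - l) :=
    mul_le_mul h3 h2 (abs_nonneg _) (by positivity)
  have h5 : |u m| ≤ |u m - u p| + |u p| := by simpa using abs_add_le (u m - u p) (u p)
  have h6 : (r - l) * N * |u m| ≤ 1 / 2 * |u m| :=
    mul_le_mul_of_nonneg_right hshort (abs_nonneg _)
  intro k hk
  have h7 : |u k| ≤ |u m| := hmax hk
  nlinarith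

section

variable {f φ α ζ : ℝ → ℝ} {Q : ℝ → ℝ → ℝ → ℝ} {k₀ η K : ℝ} {σ₁ z₁ σ₂ z₂ : ℝ → ℝ}

/-- The difference of the right-hand sides of the singular equation, for two solutions. -/
lemma singular_difference {α ζ Q₁ Q₂ g₁ g₂ s₁ s₂ z₁ z₂ : ℝ} (hg₁ : g₁ ≠ 0) (hg₂ : g₂ ≠ 0)
    (hs₁ : s₁ ≠ 0) (hu : s₁ - s₂ = g₂ - g₁) :
    s₁ * α / g₁ ^ 2 * (z₁ - ζ + g₁ * Q₁) - s₂ * α / g₂ ^ 2 * (z₂ - ζ + g₂ * Q₂) =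
      s₁ * α / g₁ ^ 2 * (z₁ - z₂ + (g₁ * (Q₁ - Q₂) +
        (s₁ - s₂) * (z₂ - ζ + g₁ * Q₂) / s₁ +
        s₂ / s₁ * ((z₂ - ζ) * ((s₁ - s₂) * (g₁ + g₂) / g₂ ^ 2) +
          Q₂ * (g₁ * (s₁ - s₂) / g₂)))) := by
  have : s₂ = s₁ - (g₂ - g₁) := by linarith
  subst this
  field_simp
  ring

/-- The slopes of two solutions differ by a multiple of the difference of the solutions. The
second solution is the one that stays farther from the graph of `f`. -/
lemma slope_comparison (hF : IsSingularField f φ α ζ Q k₀ η K) {l r C U V : ℝ}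
    (hnear : ∀ k ∈ Icc l r, |k - k₀| ≤ η)
    (hz₁c : ContinuousOn z₁ (Icc l r)) (hz₂c : ContinuousOn z₂ (Icc l r))
    (hbox₁ : ∀ k ∈ Icc l r, |σ₁ k - f k₀| ≤ η ∧ |z₁ k - ζ k₀| ≤ η)
    (hbox₂ : ∀ k ∈ Icc l r, |σ₂ k - f k₀| ≤ η ∧ |z₂ k - ζ k₀| ≤ η)
    (hode₁ : ∀ k ∈ Ioo l r, HasDerivAt z₁
      (σ₁ k * α k / (f k - σ₁ k) ^ 2 * (z₁ k - ζ k + (f k - σ₁ k) * Q k (σ₁ k) (z₁ k))) k)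
    (hode₂ : ∀ k ∈ Ioo l r, HasDerivAt z₂
      (σ₂ k * α k / (f k - σ₂ k) ^ 2 * (z₂ k - ζ k + (f k - σ₂ k) * Q k (σ₂ k) (z₂ k))) k)
    (hg₁ : ∀ k ∈ Ioo l r, f k - σ₁ k ≠ 0) (hg₂ : ∀ k ∈ Ioo l r, f k - σ₂ k ≠ 0)
    (hC : 1 ≤ C) (hg : ∀ k ∈ Ioo l r, |f k - σ₁ k| ≤ C * |f k - σ₂ k|)
    (hX : ∀ k ∈ Ioo l r, |z₂ k - ζ k| ≤ C * |f k - σ₂ k|)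
    (hs₁ : ∀ k ∈ Ioo l r, K * |f k - σ₁ k| ≤ 1 / 2) (hs₂ : ∀ k ∈ Ioo l r, |f k - σ₂ k| ≤ 1)
    (hU : ∀ k ∈ Icc l r, |σ₁ k - σ₂ k| ≤ U) (hV : |z₁ r - z₂ r| ≤ V) :
    ∀ k ∈ Icc l r, |z₁ k - z₂ k| ≤ max V (10 * C ^ 2 * K ^ 3 * U) := by
  have hK := hF.K_pos
  have hK1 := hF.one_le
  refine abs_le_of_forall_hasDerivAt (hz₁c.sub hz₂c) (fun k hk hlt => ?_)
    (hV.trans (le_max_left _ _))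
  have hkI := Ioo_subset_Icc_self hk
  have hσ₁ := hF.rate_pos (hbox₁ k hkI).1
  have hσ₂ := hF.rate_pos (hbox₂ k hkI).1
  have hα := hF.α_pos (hnear k hkI)
  have hg₁0 := hg₁ k hk
  have hg₂0 := hg₂ k hk
  have hQ := hF.Q_lipschitz k (σ₁ k) (z₁ k) (σ₂ k) (z₂ k) (hnear k hkI) (hbox₁ k hkI).1
    (hbox₁ k hkI).2 (hbox₂ k hkI).1 (hbox₂ k hkI).2
  have hQ₂ := hF.Q_le k (σ₂ k) (z₂ k) (hnear k hkI) (hbox₂ k hkI).1 (hbox₂ k hkI).2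
  have hinv : 1 / σ₁ k ≤ K := by
    rw [div_le_iff₀ hσ₁]; exact hF.rate_lower _ (hbox₁ k hkI).1
  have hσ₂K := hF.rate_upper _ (hbox₂ k hkI).1
  have hder := (hode₁ k hk).sub (hode₂ k hk)
  rw [singular_difference hg₁0 hg₂0 hσ₁.ne' (by ring)] at hder
  refine ⟨_, _, ?_, ?_, hder⟩
  · positivity
  have hU' := hU k hkI
  have hgk := hg k hk
  have hXk := hX k hk
  have h1k := hs₁ k hk
  have h2k := hs₂ k hk
  have hv : 10 * C ^ 2 * K ^ 3 * U < |z₁ k - z₂ k| := (le_max_right _ _).trans_lt hlt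
  set g₁ := f k - σ₁ k
  set g₂ := f k - σ₂ k
  set u := σ₁ k - σ₂ k
  set X := z₂ k - ζ k
  set q₁ := Q k (σ₁ k) (z₁ k)
  set q₂ := Q k (σ₂ k) (z₂ k)
  set v := z₁ k - z₂ k
  have hgpos : 0 < |g₂| := abs_pos.2 hg₂0
  have t1 : |g₁ * (q₁ - q₂)| ≤ 1 / 2 * (|u| + |v|) := by
    rw [abs_mul]
    calc |g₁| * |q₁ - q₂| ≤ |g₁| * (K * (|u| + |v|)) := by gcongr
      _ = K * |g₁| * (|u| + |v|) := by ring
      _ ≤ 1 / 2 * (|u| + |v|) := by gcongr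
  have t2 : |u * (X + g₁ * q₂) / σ₁ k| ≤ K * (|u| * (C + 1 / 2)) := by
    rw [abs_div, abs_mul, abs_of_pos hσ₁]
    have h1 : |X + g₁ * q₂| ≤ C + 1 / 2 := by
      refine (abs_add_le _ _).trans (add_le_add (hXk.trans ?_) ?_)
      · nlinarith
      · rw [abs_mul]
        calc |g₁| * |q₂| ≤ |g₁| * K := by gcongr
          _ = K * |g₁| := mul_comm _ _
          _ ≤ 1 / 2 := h1k
    calc |u| * |X + g₁ * q₂| / σ₁ k = 1 / σ₁ k * (|u| * |X + g₁ * q₂|) := by ring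
      _ ≤ K * (|u| * (C + 1 / 2)) := by gcongr
  have t3 : |X * (u * (g₁ + g₂) / g₂ ^ 2)| ≤ C * (C + 1) * |u| := by
    have h1 : |g₁ + g₂| ≤ (C + 1) * |g₂| := by
      refine (abs_add_le _ _).trans ?_
      linarith
    rw [abs_mul, abs_div, abs_mul, abs_pow]
    calc |X| * (|u| * |g₁ + g₂| / |g₂| ^ 2)
        ≤ C * |g₂| * (|u| * ((C + 1) * |g₂|) / |g₂| ^ 2) := by gcongr
      _ = C * (C + 1) * |u| := by field_simp
  have t4 : |q₂ * (g₁ * u / g₂)| ≤ K * C * |u| := by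
    rw [abs_mul, abs_div, abs_mul]
    calc |q₂| * (|g₁| * |u| / |g₂|) ≤ K * (C * |g₂| * |u| / |g₂|) := by gcongr
      _ = K * C * |u| := by field_simp
  have t5 : |σ₂ k / σ₁ k * (X * (u * (g₁ + g₂) / g₂ ^ 2) + q₂ * (g₁ * u / g₂))| ≤
      K ^ 2 * (C * (C + 1) * |u| + K * C * |u|) := by
    rw [abs_mul, abs_div, abs_of_pos hσ₁, abs_of_pos hσ₂]
    have h1 : σ₂ k / σ₁ k ≤ K ^ 2 := by
      calc σ₂ k / σ₁ k = σ₂ k * (1 / σ₁ k) := by ring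
        _ ≤ K * K := by gcongr
        _ = K ^ 2 := by ring
    have h2 := (abs_add_le (X * (u * (g₁ + g₂) / g₂ ^ 2)) (q₂ * (g₁ * u / g₂))).trans
      (add_le_add t3 t4)
    gcongr
  -- each coefficient of `|u|` is at most a multiple of `C² K³`
  have hCK : ∀ m n : ℕ, m ≤ 2 → n ≤ 3 → C ^ m * K ^ n ≤ C ^ 2 * K ^ 3 := fun m n hm hn =>
    mul_le_mul (pow_le_pow_right₀ hC hm) (pow_le_pow_right₀ hK1 hn) (by positivity)
      (by positivity)
  have c1 := hCK 0 0 (by norm_num) (by norm_num)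
  have c2 := hCK 1 1 (by norm_num) (by norm_num)
  have c3 := hCK 0 1 (by norm_num) (by norm_num)
  have c4 := hCK 2 2 (by norm_num) (by norm_num)
  have c5 := hCK 1 2 (by norm_num) (by norm_num)
  have c6 := hCK 1 3 (by norm_num) (by norm_num)
  have hcoef : 1 / 2 + K * (C + 1 / 2) + K ^ 2 * (C * (C + 1) + K * C) ≤ 5 * (C ^ 2 * K ^ 3) := by
    linarith
  have hU0 : 5 * (C ^ 2 * K ^ 3) * |u| ≤ 5 * (C ^ 2 * K ^ 3) * U := by gcongr
  have hcoef' := mul_le_mul_of_nonneg_right hcoef (abs_nonneg u)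
  refine (abs_add_le _ _).trans_lt ?_
  have t12 := (abs_add_le (g₁ * (q₁ - q₂)) (u * (X + g₁ * q₂) / σ₁ k)).trans (add_le_add t1 t2)
  linarith

/-- Two solutions defined around `k₀`, with the singular points `k₀` and `s > k₀` and the same
slope at the right end, differ by at most a multiple of `s - k₀`. -/
lemma solution_comparison (hF : IsSingularField f φ α ζ Q k₀ η K) {s r M : ℝ} (hr : 0 < r)
    (hrK : 1000 * M ^ 2 * K ^ 9 * r ≤ 1) (hM1 : 4 ≤ M) (hs : s ∈ Ioo k₀ (k₀ + r))
    (h₁ : IsSingularSolution f α ζ Q k₀ η k₀ (k₀ - r) (k₀ + r) σ₁ z₁)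
    (h₂ : IsSingularSolution f α ζ Q k₀ η s (k₀ - r) (k₀ + r) σ₂ z₂)
    (hM : ∀ k ∈ Icc k₀ (k₀ + r), |z₁ k - ζ k₀| ≤ M * (k - k₀))
    (hend : z₂ (k₀ + r) = z₁ (k₀ + r)) :
    ∀ k ∈ Icc (k₀ - r) (k₀ + r), |σ₂ k - σ₁ k| ≤ 5 * K ^ 2 * (s - k₀) := by
  have hK := hF.K_pos
  have hK1 := hF.one_le
  have hM0 : 0 < M := by linarith
  have hsk : 0 < s - k₀ := sub_pos.2 hs.1
  set C := 2 * M * K ^ 3 with hCdef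
  have hC : 1 ≤ C := by
    have := one_le_pow₀ hK1 (n := 3)
    nlinarith
  have hN : r * (10 * C ^ 2 * K ^ 3) ≤ 1 / 20 := by
    rw [hCdef]; linarith
  -- the interval is short in terms of the constants
  have hpow : ∀ n, n ≤ 9 → K ^ n ≤ M ^ 2 * K ^ 9 := fun n hn => by
    have h1 : K ^ n ≤ K ^ 9 := pow_le_pow_right₀ hK1 hn
    have h2 : 1 ≤ M ^ 2 := one_le_pow₀ (by linarith)
    have h3 : 0 < K ^ 9 := by positivity
    nlinarith
  have hsmall : ∀ n, n ≤ 9 → 1000 * K ^ n * r ≤ 1 := fun n hn => by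
    have := mul_le_mul_of_nonneg_right (hpow n hn) hr.le
    linarith
  have hI₀ : ∀ k ∈ Icc (k₀ - r) (k₀ + r), |k - k₀| ≤ r := fun k hk =>
    abs_le.2 ⟨by linarith [hk.1], by linarith [hk.2]⟩
  have hIs : ∀ k ∈ Icc (k₀ - r) (k₀ + r), |k - s| ≤ 2 * r := fun k hk =>
    abs_le.2 ⟨by linarith [hk.1, hs.2], by linarith [hk.2, hs.1]⟩
  have hgap₁ : ∀ k ∈ Icc (k₀ - r) (k₀ + r), |k - k₀| ≤ K * |f k - σ₁ k| ∧
      |f k - σ₁ k| ≤ K * |k - k₀| := fun k hk => h₁.gap_bounds hF hk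
  have hgap₂ : ∀ k ∈ Icc (k₀ - r) (k₀ + r), |k - s| ≤ K * |f k - σ₂ k| ∧
      |f k - σ₂ k| ≤ K * |k - s| := fun k hk => h₂.gap_bounds hF hk
  have hne : ∀ {g x : ℝ}, x ≠ 0 → |x| ≤ K * |g| → g ≠ 0 := by
    rintro g x hx hle rfl
    rw [abs_zero, mul_zero] at hle
    exact hx (abs_eq_zero.1 (le_antisymm hle (abs_nonneg _)))
  have hg₁s : ∀ k ∈ Icc (k₀ - r) (k₀ + r), K * |f k - σ₁ k| ≤ 1 / 2 ∧ |f k - σ₁ k| ≤ 1 := by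
    intro k hk
    have h1 : |f k - σ₁ k| ≤ K * r := (hgap₁ k hk).2.trans (by gcongr; exact hI₀ k hk)
    have h2 := hsmall 2 (by norm_num)
    have h3 := hsmall 1 (by norm_num)
    constructor <;> nlinarith
  have hg₂s : ∀ k ∈ Icc (k₀ - r) (k₀ + r), K * |f k - σ₂ k| ≤ 1 / 2 ∧ |f k - σ₂ k| ≤ 1 := by
    intro k hk
    have h1 : |f k - σ₂ k| ≤ K * (2 * r) := (hgap₂ k hk).2.trans (by gcongr; exact hIs k hk)
    have h2 := hsmall 2 (by norm_num)
    have h3 := hsmall 1 (by norm_num)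
    constructor <;> nlinarith
  -- between the two singular points, both graphs are close to that of `f`
  have hmid : ∀ k ∈ Icc k₀ s, |σ₂ k - σ₁ k| ≤ 2 * K * (s - k₀) := by
    intro k hk
    have hkI : k ∈ Icc (k₀ - r) (k₀ + r) := ⟨by linarith [hk.1], hk.2.trans hs.2.le⟩
    have h1 := (hgap₁ k hkI).2
    have h2 := (hgap₂ k hkI).2
    have h3 : |k - k₀| ≤ s - k₀ := abs_le.2 ⟨by linarith [hk.1], by linarith [hk.2]⟩
    have h4 : |k - s| ≤ s - k₀ := abs_le.2 ⟨by linarith [hk.1], by linarith [hk.2]⟩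
    have h5 : |σ₂ k - σ₁ k| ≤ |f k - σ₁ k| + |f k - σ₂ k| := by
      have := abs_sub (f k - σ₁ k) (f k - σ₂ k)
      rwa [sub_sub_sub_cancel_left] at this
    have h6 : K * |k - k₀| ≤ K * (s - k₀) := by gcongr
    have h7 : K * |k - s| ≤ K * (s - k₀) := by gcongr
    linarith
  have hD : 2 * (2 * K * (s - k₀)) ≤ 4 * K ^ 2 * (s - k₀) := by
    have : K ≤ K ^ 2 := by nlinarith
    nlinarith
  have hleft : ∀ k ∈ Icc (k₀ - r) k₀, |σ₂ k - σ₁ k| ≤ 5 * K ^ 2 * (s - k₀) := by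
    have hsub : Icc (k₀ - r) k₀ ⊆ Icc (k₀ - r) (k₀ + r) := Icc_subset_Icc_right (by linarith)
    have hX : ∀ k ∈ Icc (k₀ - r) k₀, |z₂ k - ζ k| ≤ 3 * K ^ 2 * (s - k) := by
      intro k hk
      have h1 := h₂.left_barrier hF (k := k) ⟨hk.1, hk.2.trans hs.1.le⟩
      have h2 := hF.ζ_lipschitz s k (h₂.near h₂.mem) (h₂.near (hsub hk))
      rw [abs_of_nonneg (by linarith [hk.2] : 0 ≤ s - k)] at h2
      have h3 : |z₂ k - ζ k| ≤ |z₂ k - ζ s| + |ζ s - ζ k| := abs_sub_le _ _ _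
      have h4 : K * (s - k) ≤ K ^ 2 * (s - k) :=
        mul_le_mul_of_nonneg_right (by nlinarith) (by linarith [hk.2])
      linarith
    have hV : |z₁ k₀ - z₂ k₀| ≤ 3 * K ^ 2 * (s - k₀) := by
      rw [h₁.slope_eq, abs_sub_comm]
      exact hX k₀ ⟨by linarith, le_rfl⟩
    have hmain := abs_le_of_derivative_bound (u := fun k => σ₁ k - σ₂ k)
      (v := fun k => z₁ k - z₂ k) (l := k₀ - r) (r := k₀) (p := k₀) (D := 2 * K * (s - k₀))
      (V := 3 * K ^ 2 * (s - k₀)) (N := 10 * C ^ 2 * K ^ 3)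
      ((h₁.continuousOn_rate.mono hsub).sub (h₂.continuousOn_rate.mono hsub))
      (fun k hk => (h₁.hasDerivAt_rate k ⟨hk.1, by linarith [hk.2]⟩).sub
        (h₂.hasDerivAt_rate k ⟨hk.1, by linarith [hk.2]⟩))
      ⟨by linarith, le_rfl⟩
      (by rw [abs_sub_comm]; exact hmid k₀ ⟨le_rfl, hs.1.le⟩) (by positivity) (by positivity)
      (fun U hU => slope_comparison hF (fun k hk => h₁.near (hsub hk))
        (h₁.continuousOn.mono hsub) (h₂.continuousOn.mono hsub)
        (fun k hk => ⟨h₁.rate_mem k (hsub hk), h₁.slope_mem k (hsub hk)⟩)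
        (fun k hk => ⟨h₂.rate_mem k (hsub hk), h₂.slope_mem k (hsub hk)⟩)
        (fun k hk => h₁.hasDerivAt k ⟨hk.1, by linarith [hk.2]⟩ hk.2.ne)
        (fun k hk => h₂.hasDerivAt k ⟨hk.1, by linarith [hk.2]⟩ (hk.2.trans hs.1).ne)
        (fun k hk => hne (sub_neg.2 hk.2).ne (hgap₁ k (hsub (Ioo_subset_Icc_self hk))).1)
        (fun k hk => hne (sub_neg.2 (hk.2.trans hs.1)).ne
          (hgap₂ k (hsub (Ioo_subset_Icc_self hk))).1)
        hC
        (fun k hk => by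
          have hkI := hsub (Ioo_subset_Icc_self hk)
          have h1 := (hgap₁ k hkI).2
          have h2 := (hgap₂ k hkI).1
          rw [abs_of_neg (sub_neg.2 hk.2)] at h1
          rw [abs_of_neg (sub_neg.2 (hk.2.trans hs.1))] at h2
          have h3 : |f k - σ₁ k| ≤ K * (K * |f k - σ₂ k|) := h1.trans (by gcongr; linarith)
          have h4 : K ^ 2 ≤ C := by
            have : K ^ 2 ≤ K ^ 3 := pow_le_pow_right₀ hK1 (by norm_num)
            have : 0 < K ^ 3 := by positivity
            nlinarith
          have h5 := mul_le_mul_of_nonneg_right h4 (abs_nonneg (f k - σ₂ k))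
          linarith)
        (fun k hk => by
          have hkI := hsub (Ioo_subset_Icc_self hk)
          have h1 := hX k (Ioo_subset_Icc_self hk)
          have h2 := (hgap₂ k hkI).1
          rw [abs_of_neg (sub_neg.2 (hk.2.trans hs.1)), neg_sub] at h2
          have h3 : |z₂ k - ζ k| ≤ 3 * K ^ 2 * (K * |f k - σ₂ k|) := h1.trans (by gcongr)
          have h4 : 3 * K ^ 3 ≤ C := by
            have : 0 < K ^ 3 := by positivity
            nlinarith
          have h5 := mul_le_mul_of_nonneg_right h4 (abs_nonneg (f k - σ₂ k))
          linarith)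
        (fun k hk => (hg₁s k (hsub (Ioo_subset_Icc_self hk))).1)
        (fun k hk => (hg₂s k (hsub (Ioo_subset_Icc_self hk))).2)
        hU hV)
      (by linarith)
    intro k hk
    have h1 := hmain k hk
    rw [abs_sub_comm] at h1
    have h2 : 2 * (k₀ - (k₀ - r)) * (3 * K ^ 2 * (s - k₀)) ≤ K ^ 2 * (s - k₀) := by
      have h3 := hsmall 0 (by norm_num)
      have h4 : 0 < K ^ 2 * (s - k₀) := by positivity
      nlinarith
    linarith
  have hright : ∀ k ∈ Icc s (k₀ + r), |σ₂ k - σ₁ k| ≤ 5 * K ^ 2 * (s - k₀) := by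
    have hsub : Icc s (k₀ + r) ⊆ Icc (k₀ - r) (k₀ + r) := Icc_subset_Icc_left (by linarith)
    have hmain := abs_le_of_derivative_bound (u := fun k => σ₂ k - σ₁ k)
      (v := fun k => z₂ k - z₁ k) (l := s) (r := k₀ + r) (p := s) (D := 2 * K * (s - k₀))
      (V := 0) (N := 10 * C ^ 2 * K ^ 3)
      ((h₂.continuousOn_rate.mono hsub).sub (h₁.continuousOn_rate.mono hsub))
      (fun k hk => (h₂.hasDerivAt_rate k ⟨by linarith [hk.1], hk.2⟩).sub
        (h₁.hasDerivAt_rate k ⟨by linarith [hk.1], hk.2⟩))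
      ⟨le_rfl, hs.2.le⟩
      (hmid s ⟨hs.1.le, le_rfl⟩) le_rfl (by positivity)
      (fun U hU => slope_comparison hF (fun k hk => h₁.near (hsub hk))
        (h₂.continuousOn.mono hsub) (h₁.continuousOn.mono hsub)
        (fun k hk => ⟨h₂.rate_mem k (hsub hk), h₂.slope_mem k (hsub hk)⟩)
        (fun k hk => ⟨h₁.rate_mem k (hsub hk), h₁.slope_mem k (hsub hk)⟩)
        (fun k hk => h₂.hasDerivAt k ⟨by linarith [hk.1], hk.2⟩ hk.1.ne')
        (fun k hk => h₁.hasDerivAt k ⟨by linarith [hk.1], hk.2⟩ (hs.1.trans hk.1).ne')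
        (fun k hk => hne (sub_pos.2 hk.1).ne' (hgap₂ k (hsub (Ioo_subset_Icc_self hk))).1)
        (fun k hk => hne (sub_pos.2 (hs.1.trans hk.1)).ne'
          (hgap₁ k (hsub (Ioo_subset_Icc_self hk))).1)
        hC
        (fun k hk => by
          have hkI := hsub (Ioo_subset_Icc_self hk)
          have h1 := (hgap₂ k hkI).2
          have h2 := (hgap₁ k hkI).1
          rw [abs_of_pos (sub_pos.2 hk.1)] at h1
          rw [abs_of_pos (sub_pos.2 (hs.1.trans hk.1))] at h2
          have h3 : |f k - σ₂ k| ≤ K * (K * |f k - σ₁ k|) := h1.trans (by gcongr; linarith)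
          have h4 : K ^ 2 ≤ C := by
            have : K ^ 2 ≤ K ^ 3 := pow_le_pow_right₀ hK1 (by norm_num)
            have : 0 < K ^ 3 := by positivity
            nlinarith
          have h5 := mul_le_mul_of_nonneg_right h4 (abs_nonneg (f k - σ₁ k))
          linarith)
        (fun k hk => by
          have hkI := hsub (Ioo_subset_Icc_self hk)
          have hkk : k₀ < k := hs.1.trans hk.1
          have h1 := hM k ⟨hkk.le, hkI.2⟩
          have h2 := (hgap₁ k hkI).1
          rw [abs_of_pos (sub_pos.2 hkk)] at h2
          have h6 := hF.ζ_lipschitz k k₀ (h₁.near hkI) (h₁.near h₁.mem)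
          rw [abs_of_pos (sub_pos.2 hkk), abs_sub_comm] at h6
          have h7 : |z₁ k - ζ k| ≤ |z₁ k - ζ k₀| + |ζ k₀ - ζ k| := abs_sub_le _ _ _
          have h3 : |z₁ k - ζ k| ≤ (M + K) * (K * |f k - σ₁ k|) := by
            have : (M + K) * (k - k₀) ≤ (M + K) * (K * |f k - σ₁ k|) := by gcongr
            linarith
          have h4 : (M + K) * K ≤ C := by
            have e1 : K ≤ K ^ 2 := by nlinarith
            have e2 : K ^ 2 ≤ K ^ 3 := pow_le_pow_right₀ hK1 (by norm_num)
            have e3 : M * K ≤ M * K ^ 3 := mul_le_mul_of_nonneg_left (e1.trans e2) hM0.le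
            have e4 : K ^ 2 ≤ M * K ^ 3 := by nlinarith
            rw [hCdef]
            linarith
          have h5 := mul_le_mul_of_nonneg_right h4 (abs_nonneg (f k - σ₁ k))
          linarith)
        (fun k hk => (hg₂s k (hsub (Ioo_subset_Icc_self hk))).1)
        (fun k hk => (hg₁s k (hsub (Ioo_subset_Icc_self hk))).2)
        hU (by rw [hend, sub_self, abs_zero]))
      (by
        have : (k₀ + r - s) * (10 * C ^ 2 * K ^ 3) ≤ r * (10 * C ^ 2 * K ^ 3) := by
          gcongr; linarith [hs.1]
        linarith)
    intro k hk
    have h1 := hmain k hk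
    have : 0 < K ^ 2 * (s - k₀) := by positivity
    linarith
  intro k hk
  rcases le_total k k₀ with h | h
  · exact hleft k ⟨hk.1, h⟩
  rcases le_total k s with h' | h'
  · refine (hmid k ⟨h, h'⟩).trans ?_
    have : 0 < K ^ 2 * (s - k₀) := by positivity
    linarith
  · exact hright k ⟨h', hk.2⟩

end

/-! ### The linear singular equation -/

section Linear

variable {l q : ℝ → ℝ} {s b c ρ : ℝ}

/-- The equation `Z' = l (Z - q)` to the left of a singular point `s` where `l` is not integrable:
it has a solution with limit `q(s)`, an average of `q` over `[k, s]`. -/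
lemma exists_linear_left (hρ : 0 < ρ) (hc : 0 < c) (hl : ContinuousOn l (Iio s))
    (hlow : ∀ k, s - ρ ≤ k → k < s → c / (s - k) ^ 2 ≤ l k) (hq : Continuous q) :
    ∃ Z : ℝ → ℝ, (∀ k < s, HasDerivAt Z (l k * (Z k - q k)) k) ∧
      Tendsto Z (𝓝[<] s) (𝓝 (q s)) := by
  set a := s - ρ with ha
  have has : a < s := by linarith
  set L : ℝ → ℝ := fun k => ∫ x in a..k, l x with hL
  have hL' : ∀ k < s, HasDerivAt L (l k) k := fun k hk => by
    have hsub : uIcc a k ⊆ Iio s := fun x hx => hx.2.trans_lt (max_lt has hk)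
    exact intervalIntegral.integral_hasDerivAt_right ((hl.mono hsub).intervalIntegrable)
      (hl.stronglyMeasurableAtFilter isOpen_Iio k hk) (hl.continuousAt (Iio_mem_nhds hk))
  -- the integral of `l` diverges at `s`
  have hLlow : ∀ k ∈ Ico a s, c / (s - k) - c / ρ ≤ L k := by
    intro k hk
    have hmono : MonotoneOn (fun x => L x - c / (s - x)) (Ico a s) := by
      have hd : ∀ x ∈ Ico a s, HasDerivAt (fun x => L x - c / (s - x))
          (l x - c / (s - x) ^ 2) x := fun x hx => by
        have h0 : s - x ≠ 0 := (sub_pos.2 hx.2).ne'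
        have h1 := ((hasDerivAt_const x c).div ((hasDerivAt_id x).const_sub s) h0)
        exact ((hL' x hx.2).sub h1).congr_deriv (by simp)
      refine monotoneOn_of_hasDerivWithinAt_nonneg (convex_Ico _ _)
        (f' := fun x => l x - c / (s - x) ^ 2)
        (fun x hx => (hd x hx).continuousAt.continuousWithinAt)
        (fun x hx => (hd x (interior_subset hx)).hasDerivWithinAt) (fun x hx => ?_)
      have hx' := interior_subset hx
      exact sub_nonneg.2 (hlow x hx'.1 hx'.2)
    have h1 := hmono (left_mem_Ico.2 has) hk hk.1
    simp only [hL, intervalIntegral.integral_same] at h1 ⊢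
    have h2 : s - a = ρ := by rw [ha]; ring
    rw [h2] at h1
    linarith
  have hLlim : Tendsto L (𝓝[<] s) atTop := by
    have h1 : Tendsto (fun k => c / (s - k) - c / ρ) (𝓝[<] s) atTop := by
      refine tendsto_atTop_add_const_right _ _ (Tendsto.const_mul_atTop hc ?_)
      refine tendsto_inv_nhdsGT_zero.comp (tendsto_nhdsWithin_iff.2 ⟨?_, ?_⟩)
      · have : Tendsto (fun k => s - k) (𝓝 s) (𝓝 (s - s)) := by
          exact (by fun_prop : Continuous fun k => s - k).tendsto s
        rw [sub_self] at this
        exact this.mono_left nhdsWithin_le_nhds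
      · filter_upwards [self_mem_nhdsWithin] with k hk using mem_Ioi.2 (sub_pos.2 (mem_Iio.1 hk))
    refine tendsto_atTop_mono' _ ?_ h1
    filter_upwards [Ico_mem_nhdsLT has] with k hk using hLlow k hk
  set w : ℝ → ℝ := fun k => Real.exp (-L k) with hw
  have hw' : ∀ k < s, HasDerivAt w (-(l k * w k)) k := fun k hk =>
    (hL' k hk).neg.exp.congr_deriv (by simp only [hw, Pi.neg_apply]; ring)
  have hwlim : Tendsto w (𝓝[<] s) (𝓝 0) :=
    Real.tendsto_exp_neg_atTop_nhds_zero.comp hLlim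
  have hwpos : ∀ k, 0 < w k := fun k => Real.exp_pos _
  -- `l w` is integrable up to `s`, being the derivative of a monotone function
  have hint : IntervalIntegrable (fun k => l k * w k) volume a s := by
    set w₀ : ℝ → ℝ := fun k => if k < s then -w k else 0 with hw₀
    have hev : ∀ k < s, w₀ =ᶠ[𝓝 k] fun k => -w k := fun k hk => by
      filter_upwards [Iio_mem_nhds hk] with x hx
      have hx' : x < s := hx
      simp [hw₀, hx']
    have hd : ∀ k < s, HasDerivAt w₀ (l k * w k) k := fun k hk =>
      ((hw' k hk).neg.congr_of_eventuallyEq (hev k hk)).congr_deriv (by ring)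
    refine intervalIntegral.intervalIntegrable_deriv_of_nonneg (g := w₀) ?_ ?_ ?_
    · rw [uIcc_of_le has.le]
      intro k hk
      rcases hk.2.eq_or_lt with h | h
      · subst h
        have h1 : Tendsto w₀ (𝓝[<] k) (𝓝 (w₀ k)) := by
          have h2 : Tendsto (fun x => -w x) (𝓝[<] k) (𝓝 (w₀ k)) := by
            simpa [hw₀] using hwlim.neg
          refine h2.congr' ?_
          filter_upwards [self_mem_nhdsWithin] with x hx
          have hx' : x < k := hx
          simp [hw₀, hx']
        have h2 : ContinuousWithinAt w₀ (Iic k) k := by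
          rw [← Iio_insert]
          exact continuousWithinAt_insert_self.2 h1
        exact h2.mono Icc_subset_Iic_self
      · exact (hd k h).continuousAt.continuousWithinAt
    · intro k hk
      rw [min_eq_left has.le, max_eq_right has.le] at hk
      exact hd k hk.2
    · intro k hk
      rw [min_eq_left has.le, max_eq_right has.le] at hk
      have h1 := hlow k hk.1.le hk.2
      have h2 : 0 ≤ c / (s - k) ^ 2 := by positivity
      exact mul_nonneg (h2.trans h1) (hwpos k).le
  have hintq : IntervalIntegrable (fun k => l k * w k * q k) volume a s :=
    hint.mul_continuousOn hq.continuousOn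
  set P : ℝ → ℝ := fun k => ∫ x in a..k, l x * w x * q x with hP
  have hwc : ContinuousOn w (Iio s) := fun k hk => (hw' k hk).continuousAt.continuousWithinAt
  have hlwq : ContinuousOn (fun k => l k * w k * q k) (Iio s) := (hl.mul hwc).mul hq.continuousOn
  have hP' : ∀ k < s, HasDerivAt P (l k * w k * q k) k := fun k hk => by
    have hsub : uIcc a k ⊆ Iio s := fun x hx => hx.2.trans_lt (max_lt has hk)
    exact intervalIntegral.integral_hasDerivAt_right ((hlwq.mono hsub).intervalIntegrable)
      (hlwq.stronglyMeasurableAtFilter isOpen_Iio k hk) (hlwq.continuousAt (Iio_mem_nhds hk))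
  have hPlim : Tendsto P (𝓝[<] s) (𝓝 (P s)) := by
    have h1 : ContinuousOn P (uIcc a s) :=
      intervalIntegral.continuousOn_primitive_interval
        ((intervalIntegrable_iff_integrableOn_Icc_of_le has.le).1 hintq |>.mono_set
          (by rw [uIcc_of_le has.le]))
    have h2 := h1 s right_mem_uIcc
    refine h2.mono_left (nhdsWithin_le_iff.2 ?_)
    rw [uIcc_of_le has.le]
    exact mem_of_superset (Ico_mem_nhdsLT has) Ico_subset_Icc_self
  refine ⟨fun k => (P s - P k) / w k, fun k hk => ?_, ?_⟩
  · refine (((hP' k hk).const_sub (P s)).div (hw' k hk) (hwpos k).ne').congr_deriv ?_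
    have := (hwpos k).ne'
    field_simp
    ring
  · refine HasDerivAt.lhopital_zero_left_on_Ioo has (f := fun k => P s - P k) (g := w)
      (f' := fun k => -(l k * w k * q k)) (g' := fun k => -(l k * w k))
      (fun k hk => (hP' k hk.2).const_sub (P s)) (fun k hk => hw' k hk.2)
      (fun k hk => ?_) ?_ hwlim ?_
    · have h1 := hlow k hk.1.le hk.2
      have h2 : 0 < c / (s - k) ^ 2 := by have := sub_pos.2 hk.2; positivity
      exact (neg_neg_of_pos (mul_pos (h2.trans_le h1) (hwpos k))).ne
    · simpa using hPlim.const_sub (P s)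
    · refine (hq.continuousAt.tendsto.mono_left nhdsWithin_le_nhds).congr' ?_
      filter_upwards [Ico_mem_nhdsLT has] with k hk
      have h1 := hlow k hk.1 hk.2
      have h2 : 0 < c / (s - k) ^ 2 := by have := sub_pos.2 hk.2; positivity
      have h3 := (mul_pos (h2.trans_le h1) (hwpos k)).ne'
      rw [neg_div_neg_eq, mul_div_cancel_left₀ _ h3]

/-- The equation `Z' = l (Z - q)` to the right of a singular point `s` where `l` is not integrable:
every solution has the limit `q(s)`. -/
lemma exists_linear_right (hρ : 0 < ρ) (hc : 0 < c) (hsb : s < b) (hl : ContinuousOn l (Ioi s))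
    (hlow : ∀ k, s < k → k ≤ s + ρ → c / (k - s) ^ 2 ≤ l k) (hq : Continuous q) (zb : ℝ) :
    ∃ Z : ℝ → ℝ, (∀ k > s, HasDerivAt Z (l k * (Z k - q k)) k) ∧
      Tendsto Z (𝓝[>] s) (𝓝 (q s)) ∧ Z b = zb := by
  set L : ℝ → ℝ := fun k => ∫ x in b..k, l x with hL
  have hL' : ∀ k > s, HasDerivAt L (l k) k := fun k hk => by
    have hsub : uIcc b k ⊆ Ioi s := fun x hx => (lt_min hsb hk).trans_le hx.1
    exact intervalIntegral.integral_hasDerivAt_right ((hl.mono hsub).intervalIntegrable)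
      (hl.stronglyMeasurableAtFilter isOpen_Ioi k hk) (hl.continuousAt (Ioi_mem_nhds hk))
  set w : ℝ → ℝ := fun k => Real.exp (-L k) with hw
  have hw' : ∀ k > s, HasDerivAt w (-(l k * w k)) k := fun k hk =>
    (hL' k hk).neg.exp.congr_deriv (by simp only [hw, Pi.neg_apply]; ring)
  have hwpos : ∀ k, 0 < w k := fun k => Real.exp_pos _
  have hwc : ContinuousOn w (Ioi s) := fun k hk => (hw' k hk).continuousAt.continuousWithinAt
  have hlwq : ContinuousOn (fun k => l k * w k * q k) (Ioi s) := (hl.mul hwc).mul hq.continuousOn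
  set P : ℝ → ℝ := fun k => ∫ x in b..k, l x * w x * q x with hP
  have hP' : ∀ k > s, HasDerivAt P (l k * w k * q k) k := fun k hk => by
    have hsub : uIcc b k ⊆ Ioi s := fun x hx => (lt_min hsb hk).trans_le hx.1
    exact intervalIntegral.integral_hasDerivAt_right ((hlwq.mono hsub).intervalIntegrable)
      (hlwq.stronglyMeasurableAtFilter isOpen_Ioi k hk) (hlwq.continuousAt (Ioi_mem_nhds hk))
  -- the integral of `l` diverges at `s`
  have hLlim : Tendsto (fun k => -L k) (𝓝[>] s) atTop := by
    have hlim : Tendsto (fun k => c / (k - s)) (𝓝[>] s) atTop := by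
      refine Tendsto.const_mul_atTop hc (tendsto_inv_nhdsGT_zero.comp
        (tendsto_nhdsWithin_iff.2 ⟨?_, ?_⟩))
      · have : Tendsto (fun k => k - s) (𝓝 s) (𝓝 (s - s)) := by
          exact (by fun_prop : Continuous fun k => k - s).tendsto s
        rw [sub_self] at this
        exact this.mono_left nhdsWithin_le_nhds
      · filter_upwards [self_mem_nhdsWithin] with k hk using mem_Ioi.2 (sub_pos.2 (mem_Ioi.1 hk))
    have hmono : MonotoneOn (fun x => L x + c / (x - s)) (Ioc s (s + ρ)) := by
      have hd : ∀ x ∈ Ioc s (s + ρ), HasDerivAt (fun x => L x + c / (x - s))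
          (l x - c / (x - s) ^ 2) x := fun x hx => by
        have h0 : x - s ≠ 0 := (sub_pos.2 hx.1).ne'
        have h1 := ((hasDerivAt_const x c).div ((hasDerivAt_id x).sub_const s) h0)
        exact ((hL' x hx.1).add h1).congr_deriv (by simp; ring)
      refine monotoneOn_of_hasDerivWithinAt_nonneg (convex_Ioc _ _)
        (f' := fun x => l x - c / (x - s) ^ 2)
        (fun x hx => (hd x hx).continuousAt.continuousWithinAt)
        (fun x hx => (hd x (interior_subset hx)).hasDerivWithinAt) (fun x hx => ?_)
      have hx' := interior_subset hx
      exact sub_nonneg.2 (hlow x hx'.1 hx'.2)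
    refine tendsto_atTop_mono' _ ?_
      (tendsto_atTop_add_const_right _ (-(L (s + ρ) + c / ρ)) hlim)
    filter_upwards [Ioc_mem_nhdsGT (show s < s + ρ by linarith)] with k hk
    have h1 := hmono hk (right_mem_Ioc.2 (by linarith)) hk.2
    simp only [add_sub_cancel_left] at h1
    linarith
  have hwlim : Tendsto w (𝓝[>] s) atTop := Real.tendsto_exp_atTop.comp hLlim
  -- an upper bound for the limit of a solution; the lower bound follows by symmetry
  have hkey : ∀ p : ℝ → ℝ, Continuous p → ∀ N : ℝ → ℝ,
      (∀ k > s, HasDerivAt N (-(l k * w k * p k)) k) → ∀ ε > 0,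
      ∀ᶠ k in 𝓝[>] s, N k / w k < p s + ε := by
    intro p hp N hN ε hε
    have hev : ∀ᶠ k in 𝓝[>] s, p k < p s + ε / 2 ∧ k ≤ s + ρ :=
      ((hp.continuousAt.eventually (gt_mem_nhds (by linarith))).filter_mono
        nhdsWithin_le_nhds).and ((eventually_le_nhds (by linarith)).filter_mono nhdsWithin_le_nhds)
    obtain ⟨x₁, hx₁, hev'⟩ := mem_nhdsGT_iff_exists_Ioc_subset.1 hev
    set e := p s + ε / 2
    have hmono : MonotoneOn (fun k => N k - e * w k) (Ioc s x₁) := by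
      have hd : ∀ x ∈ Ioc s x₁, HasDerivAt (fun k => N k - e * w k)
          (l x * w x * (e - p x)) x := fun x hx =>
        ((hN x hx.1).sub ((hw' x hx.1).const_mul e)).congr_deriv (by ring)
      refine monotoneOn_of_hasDerivWithinAt_nonneg (convex_Ioc _ _)
        (f' := fun x => l x * w x * (e - p x))
        (fun x hx => (hd x hx).continuousAt.continuousWithinAt)
        (fun x hx => (hd x (interior_subset hx)).hasDerivWithinAt) (fun x hx => ?_)
      have hx' := interior_subset hx
      have h1 := hev' hx'
      have h2 : 0 ≤ c / (x - s) ^ 2 := by positivity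
      exact mul_nonneg (mul_nonneg (h2.trans (hlow x hx'.1 h1.2)) (hwpos x).le)
        (sub_nonneg.2 h1.1.le)
    have hC := (tendsto_const_nhds (x := N x₁ - e * w x₁)).div_atTop hwlim
    filter_upwards [Ioc_mem_nhdsGT hx₁, hC.eventually (gt_mem_nhds (half_pos hε))] with k hk hk'
    have h1 := hmono hk (right_mem_Ioc.2 hx₁) hk.2
    rw [div_lt_iff₀ (hwpos k)] at hk' ⊢
    have : e = p s + ε / 2 := rfl
    have h2 : (p s + ε) * w k = e * w k + ε / 2 * w k := by simp only [e]; ring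
    linarith
  have hN' : ∀ k > s, HasDerivAt (fun k => zb - P k) (-(l k * w k * q k)) k := fun k hk =>
    (hP' k hk).const_sub zb
  refine ⟨fun k => (zb - P k) / w k, fun k hk => ?_, ?_, ?_⟩
  · refine ((hN' k hk).div (hw' k hk) (hwpos k).ne').congr_deriv ?_
    have := (hwpos k).ne'
    field_simp
    ring
  · rw [Metric.tendsto_nhds]
    intro ε hε
    filter_upwards [hkey q hq _ hN' ε hε, hkey (fun k => -q k) hq.neg (fun k => -(zb - P k))
      (fun k hk => (hN' k hk).neg.congr_deriv (by ring)) ε hε] with k h1 h2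
    rw [neg_div] at h2
    rw [Real.dist_eq, abs_lt]
    constructor <;> linarith
  · simp [hP, hw, hL]

/-- The equation `Z' = l (Z - q)`, with a coefficient `l` that is singular at `s`, has a continuous
solution with a given value at a point `b > s`. -/
lemma exists_singular_linear (hρ : 0 < ρ) (hc : 0 < c) (hsb : s < b) (hl : ContinuousOn l {s}ᶜ)
    (hlow : ∀ k, k ≠ s → |k - s| ≤ ρ → c / (k - s) ^ 2 ≤ l k) (hq : Continuous q) (zb : ℝ) :
    ∃ Z : ℝ → ℝ, Continuous Z ∧ Z s = q s ∧ Z b = zb ∧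
      ∀ k, k ≠ s → HasDerivAt Z (l k * (Z k - q k)) k := by
  obtain ⟨Z₁, hZ₁, hlim₁⟩ := exists_linear_left hρ hc (hl.mono fun k (hk : k < s) => hk.ne)
    (fun k hk hks => by
      have := hlow k hks.ne (by rw [abs_of_neg (sub_neg.2 hks)]; linarith)
      rwa [← neg_sub, neg_sq] ) hq
  obtain ⟨Z₂, hZ₂, hlim₂, hb⟩ := exists_linear_right hρ hc hsb
    (hl.mono fun k (hk : s < k) => hk.ne')
    (fun k hk hks => hlow k hk.ne' (by rw [abs_of_pos (sub_pos.2 hk)]; linarith)) hq zb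
  set Z : ℝ → ℝ := fun k => if k < s then Z₁ k else if k = s then q s else Z₂ k with hZ
  have hZs : Z s = q s := by simp [hZ]
  have hlt : ∀ k < s, Z k = Z₁ k := fun k hk => by simp [hZ, hk]
  have hgt : ∀ k > s, Z k = Z₂ k := fun k hk => by simp [hZ, hk.not_gt, hk.ne']
  have hd : ∀ k, k ≠ s → HasDerivAt Z (l k * (Z k - q k)) k := by
    intro k hk
    rcases lt_or_gt_of_ne hk with h | h
    · rw [hlt k h]
      refine (hZ₁ k h).congr_of_eventuallyEq ?_
      filter_upwards [Iio_mem_nhds h] with x hx using hlt x hx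
    · rw [hgt k h]
      refine (hZ₂ k h).congr_of_eventuallyEq ?_
      filter_upwards [Ioi_mem_nhds h] with x hx using hgt x hx
  refine ⟨Z, continuous_iff_continuousAt.2 fun k => ?_, hZs, by rw [hgt b hsb, hb], hd⟩
  by_cases hk : k = s
  · subst hk
    rw [continuousAt_iff_continuous_left'_right', ContinuousWithinAt, ContinuousWithinAt, hZs]
    refine ⟨hlim₁.congr' ?_, hlim₂.congr' ?_⟩
    · filter_upwards [self_mem_nhdsWithin] with x hx using (hlt x hx).symm
    · filter_upwards [self_mem_nhdsWithin] with x hx using (hgt x hx).symm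
  · exact (hd k hk).continuousAt

end Linear

/-! ### Existence for the singular equation -/

/-- The curve of slope `z` that meets the graph of `f` at `s`. -/
noncomputable def curveThrough (f : ℝ → ℝ) (s : ℝ) (z : ℝ → ℝ) (k : ℝ) : ℝ :=
  f s + ∫ x in s..k, z x

/-- `Z` solves on `[a, b]` the linear equation obtained by freezing at `z` the coefficients of the
singular equation; `Z = z` makes it a solution of the singular equation. -/
structure IsFrozenSolution (f α ζ : ℝ → ℝ) (Q : ℝ → ℝ → ℝ → ℝ) (s a b zb : ℝ) (z Z : ℝ → ℝ) :
    Prop where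
  continuous : Continuous Z
  eq_left : Z s = ζ s
  eq_right : Z b = zb
  hasDerivAt : ∀ k ∈ Ioo a b, k ≠ s → HasDerivAt Z
    (curveThrough f s z k * α k / (f k - curveThrough f s z k) ^ 2 *
      (Z k - ζ k + (f k - curveThrough f s z k) * Q k (curveThrough f s z k) (z k))) k

section

variable {f φ α ζ : ℝ → ℝ} {Q : ℝ → ℝ → ℝ → ℝ} {k₀ η K s r τ zb : ℝ} {z Z : ℝ → ℝ}

lemma hasDerivAt_curveThrough (hz : Continuous z) (k : ℝ) :
    HasDerivAt (curveThrough f s z) (z k) k :=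
  (hz.integral_hasStrictDerivAt s k).hasDerivAt.const_add (f s)

lemma curveThrough_self : curveThrough f s z s = f s := by simp [curveThrough]

/-- Numerical conditions under which the linearized equation defines a contraction on the slopes at
distance at most `τ` from `ζ(k₀)`, over the interval `[k₀ - r, k₀ + r]`. -/
structure IsSmall (η K r τ : ℝ) : Prop where
  r_pos : 0 < r
  r_le : 4 * K * r ≤ η
  r_le_τ : 3 * K ^ 2 * r ≤ τ
  τ_le : τ ≤ η
  τ_small : 16 * K ^ 5 * τ ≤ 1

lemma abs_sub_le_two_mul_of_mem (hs : s ∈ Ioo (k₀ - r) (k₀ + r)) {k : ℝ}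
    (hk : k ∈ Icc (k₀ - r) (k₀ + r)) : |k - s| ≤ 2 * r :=
  abs_le.2 ⟨by linarith [hk.1, hs.2], by linarith [hk.2, hs.1]⟩

namespace IsSingularField

variable (hF : IsSingularField f φ α ζ Q k₀ η K) (hsm : IsSmall η K r τ)
  (hs : s ∈ Ioo (k₀ - r) (k₀ + r))
include hF hsm

lemma r_le_η : r ≤ η := by
  have := hsm.r_le
  have := hF.one_le
  have := hsm.r_pos
  nlinarith

lemma near_of_mem {k : ℝ} (hk : k ∈ Icc (k₀ - r) (k₀ + r)) : |k - k₀| ≤ η := by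
  have := hF.r_le_η hsm
  exact abs_le.2 ⟨by linarith [hk.1], by linarith [hk.2]⟩

lemma two_r_le_one : 2 * r ≤ 1 := by
  have h1 := hF.one_le
  have h2 := one_le_pow₀ h1 (n := 2)
  have h3 := one_le_pow₀ h1 (n := 5)
  have h4 := hsm.r_le_τ
  have h5 := hsm.τ_small
  have h6 := hsm.r_pos
  have h7 : 1 * r ≤ K ^ 2 * r := by gcongr
  have h8 : 1 * τ ≤ K ^ 5 * τ := mul_le_mul_of_nonneg_right h3 (by linarith)
  linarith

include hs

/-- A curve of slope at distance at most `τ` from `ζ(k₀)` stays in the range where the bounds of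
the singular field hold. -/
lemma curveThrough_mem (hz : Continuous z)
    (hzτ : ∀ k ∈ Icc (k₀ - r) (k₀ + r), |z k - ζ k₀| ≤ τ) {k : ℝ}
    (hk : k ∈ Icc (k₀ - r) (k₀ + r)) : |curveThrough f s z k - f k₀| ≤ η := by
  have hr := hsm.r_pos
  have hK := hF.K_pos
  have hk₀ : k₀ ∈ Icc (k₀ - r) (k₀ + r) := ⟨by linarith, by linarith⟩
  have hsI := Ioo_subset_Icc_self hs
  have hzη : ∀ x ∈ Icc (k₀ - r) (k₀ + r), |z x - ζ k₀| ≤ η := fun x hx =>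
    (hzτ x hx).trans hsm.τ_le
  have h1 := abs_sub_le_of_hasDerivAt (u := curveThrough f s z) (v := z) (W := K)
    (fun x hx => (hasDerivAt_curveThrough hz x).continuousAt.continuousWithinAt)
    (fun x _ => hasDerivAt_curveThrough hz x)
    (fun x hx => hF.slope_upper _ (hzη x (Ioo_subset_Icc_self hx))) hk hsI
  have hζ₀ : |ζ k₀ - ζ k₀| ≤ η := by rw [sub_self, abs_zero]; exact hF.pos.le
  have h2 := abs_sub_le_of_hasDerivAt (u := f) (v := φ) (W := 2 * K)
    (l := k₀ - r) (r := k₀ + r)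
    (fun x hx => (hF.hasDerivAt x (hF.near_of_mem hsm hx)).continuousAt.continuousWithinAt)
    (fun x hx => hF.hasDerivAt x (hF.near_of_mem hsm (Ioo_subset_Icc_self hx)))
    (fun x hx => by
      have hx' := hF.near_of_mem hsm (Ioo_subset_Icc_self hx)
      have a1 := hF.gap_lower x (ζ k₀) hx' hζ₀
      have a2 := hF.gap_upper x (ζ k₀) hx' hζ₀
      have a3 := abs_le.1 (hF.slope_upper _ hζ₀)
      have a4 : 0 < ζ k₀ - φ x := (mul_pos_iff_of_pos_left hK).1 (one_pos.trans_le a1)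
      exact abs_le.2 ⟨by linarith [a3.1], by linarith [a3.2]⟩) hsI hk₀
  rw [curveThrough_self] at h1
  have h3 := abs_sub_le_two_mul_of_mem hs hk
  have h4 : |s - k₀| ≤ r := abs_le.2 ⟨by linarith [hs.1], by linarith [hs.2]⟩
  have h5 : |curveThrough f s z k - f k₀| ≤ |curveThrough f s z k - f s| + |f s - f k₀| :=
    abs_sub_le _ _ _
  have h6 : K * |k - s| ≤ K * (2 * r) := by gcongr
  have h7 : 2 * K * |s - k₀| ≤ 2 * K * r := by gcongr
  linarith [hsm.r_le]

lemma curveThrough_gap (hz : Continuous z)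
    (hzτ : ∀ k ∈ Icc (k₀ - r) (k₀ + r), |z k - ζ k₀| ≤ τ) {k : ℝ}
    (hk : k ∈ Icc (k₀ - r) (k₀ + r)) :
    |k - s| ≤ K * |f k - curveThrough f s z k| ∧
      |f k - curveThrough f s z k| ≤ K * |k - s| :=
  hF.abs_gap_bounds (Ioo_subset_Icc_self hs) (by linarith [hF.r_le_η hsm])
    (by linarith [hF.r_le_η hsm])
    (fun x _ => (hasDerivAt_curveThrough hz x).continuousAt.continuousWithinAt)
    (fun x _ => hasDerivAt_curveThrough hz x) curveThrough_self
    (fun x hx => (hzτ x hx).trans hsm.τ_le) hk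

lemma curveThrough_gap_ne (hz : Continuous z)
    (hzτ : ∀ k ∈ Icc (k₀ - r) (k₀ + r), |z k - ζ k₀| ≤ τ) {k : ℝ}
    (hk : k ∈ Icc (k₀ - r) (k₀ + r)) (hne : k ≠ s) : f k - curveThrough f s z k ≠ 0 := by
  intro h0
  have h1 := (hF.curveThrough_gap hsm hs hz hzτ hk).1
  rw [h0, abs_zero, mul_zero] at h1
  exact hne (sub_eq_zero.1 (abs_eq_zero.1 (le_antisymm h1 (abs_nonneg _))))

/-- The target `q = ζ - g Q` of the linearized equation is close to `ζ(k₀)`. -/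
lemma abs_target_le (hz : Continuous z)
    (hzτ : ∀ k ∈ Icc (k₀ - r) (k₀ + r), |z k - ζ k₀| ≤ τ) {k : ℝ}
    (hk : k ∈ Icc (k₀ - r) (k₀ + r)) :
    |ζ k - (f k - curveThrough f s z k) * Q k (curveThrough f s z k) (z k) - ζ k₀| ≤ τ := by
  have hr := hsm.r_pos
  have hK := hF.K_pos
  have hK1 := hF.one_le
  have hnear := hF.near_of_mem hsm hk
  have h1 := hF.ζ_lipschitz k k₀ hnear (by simpa using hF.pos.le)
  have h2 := hF.Q_le k _ _ hnear (hF.curveThrough_mem hsm hs hz hzτ hk)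
    ((hzτ k hk).trans hsm.τ_le)
  have h3 := (hF.curveThrough_gap hsm hs hz hzτ hk).2
  have h4 := abs_sub_le_two_mul_of_mem hs hk
  have h5 : |k - k₀| ≤ r := abs_le.2 ⟨by linarith [hk.1], by linarith [hk.2]⟩
  have h6 : |(f k - curveThrough f s z k) * Q k (curveThrough f s z k) (z k)| ≤
      K * (2 * r) * K := by
    rw [abs_mul]
    exact mul_le_mul (h3.trans (by gcongr)) h2 (abs_nonneg _) (by positivity)
  have h7 : K * |k - k₀| ≤ K ^ 2 * r := by
    have : K * |k - k₀| ≤ K * r := by gcongr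
    have : K * r ≤ K ^ 2 * r := mul_le_mul_of_nonneg_right (by nlinarith) hr.le
    linarith
  calc |ζ k - (f k - curveThrough f s z k) * Q k (curveThrough f s z k) (z k) - ζ k₀|
      = |(ζ k - ζ k₀) - (f k - curveThrough f s z k) * Q k (curveThrough f s z k) (z k)| := by
        congr 1; ring
    _ ≤ |ζ k - ζ k₀| + |(f k - curveThrough f s z k) * Q k (curveThrough f s z k) (z k)| :=
        abs_sub _ _
    _ ≤ τ := by linarith [hsm.r_le_τ]

lemma coefficient_pos (hz : Continuous z)
    (hzτ : ∀ k ∈ Icc (k₀ - r) (k₀ + r), |z k - ζ k₀| ≤ τ) {k : ℝ}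
    (hk : k ∈ Icc (k₀ - r) (k₀ + r)) (hne : k ≠ s) :
    0 < curveThrough f s z k * α k / (f k - curveThrough f s z k) ^ 2 := by
  have h1 := hF.rate_pos (hF.curveThrough_mem hsm hs hz hzτ hk)
  have h2 := hF.α_pos (hF.near_of_mem hsm hk)
  have h3 := hF.curveThrough_gap_ne hsm hs hz hzτ hk hne
  positivity

/-- The solutions of the linearized equation stay at distance at most `τ` from `ζ(k₀)`. -/
lemma abs_frozen_le (hz : Continuous z)
    (hzτ : ∀ k ∈ Icc (k₀ - r) (k₀ + r), |z k - ζ k₀| ≤ τ) (hzb : |zb - ζ k₀| ≤ τ)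
    (h : IsFrozenSolution f α ζ Q s (k₀ - r) (k₀ + r) zb z Z) :
    ∀ k ∈ Icc (k₀ - r) (k₀ + r), |Z k - ζ k₀| ≤ τ := by
  have hd : ∀ k ∈ Ioo (k₀ - r) (k₀ + r), k ≠ s → τ < |Z k - ζ k₀| → ∃ c e, 0 < c ∧
      |e| < |Z k - ζ k₀| ∧ HasDerivAt (fun k => Z k - ζ k₀) (c * (Z k - ζ k₀ + e)) k := by
    intro k hk hne hlt
    have hkI := Ioo_subset_Icc_self hk
    refine ⟨_, ζ k₀ - (ζ k - (f k - curveThrough f s z k) * Q k (curveThrough f s z k) (z k)),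
      hF.coefficient_pos hsm hs hz hzτ hkI hne, ?_,
      ((h.hasDerivAt k hk hne).sub_const _).congr_deriv (by ring)⟩
    rw [abs_sub_comm]
    exact (hF.abs_target_le hsm hs hz hzτ hkI).trans_lt hlt
  have hsτ : |Z s - ζ k₀| ≤ τ := by
    rw [h.eq_left]
    have := hF.abs_target_le hsm hs hz hzτ (Ioo_subset_Icc_self hs)
    rwa [curveThrough_self, sub_self, zero_mul, sub_zero] at this
  have hcont : Continuous fun k => Z k - ζ k₀ := h.continuous.sub continuous_const
  have h1 := abs_le_of_forall_hasDerivAt (v := fun k => Z k - ζ k₀) (l := k₀ - r) (r := s)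
    (M := τ) hcont.continuousOn (fun k hk => hd k ⟨hk.1, hk.2.trans hs.2⟩ hk.2.ne) hsτ
  have h2 := abs_le_of_forall_hasDerivAt (v := fun k => Z k - ζ k₀) (l := s) (r := k₀ + r)
    (M := τ) hcont.continuousOn (fun k hk => hd k ⟨hs.1.trans hk.1, hk.2⟩ hk.1.ne')
    (by rwa [h.eq_right])
  intro k hk
  rcases le_total k s with hks | hks
  · exact h1 k ⟨hk.1, hks⟩
  · exact h2 k ⟨hks, hk.2⟩

/-- The linearized equation has a coefficient of order `(k - s)⁻²` at `s`, hence a continuous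
solution with a prescribed value at the right end. -/
lemma exists_frozen (hz : Continuous z)
    (hzτ : ∀ k ∈ Icc (k₀ - r) (k₀ + r), |z k - ζ k₀| ≤ τ) (zb : ℝ) :
    ∃ Z, IsFrozenSolution f α ζ Q s (k₀ - r) (k₀ + r) zb z Z := by
  have hr := hsm.r_pos
  have hK := hF.K_pos
  have hK1 := hF.one_le
  have hab : k₀ - r ≤ k₀ + r := by linarith
  have hIη : Icc (k₀ - r) (k₀ + r) ⊆ Icc (k₀ - η) (k₀ + η) :=
    Icc_subset_Icc (by linarith [hF.r_le_η hsm]) (by linarith [hF.r_le_η hsm])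
  set σ := curveThrough f s z with hσ
  set I := Icc (k₀ - r) (k₀ + r) with hI
  have hσc : Continuous σ :=
    continuous_iff_continuousAt.2 fun k => (hasDerivAt_curveThrough hz k).continuousAt
  have hfc : ContinuousOn f I := fun k hk =>
    (hF.hasDerivAt k (hF.near_of_mem hsm hk)).continuousAt.continuousWithinAt
  have hζc : ContinuousOn ζ I := by
    refine (LipschitzOnWith.of_dist_le_mul (K := ⟨K, hK.le⟩) fun x hx y hy => ?_).continuousOn
    exact hF.ζ_lipschitz x y (hF.near_of_mem hsm hx) (hF.near_of_mem hsm hy)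
  have hQc : ContinuousOn (fun k => Q k (σ k) (z k)) I := by
    refine hF.continuousOn_Q.comp (f := fun k => (k, σ k, z k)) (by fun_prop) fun k hk => ?_
    exact ⟨hF.near_of_mem hsm hk, hF.curveThrough_mem hsm hs hz hzτ hk,
      (hzτ k hk).trans hsm.τ_le⟩
  -- the coefficients are extended from the interval by their values at the end points
  set π : ℝ → ℝ := fun k => projIcc (k₀ - r) (k₀ + r) hab k with hπ
  have hπc : Continuous π := continuous_subtype_val.comp continuous_projIcc
  have hπI : ∀ k, π k ∈ I := fun k => (projIcc (k₀ - r) (k₀ + r) hab k).2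
  have hπeq : ∀ k ∈ I, π k = k := fun k hk => by simp only [hπ, projIcc_of_mem hab hk]
  have hπs : ∀ k, k ≠ s → π k ≠ s := by
    intro k hk h
    by_cases hkI : k ∈ I
    · exact hk ((hπeq k hkI).symm.trans h)
    · rw [hI, mem_Icc, not_and_or, not_le, not_le] at hkI
      rcases hkI with h' | h'
      · have e : π k = k₀ - r := by simp only [hπ, projIcc_of_le_left hab h'.le]
        exact hs.1.ne (e.symm.trans h)
      · have e : π k = k₀ + r := by simp only [hπ, projIcc_of_right_le hab h'.le]
        exact hs.2.ne' (e.symm.trans h)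
  set l₀ : ℝ → ℝ := fun k => σ k * α k / (f k - σ k) ^ 2 with hl₀
  set q₀ : ℝ → ℝ := fun k => ζ k - (f k - σ k) * Q k (σ k) (z k) with hq₀
  have hl₀c : ContinuousOn l₀ (I \ {s}) := by
    refine ContinuousOn.div ?_ ?_ fun k hk => pow_ne_zero 2
      (hF.curveThrough_gap_ne hsm hs hz hzτ hk.1 hk.2)
    · exact hσc.continuousOn.mul ((hF.continuousOn_α.mono hIη).mono sdiff_subset)
    · exact ((hfc.mono sdiff_subset).sub hσc.continuousOn).pow 2
  have hq₀c : ContinuousOn q₀ I := hζc.sub ((hfc.sub hσc.continuousOn).mul hQc)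
  have hlow : ∀ k, k ≠ s → |k - s| ≤ min (s - (k₀ - r)) (k₀ + r - s) →
      1 / K ^ 4 / (k - s) ^ 2 ≤ l₀ (π k) := by
    intro k hk hks
    have h1 := abs_le.1 (hks.trans (min_le_left _ _))
    have h2 := abs_le.1 (hks.trans (min_le_right _ _))
    have hkI : k ∈ I := ⟨by linarith [h1.1], by linarith [h2.2]⟩
    rw [hπeq k hkI]
    have hg := (hF.curveThrough_gap hsm hs hz hzτ hkI).2
    have hσk := hF.rate_lower _ (hF.curveThrough_mem hsm hs hz hzτ hkI)
    have hαk := hF.α_lower k (hF.near_of_mem hsm hkI)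
    have hx : 0 < (k - s) ^ 2 := by have := sub_ne_zero.2 hk; positivity
    have hg0 := hF.curveThrough_gap_ne hsm hs hz hzτ hkI hk
    have hg2 : (f k - σ k) ^ 2 ≤ K ^ 2 * (k - s) ^ 2 := by
      rw [← sq_abs, ← sq_abs (k - s), ← mul_pow]
      exact pow_le_pow_left₀ (abs_nonneg _) hg 2
    have hg2pos : 0 < (f k - σ k) ^ 2 := by positivity
    have h3 : 1 ≤ K ^ 2 * (σ k * α k) := by
      have := mul_le_mul hσk hαk zero_le_one (zero_le_one.trans hσk)
      calc (1 : ℝ) = 1 * 1 := by ring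
        _ ≤ K * σ k * (K * α k) := this
        _ = K ^ 2 * (σ k * α k) := by ring
    simp only [hl₀]
    rw [div_div, div_le_div_iff₀ (by positivity) hg2pos, one_mul]
    have h4 : K ^ 2 * (k - s) ^ 2 * 1 ≤ K ^ 2 * (k - s) ^ 2 * (K ^ 2 * (σ k * α k)) :=
      mul_le_mul_of_nonneg_left h3 (by positivity)
    calc (f k - σ k) ^ 2 ≤ K ^ 2 * (k - s) ^ 2 * 1 := by rw [mul_one]; exact hg2
      _ ≤ _ := h4
      _ = σ k * α k * (K ^ 4 * (k - s) ^ 2) := by ring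
  obtain ⟨Z, hZc, hZs, hZb, hZ⟩ := exists_singular_linear (l := fun k => l₀ (π k))
    (q := fun k => q₀ (π k)) (s := s) (b := k₀ + r) (c := 1 / K ^ 4)
    (ρ := min (s - (k₀ - r)) (k₀ + r - s))
    (lt_min (by linarith [hs.1]) (by linarith [hs.2])) (by positivity) hs.2
    (hl₀c.comp hπc.continuousOn fun k hk => ⟨hπI k, hπs k hk⟩)
    hlow (hq₀c.comp_continuous hπc hπI) zb
  refine ⟨Z, hZc, ?_, hZb, fun k hk hne => ?_⟩
  · rw [hZs, hπeq s (Ioo_subset_Icc_self hs)]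
    simp [hq₀, hσ, curveThrough_self]
  · have h1 := hZ k hne
    rw [hπeq k (Ioo_subset_Icc_self hk)] at h1
    refine h1.congr_deriv ?_
    simp only [hl₀, hq₀]
    ring

end IsSingularField

/-- The difference of the right-hand sides of two linearized equations. -/
lemma frozen_difference {α ζ Q₁ Q₂ g₁ g₂ s₁ s₂ Z₁ Z₂ : ℝ} (hg₁ : g₁ ≠ 0) (hg₂ : g₂ ≠ 0)
    (hs₁ : s₁ ≠ 0) :
    s₁ * α / g₁ ^ 2 * (Z₁ - ζ + g₁ * Q₁) - s₂ * α / g₂ ^ 2 * (Z₂ - ζ + g₂ * Q₂) =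
      s₁ * α / g₁ ^ 2 * (Z₁ - Z₂ + (g₁ * (Q₁ - Q₂) + (g₁ - g₂) * Q₂ +
        ((s₁ - s₂) / s₁ + s₂ / s₁ * ((g₂ - g₁) * (g₂ + g₁) / g₂ ^ 2)) *
          (Z₂ - (ζ - g₂ * Q₂)))) := by
  field_simp
  ring

/-- The linearized equation contracts the distances of slopes. -/
lemma IsSingularField.frozen_contraction (hF : IsSingularField f φ α ζ Q k₀ η K)
    (hsm : IsSmall η K r τ) (hs : s ∈ Ioo (k₀ - r) (k₀ + r)) {z₁ z₂ Z₁ Z₂ : ℝ → ℝ} {d : ℝ}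
    (hz₁ : Continuous z₁) (hz₂ : Continuous z₂)
    (hzτ₁ : ∀ k ∈ Icc (k₀ - r) (k₀ + r), |z₁ k - ζ k₀| ≤ τ)
    (hzτ₂ : ∀ k ∈ Icc (k₀ - r) (k₀ + r), |z₂ k - ζ k₀| ≤ τ) (hzb : |zb - ζ k₀| ≤ τ)
    (h₁ : IsFrozenSolution f α ζ Q s (k₀ - r) (k₀ + r) zb z₁ Z₁)
    (h₂ : IsFrozenSolution f α ζ Q s (k₀ - r) (k₀ + r) zb z₂ Z₂)
    (hd : ∀ k ∈ Icc (k₀ - r) (k₀ + r), |z₁ k - z₂ k| ≤ d) :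
    ∀ k ∈ Icc (k₀ - r) (k₀ + r), |Z₁ k - Z₂ k| ≤ d / 2 := by
  have hr := hsm.r_pos
  have hK := hF.K_pos
  have hK1 := hF.one_le
  have hd0 : 0 ≤ d := (abs_nonneg _).trans (hd s (Ioo_subset_Icc_self hs))
  have hbd := hF.abs_frozen_le hsm hs hz₂ hzτ₂ hzb h₂
  have hder : ∀ k ∈ Ioo (k₀ - r) (k₀ + r), k ≠ s → d / 2 < |Z₁ k - Z₂ k| → ∃ c e, 0 < c ∧
      |e| < |Z₁ k - Z₂ k| ∧ HasDerivAt (fun k => Z₁ k - Z₂ k) (c * (Z₁ k - Z₂ k + e)) k := by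
    intro k hk hne hlt
    have hkI := Ioo_subset_Icc_self hk
    have hnear := hF.near_of_mem hsm hkI
    have hb₁ := hF.curveThrough_mem hsm hs hz₁ hzτ₁ hkI
    have hb₂ := hF.curveThrough_mem hsm hs hz₂ hzτ₂ hkI
    have hσ₁ := hF.rate_pos hb₁
    have hσ₂ := hF.rate_pos hb₂
    have hg₁0 := hF.curveThrough_gap_ne hsm hs hz₁ hzτ₁ hkI hne
    have hg₂0 := hF.curveThrough_gap_ne hsm hs hz₂ hzτ₂ hkI hne
    have hdiff := (h₁.hasDerivAt k hk hne).sub (h₂.hasDerivAt k hk hne)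
    rw [frozen_difference hg₁0 hg₂0 hσ₁.ne'] at hdiff
    refine ⟨_, _, hF.coefficient_pos hsm hs hz₁ hzτ₁ hkI hne, ?_, hdiff⟩
    refine lt_of_le_of_lt ?_ hlt
    have hQ := hF.Q_lipschitz k _ _ _ _ hnear hb₁ ((hzτ₁ k hkI).trans hsm.τ_le) hb₂
      ((hzτ₂ k hkI).trans hsm.τ_le)
    have hQ₂ := hF.Q_le k _ _ hnear hb₂ ((hzτ₂ k hkI).trans hsm.τ_le)
    have hG₁ := (hF.curveThrough_gap hsm hs hz₁ hzτ₁ hkI).2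
    have hG₂ := hF.curveThrough_gap hsm hs hz₂ hzτ₂ hkI
    have hinv : 1 / curveThrough f s z₁ k ≤ K := by
      rw [div_le_iff₀ hσ₁]; exact hF.rate_lower _ hb₁
    have hσ₂K := hF.rate_upper _ hb₂
    have htar := hF.abs_target_le hsm hs hz₂ hzτ₂ hkI
    have hu : |curveThrough f s z₁ k - curveThrough f s z₂ k| ≤ d * |k - s| := by
      have := abs_sub_le_of_hasDerivAt
        (u := fun k => curveThrough f s z₁ k - curveThrough f s z₂ k)
        (v := fun k => z₁ k - z₂ k) (l := k₀ - r) (r := k₀ + r) (W := d)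
        (fun x _ => ((hasDerivAt_curveThrough hz₁ x).sub
          (hasDerivAt_curveThrough hz₂ x)).continuousAt.continuousWithinAt)
        (fun x _ => (hasDerivAt_curveThrough hz₁ x).sub (hasDerivAt_curveThrough hz₂ x))
        (fun x hx => hd x (Ioo_subset_Icc_self hx)) hkI (Ioo_subset_Icc_self hs)
      simpa [curveThrough_self] using this
    have hzd := hd k hkI
    have hx2 := abs_sub_le_two_mul_of_mem hs hkI
    have hZ₂ := hbd k hkI
    set q₁ := Q k (curveThrough f s z₁ k) (z₁ k)
    set q₂ := Q k (curveThrough f s z₂ k) (z₂ k)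
    set s₁ := curveThrough f s z₁ k
    set s₂ := curveThrough f s z₂ k
    set x := |k - s|
    have hx0 : 0 ≤ x := abs_nonneg _
    have hx1 : x ≤ 1 := hx2.trans (hF.two_r_le_one hsm)
    have hgu : |(f k - s₁) - (f k - s₂)| ≤ d * x := by
      rw [sub_sub_sub_cancel_left, abs_sub_comm]; exact hu
    set g₁ := f k - s₁
    set g₂ := f k - s₂
    have hg₂pos : 0 < |g₂| := abs_pos.2 hg₂0
    have t1 : |g₁ * (q₁ - q₂)| ≤ 2 * K ^ 2 * x * d := by
      rw [abs_mul]
      have : |s₁ - s₂| + |z₁ k - z₂ k| ≤ 2 * d := by nlinarith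
      calc |g₁| * |q₁ - q₂| ≤ (K * x) * (K * (|s₁ - s₂| + |z₁ k - z₂ k|)) := by gcongr
        _ ≤ (K * x) * (K * (2 * d)) := by gcongr
        _ = 2 * K ^ 2 * x * d := by ring
    have t2 : |(g₁ - g₂) * q₂| ≤ K ^ 2 * x * d := by
      rw [abs_mul]
      calc |g₁ - g₂| * |q₂| ≤ d * x * K := by gcongr
        _ = K * (x * d) := by ring
        _ ≤ K ^ 2 * (x * d) := by gcongr; nlinarith
        _ = K ^ 2 * x * d := by ring
    have t3 : |(s₁ - s₂) / s₁| ≤ K ^ 5 * d := by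
      rw [abs_div, abs_of_pos hσ₁]
      calc |s₁ - s₂| / s₁ = 1 / s₁ * |s₁ - s₂| := by ring
        _ ≤ K * (d * 1) := by
          refine mul_le_mul hinv (hu.trans ?_) (abs_nonneg _) hK.le
          gcongr
        _ = K ^ 1 * d := by ring
        _ ≤ K ^ 5 * d := by
          refine mul_le_mul_of_nonneg_right (pow_le_pow_right₀ hK1 (by norm_num)) hd0
    have t4 : |s₂ / s₁ * ((g₂ - g₁) * (g₂ + g₁) / g₂ ^ 2)| ≤ (K ^ 3 + K ^ 5) * d := by
      have hratio : |g₁| ≤ K ^ 2 * |g₂| := by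
        calc |g₁| ≤ K * x := hG₁
          _ ≤ K * (K * |g₂|) := by gcongr; exact hG₂.1
          _ = K ^ 2 * |g₂| := by ring
      have hsum : |g₂ + g₁| ≤ (1 + K ^ 2) * |g₂| := by
        refine (abs_add_le _ _).trans ?_
        linarith
      have hdg : |g₂ - g₁| ≤ d * (K * |g₂|) := by
        rw [abs_sub_comm]
        refine hgu.trans ?_
        gcongr
        exact hG₂.1
      have hss : s₂ / s₁ ≤ K ^ 2 := by
        calc s₂ / s₁ = s₂ * (1 / s₁) := by ring
          _ ≤ K * K := by gcongr
          _ = K ^ 2 := by ring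
      rw [abs_mul, abs_div, abs_div, abs_mul, abs_pow, abs_of_pos hσ₁, abs_of_pos hσ₂]
      calc s₂ / s₁ * (|g₂ - g₁| * |g₂ + g₁| / |g₂| ^ 2)
          ≤ K ^ 2 * (d * (K * |g₂|) * ((1 + K ^ 2) * |g₂|) / |g₂| ^ 2) := by gcongr
        _ = (K ^ 3 + K ^ 5) * d := by field_simp
    have t5 : |Z₂ k - (ζ k - g₂ * q₂)| ≤ 2 * τ := by
      have h5 := abs_sub_le (Z₂ k) (ζ k₀) (ζ k - g₂ * q₂)
      rw [abs_sub_comm (ζ k₀)] at h5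
      linarith
    have t6 : |((s₁ - s₂) / s₁ + s₂ / s₁ * ((g₂ - g₁) * (g₂ + g₁) / g₂ ^ 2)) *
        (Z₂ k - (ζ k - g₂ * q₂))| ≤ 3 * K ^ 5 * d * (2 * τ) := by
      rw [abs_mul]
      have h6 : K ^ 3 ≤ K ^ 5 := pow_le_pow_right₀ hK1 (by norm_num)
      have h7 : K ^ 3 * d ≤ K ^ 5 * d := by gcongr
      exact mul_le_mul ((abs_add_le _ _).trans ((add_le_add t3 t4).trans (by linarith))) t5
        (abs_nonneg _) (by positivity)
    have t7 : 3 * K ^ 2 * x * d ≤ 2 * τ * d := by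
      have : 3 * K ^ 2 * x ≤ 2 * τ := by
        calc 3 * K ^ 2 * x ≤ 3 * K ^ 2 * (2 * r) := by gcongr
          _ ≤ 2 * τ := by linarith [hsm.r_le_τ]
      gcongr
    have hτ0 : 0 ≤ τ := (abs_nonneg _).trans hzb
    have t8 : 2 * τ * d ≤ 2 * K ^ 5 * τ * d := by
      have : 1 * τ ≤ K ^ 5 * τ := by gcongr; exact one_le_pow₀ hK1
      nlinarith
    have t9 : 16 * K ^ 5 * τ * d ≤ 1 * d := by gcongr; exact hsm.τ_small
    have t10 := (abs_add_le (g₁ * (q₁ - q₂) + (g₁ - g₂) * q₂)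
      (((s₁ - s₂) / s₁ + s₂ / s₁ * ((g₂ - g₁) * (g₂ + g₁) / g₂ ^ 2)) *
        (Z₂ k - (ζ k - g₂ * q₂)))).trans
      (add_le_add ((abs_add_le _ _).trans (add_le_add t1 t2)) t6)
    linarith
  have hcont : Continuous fun k => Z₁ k - Z₂ k := h₁.continuous.sub h₂.continuous
  have e1 := abs_le_of_forall_hasDerivAt (v := fun k => Z₁ k - Z₂ k) (l := k₀ - r) (r := s)
    (M := d / 2) hcont.continuousOn (fun k hk => hder k ⟨hk.1, hk.2.trans hs.2⟩ hk.2.ne)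
    (by rw [h₁.eq_left, h₂.eq_left, sub_self, abs_zero]; linarith)
  have e2 := abs_le_of_forall_hasDerivAt (v := fun k => Z₁ k - Z₂ k) (l := s) (r := k₀ + r)
    (M := d / 2) hcont.continuousOn (fun k hk => hder k ⟨hs.1.trans hk.1, hk.2⟩ hk.1.ne')
    (by rw [h₁.eq_right, h₂.eq_right, sub_self, abs_zero]; linarith)
  intro k hk
  rcases le_total k s with hks | hks
  · exact e1 k ⟨hk.1, hks⟩
  · exact e2 k ⟨hks, hk.2⟩

/-- Existence of a solution with a prescribed singular point `s` and a prescribed slope at the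
right end, on an interval that does not depend on `s`. -/
lemma IsSingularField.exists_solution (hF : IsSingularField f φ α ζ Q k₀ η K)
    (hsm : IsSmall η K r τ) (hs : s ∈ Ioo (k₀ - r) (k₀ + r)) (hzb : |zb - ζ k₀| ≤ τ) :
    ∃ σ z : ℝ → ℝ, IsSingularSolution f α ζ Q k₀ η s (k₀ - r) (k₀ + r) σ z ∧
      z (k₀ + r) = zb := by
  have hr := hsm.r_pos
  have hab : k₀ - r ≤ k₀ + r := by linarith
  set X := {z : C(Icc (k₀ - r) (k₀ + r), ℝ) | ∀ k, |z k - ζ k₀| ≤ τ} with hX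
  have hXclosed : IsClosed X := by
    have : X = ⋂ k, {z : C(Icc (k₀ - r) (k₀ + r), ℝ) | |z k - ζ k₀| ≤ τ} := by
      ext z; simp [hX]
    rw [this]
    refine isClosed_iInter fun k => isClosed_le ?_ continuous_const
    exact ((ContinuousEvalConst.continuous_eval_const k).sub continuous_const).abs
  have : CompleteSpace X := hXclosed.completeSpace_coe
  have hτ0 : 0 ≤ τ := (abs_nonneg _).trans hzb
  have : Nonempty X := ⟨⟨ContinuousMap.const _ (ζ k₀), fun k => by simpa using hτ0⟩⟩
  have hext : ∀ z : X, Continuous (IccExtend hab z.1) := fun z => z.1.continuous.Icc_extend'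
  have hextτ : ∀ z : X, ∀ k ∈ Icc (k₀ - r) (k₀ + r), |IccExtend hab z.1 k - ζ k₀| ≤ τ :=
    fun z k _ => z.2 _
  choose T₀ hT₀ using fun z : X => hF.exists_frozen hsm hs (hext z) (hextτ z) zb
  have hT₀τ := fun z : X => hF.abs_frozen_le hsm hs (hext z) (hextτ z) hzb (hT₀ z)
  set T : X → X := fun z => ⟨⟨fun k => T₀ z k, (hT₀ z).continuous.comp continuous_subtype_val⟩,
    fun k => hT₀τ z k k.2⟩ with hT
  have hcontr : ContractingWith (1 / 2) T := by
    refine ⟨by norm_num, LipschitzWith.of_dist_le_mul fun x y => ?_⟩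
    rw [Subtype.dist_eq, ContinuousMap.dist_le (by positivity)]
    intro k
    rw [Real.dist_eq]
    have h1 := hF.frozen_contraction hsm hs (hext x) (hext y) (hextτ x) (hextτ y) hzb (hT₀ x)
      (hT₀ y) (d := dist x y) (fun k hk => by
        rw [← Real.dist_eq, IccExtend_of_mem hab _ hk, IccExtend_of_mem hab _ hk]
        exact ContinuousMap.dist_apply_le_dist _) k k.2
    refine h1.trans (le_of_eq ?_)
    push_cast
    ring
  set z := hcontr.fixedPoint
  have hfix : T z = z := hcontr.fixedPoint_isFixedPt
  have hzeq : ∀ k ∈ Icc (k₀ - r) (k₀ + r), IccExtend hab z.1 k = T₀ z k := by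
    intro k hk
    rw [IccExtend_of_mem hab _ hk]
    conv_lhs => rw [← hfix]
    rfl
  have hrη := hF.r_le_η hsm
  have hsol := hT₀ z
  set zx := IccExtend hab z.1 with hzx
  refine ⟨curveThrough f s zx, zx, ⟨Ioo_subset_Icc_self hs, by linarith, by linarith,
    (hext z).continuousOn,
    fun k _ => (hasDerivAt_curveThrough (hext z) k).continuousAt.continuousWithinAt,
    fun k _ => hasDerivAt_curveThrough (hext z) k, curveThrough_self, ?_,
    fun k hk => hF.curveThrough_mem hsm hs (hext z) (hextτ z) hk,
    fun k hk => (hextτ z k hk).trans hsm.τ_le, fun k hk hne => ?_⟩, ?_⟩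
  · rw [hzeq s (Ioo_subset_Icc_self hs), hsol.eq_left]
  · have h1 := hsol.hasDerivAt k hk hne
    rw [← hzeq k (Ioo_subset_Icc_self hk)] at h1
    refine h1.congr_of_eventuallyEq ?_
    filter_upwards [Ioo_mem_nhds hk.1 hk.2] with x hx using hzeq x (Ioo_subset_Icc_self hx)
  · rw [hzeq _ (right_mem_Icc.2 hab), hsol.eq_right]

end

/-! ### From the singular equation to an equilibrium -/

/-- Global existence and convergence for a scalar equation whose drift points towards `kstar`. The
path is found explicitly: `kstar + c e^{-s}` is followed at the time `t(s) = ∫₀ˢ du / G(u)`, where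
`-G` is the logarithmic rate of the distance to `kstar`, and `t` is inverted. -/
lemma convergesTo_of_drift {f : ℝ → ℝ} {S : Strategy} {kstar L : ℝ} (hM : IsMarkov S)
    (hf : ContDiffOn ℝ 2 f (Ioi 0)) (hd : S.dom.OrdConnected) (hk : kstar ∈ S.dom)
    (hsign : ∀ x ∈ S.dom, x ≠ kstar → drift f S x * (x - kstar) < 0)
    (h0 : drift f S kstar = 0) (hL : ∀ x ∈ S.dom, |drift f S x| ≤ L * |x - kstar|) :
    ConvergesTo f S kstar := by
  refine ⟨hk, fun k hkS => ?_⟩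
  suffices H : ∃ γ, IsPath f S k γ ∧ Tendsto γ atTop (𝓝 kstar) by
    obtain ⟨γ, hγ, hlim⟩ := H
    refine ⟨⟨γ, hγ⟩, hlim.congr' ?_⟩
    filter_upwards [eventually_ge_atTop 0] with t ht
    exact (hγ.flow_eqOn hM hf hd ht).symm
  by_cases hne : k = kstar
  · refine ⟨fun _ => kstar, ⟨hne.symm, fun t _ => ⟨hk, ?_⟩⟩, tendsto_const_nhds⟩
    rw [drift] at h0
    simpa [h0] using (hasDerivAt_const t kstar).hasDerivWithinAt
  set c := k - kstar with hc
  have hc0 : c ≠ 0 := sub_ne_zero.2 hne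
  set p : ℝ → ℝ := fun s => kstar + c * Real.exp (-s) with hp
  have hpne : ∀ s, p s - kstar ≠ 0 := fun s => by
    simp only [hp, add_sub_cancel_left]
    exact mul_ne_zero hc0 (Real.exp_ne_zero _)
  have hpS : ∀ s, 0 ≤ s → p s ∈ S.dom := by
    intro s hs
    have he : Real.exp (-s) ≤ 1 := Real.exp_le_one_iff.2 (by linarith)
    have he0 := (Real.exp_pos (-s)).le
    refine hd.uIcc_subset hk hkS ?_
    rw [show p s = (1 - Real.exp (-s)) * kstar + Real.exp (-s) * k by simp only [hp, hc]; ring]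
    rw [← segment_eq_uIcc]
    exact ⟨1 - Real.exp (-s), Real.exp (-s), by linarith, he0, by ring, rfl⟩
  -- `max s 0` extends the rate to negative `s`, which makes the change of time a bijection of `ℝ`
  set G : ℝ → ℝ := fun s => -drift f S (p (max s 0)) / (p (max s 0) - kstar) with hG
  have hGpos : ∀ s, 0 < G s := by
    intro s
    have h1 := hsign _ (hpS _ (le_max_right s 0)) (sub_ne_zero.1 (hpne _))
    have h2 := hpne (max s 0)
    have : G s = -(drift f S (p (max s 0)) * (p (max s 0) - kstar)) /
        (p (max s 0) - kstar) ^ 2 := by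
      simp only [hG]; field_simp
    rw [this]
    have : 0 < -(drift f S (p (max s 0)) * (p (max s 0) - kstar)) := by linarith
    positivity
  have hGL : ∀ s, G s ≤ L := by
    intro s
    have h1 := hL _ (hpS _ (le_max_right s 0))
    refine (le_abs_self _).trans ?_
    simp only [hG]
    rw [abs_div, abs_neg, div_le_iff₀ (abs_pos.2 (hpne _))]
    exact h1
  have hL0 : 0 < L := (hGpos 0).trans_le (hGL 0)
  have hpc : Continuous p := by fun_prop
  have hpc' : Continuous fun s => p (max s 0) := by fun_prop
  have hGc : Continuous G :=
    (((hM.continuousOn_drift hf).comp_continuous hpc' fun s => hpS _ (le_max_right s 0)).neg).div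
      (hpc'.sub continuous_const) fun s => hpne _
  have hinvc : Continuous fun s => (G s)⁻¹ := hGc.inv₀ fun s => (hGpos s).ne'
  set θ : ℝ → ℝ := fun s => ∫ u in (0 : ℝ)..s, (G u)⁻¹ with hθ
  have hθd : ∀ s, HasDerivAt θ (G s)⁻¹ s := fun s =>
    (hinvc.integral_hasStrictDerivAt 0 s).hasDerivAt
  have hθc : Continuous θ := continuous_iff_continuousAt.2 fun s => (hθd s).continuousAt
  have hθmono : StrictMono θ := strictMono_of_deriv_pos fun s => by
    rw [(hθd s).deriv]; exact inv_pos.2 (hGpos s)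
  have hθ0 : θ 0 = 0 := by simp [hθ]
  have hcmp : Monotone fun s => θ s - L⁻¹ * s := by
    refine monotone_of_hasDerivAt_nonneg
      (fun s => (hθd s).sub ((hasDerivAt_id s).const_mul L⁻¹)) fun s => ?_
    have := (inv_le_inv₀ hL0 (hGpos s)).2 (hGL s)
    simpa using this
  have htop : Tendsto θ atTop atTop := by
    refine tendsto_atTop_mono' _ ?_ (tendsto_id.const_mul_atTop (inv_pos.2 hL0))
    filter_upwards [eventually_ge_atTop 0] with s hs
    have := hcmp hs
    simp only [hθ0, mul_zero, sub_zero] at this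
    simp only [id]
    linarith
  have hbot : Tendsto θ atBot atBot := by
    refine tendsto_atBot_mono' _ ?_ (tendsto_id.const_mul_atBot (inv_pos.2 hL0))
    filter_upwards [eventually_le_atBot 0] with s hs
    have := hcmp hs
    simp only [hθ0, mul_zero, sub_zero] at this
    simp only [id]
    linarith
  set e := hθmono.orderIsoOfSurjective θ (hθc.surjective htop hbot) with he
  have heq : ∀ t, θ (e.symm t) = t := fun t => e.apply_symm_apply t
  have hed : ∀ t, HasDerivAt e.symm (G (e.symm t)) t := fun t => by
    have := HasDerivAt.of_local_left_inverse e.symm.continuous.continuousAt (hθd (e.symm t))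
      (inv_ne_zero (hGpos _).ne') (Eventually.of_forall heq)
    rwa [inv_inv] at this
  have he0 : e.symm 0 = 0 := hθmono.injective (by rw [heq, hθ0])
  have henn : ∀ t, 0 ≤ t → 0 ≤ e.symm t := fun t ht => by
    rw [← he0]; exact e.symm.monotone ht
  refine ⟨fun t => p (e.symm t), ⟨by simp [he0, hp, hc], fun t ht =>
    ⟨hpS _ (henn t ht), ?_⟩⟩, ?_⟩
  · have h1 : HasDerivAt p (-(p (e.symm t) - kstar)) (e.symm t) := by
      have := (((hasDerivAt_id (e.symm t)).neg.exp).const_mul c).const_add kstar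
      refine this.congr_deriv ?_
      simp [hp]
    have h2 := h1.comp t (hed t)
    refine (h2.congr_deriv ?_).hasDerivWithinAt
    have h3 := hpne (e.symm t)
    simp only [hG, max_eq_left (henn t ht)]
    rw [drift]
    field_simp
  · have h1 : Tendsto p atTop (𝓝 (kstar + c * 0)) :=
      (Real.tendsto_exp_neg_atTop_nhds_zero.const_mul c).const_add kstar
    rw [mul_zero, add_zero] at h1
    exact h1.comp e.symm.tendsto_atTop

/-- Any solution of the singular equation, continuous at the singular point, is an equilibrium
strategy: the share `y` that it defines gives back both discounted utilities in closed form. -/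
lemma IsSingularSolution.isEquilibrium {f : ℝ → ℝ} {A B r₁ r₂ k₀ η K s a b : ℝ} {σ z : ℝ → ℝ}
    (hw : IsMixture A B r₁ r₂) (hf : ContDiffOn ℝ 2 f (Ioi 0)) (hA : 0 < A) (ha : 0 < a)
    (hs : s ∈ Ioo a b)
    (hF : IsSingularField f (deriv f) (fun k => A * r₁ + B * r₂ - deriv f k)
      (steadySlope f A B r₁ r₂) (slopeCorrection f A B r₁ r₂) k₀ η K)
    (h : IsSingularSolution f (fun k => A * r₁ + B * r₂ - deriv f k)
      (steadySlope f A B r₁ r₂) (slopeCorrection f A B r₁ r₂) k₀ η s a b σ z) :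
    IsEquilibrium f Real.log (mixedDiscount A B r₁ r₂) ⟨Ioo a b, σ⟩ s := by
  set S : Strategy := ⟨Ioo a b, σ⟩ with hS
  have hpos : ∀ k ∈ Ioo a b, 0 < k := fun k hk => ha.trans hk.1
  have hderiv : ∀ k ∈ Ioo a b, deriv σ k = z k := fun k hk => (h.hasDerivAt_rate k hk).deriv
  have hσpos : ∀ k ∈ Ioo a b, 0 < σ k := fun k hk =>
    hF.rate_pos (h.rate_mem k (Ioo_subset_Icc_self hk))
  have hzc : ContinuousOn z (Ioo a b) := h.continuousOn.mono Ioo_subset_Icc_self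
  have hM : IsMarkov S := by
    refine ⟨isOpen_Ioo, fun k hk => hpos k hk, ?_, hσpos⟩
    refine (contDiffOn_succ_iff_deriv_of_isOpen (n := 0) isOpen_Ioo).2
      ⟨fun k hk => (h.hasDerivAt_rate k hk).differentiableAt.differentiableWithinAt, by simp, ?_⟩
    exact contDiffOn_zero.2 (hzc.congr hderiv)
  have hg : ∀ k, drift f S k = f k - σ k := fun k => rfl
  have hK := hF.K_pos
  have hbounds := fun k (hk : k ∈ Ioo a b) => hF.gap_bounds h.mem h.le_left h.right_le
    h.continuousOn_rate h.hasDerivAt_rate h.rate_eq h.slope_mem (Ioo_subset_Icc_self hk)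
  have hC : ConvergesTo f S s := by
    refine convergesTo_of_drift hM hf ordConnected_Ioo hs (L := K) (fun x hx hne => ?_) ?_
      fun x hx => ?_
    · rw [hg]
      rcases lt_or_gt_of_ne hne with hlt | hlt
      · have h1 := ((hbounds x hx).1 hlt.le).1
        have h2 : 0 < f x - σ x := by
          by_contra hneg
          have := mul_nonpos_of_nonneg_of_nonpos hK.le (not_lt.1 hneg)
          linarith
        exact mul_neg_of_pos_of_neg h2 (by linarith)
      · have h1 := ((hbounds x hx).2 hlt.le).1
        have h2 : 0 < σ x - f x := by
          by_contra hneg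
          have := mul_nonpos_of_nonneg_of_nonpos hK.le (not_lt.1 hneg)
          linarith
        exact mul_neg_of_neg_of_pos (by linarith) (by linarith)
    · rw [hg, h.rate_eq, sub_self]
    · rw [hg]
      exact (hF.abs_gap_bounds h.mem h.le_left h.right_le h.continuousOn_rate h.hasDerivAt_rate
        h.rate_eq h.slope_mem (Ioo_subset_Icc_self hx)).2
  have hΔ : r₁ - r₂ ≠ 0 := (sub_pos.2 hw.rate_lt).ne'
  have hr₂ := hw.rate_pos
  have hr₁ : 0 < r₁ := hr₂.trans hw.rate_lt
  have hB := hw.right_pos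
  have hA' : A = 1 - B := by linarith [hw.add_eq]
  have hα : ∀ k ∈ Ioo a b, A * r₁ + B * r₂ - deriv f k ≠ 0 := fun k hk =>
    (hF.α_pos (abs_le.2 ⟨by linarith [h.le_left, hk.1], by linarith [h.right_le, hk.2]⟩)).ne'
  refine ⟨hM, hC, fun k hk => ?_⟩
  by_cases hne : k = s
  · subst hne
    refine (hC.isMaxOn_P1_kstar_iff hM hf hw).2 ?_
    have hα' := hα k hk
    have hz : deriv S.rate k * (A * r₁ + B * r₂ - deriv f k) =
        (r₁ - deriv f k) * (deriv f k - r₂) := by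
      rw [show deriv S.rate k = z k from hderiv k hk, h.slope_eq, steadySlope]
      exact div_mul_cancel₀ _ hα'
    set ζ := deriv S.rate k
    set φ := deriv f k
    rw [hA'] at hz ⊢
    linear_combination -hz
  -- the share is read off the Euler equation
  · set y : ℝ → ℝ := fun x => (r₁ - deriv f x + (f x - σ x) * z x / σ x) / (r₁ - r₂) with hy
    have hfd : ∀ x ∈ Ioo a b, HasDerivAt f (deriv f x) x := fun x hx =>
      hasDerivAt_of_contDiffOn hf (hpos x hx)
    have hfd' : ∀ x ∈ Ioo a b, HasDerivAt (deriv f) (deriv (deriv f) x) x := fun x hx =>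
      hasDerivAt_deriv_of_contDiffOn hf (hpos x hx)
    have hfc : ContinuousOn f (Ioo a b) := fun x hx => (hfd x hx).continuousAt.continuousWithinAt
    have hfc' : ContinuousOn (deriv f) (Ioo a b) := fun x hx =>
      (hfd' x hx).continuousAt.continuousWithinAt
    have hσc : ContinuousOn σ (Ioo a b) := h.continuousOn_rate.mono Ioo_subset_Icc_self
    have hσ0 : ∀ x ∈ Ioo a b, σ x ≠ 0 := fun x hx => (hσpos x hx).ne'
    have hyc : ContinuousOn y (Ioo a b) :=
      ((continuousOn_const.sub hfc').add (((hfc.sub hσc).mul hzc).div hσc hσ0)).div_const _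
    have hlogc : ContinuousOn (fun x => Real.log (σ x)) (Ioo a b) := hσc.log hσ0
    have hyd : ∀ x ∈ Ioo a b, x ≠ s → HasDerivAt y
        ((-(r₁ - r₂) * y x * (1 - y x) + z x * (y x - B)) / (f x - σ x)) x := by
      intro x hx hxs
      have hg0 : f x - σ x ≠ 0 := by rw [← hg]; exact hC.drift_ne_zero hM hf hx hxs
      have h1 := ((hfd' x hx).const_sub r₁).add
        ((((hfd x hx).sub (h.hasDerivAt_rate x hx)).mul (h.hasDerivAt x hx hxs)).div
          (h.hasDerivAt_rate x hx) (hσ0 x hx))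
      refine (h1.div_const (r₁ - r₂)).congr_deriv ?_
      have hα' := hα x hx
      have hσx := hσ0 x hx
      simp only [hy, steadySlope, slopeCorrection, Pi.sub_apply, Pi.mul_apply]
      obtain ⟨g, hgx⟩ : ∃ g, g = f x - σ x := ⟨_, rfl⟩
      have hfx : f x = σ x + g := by rw [hgx]; ring
      rw [← hgx] at hg0 ⊢
      rw [hfx]
      generalize deriv f x = φ at *
      generalize deriv (deriv f) x = φ' at *
      generalize σ x = c at *
      generalize z x = w at *
      rw [hA'] at hα' ⊢
      field_simp
      ring
    have hW₂ := hC.discountedUtility_eq_of_hasDerivAt hM hf hr₂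
      (F := fun x => (Real.log (σ x) + (f x - σ x) * y x / (B * σ x)) / r₂)
      (F' := fun x => y x / (B * σ x))
      ((hlogc.add (((hfc.sub hσc).mul hyc).div (continuousOn_const.mul hσc)
        fun x hx => mul_ne_zero hB.ne' (hσ0 x hx))).div_const _)
      (fun x hx hxs => by
        have hg0 : f x - σ x ≠ 0 := by rw [← hg]; exact hC.drift_ne_zero hM hf hx hxs
        have hσx := hσ0 x hx
        refine ⟨?_, by rw [hg]; simp only [hS]; field_simp; ring⟩
        have h1 := ((h.hasDerivAt_rate x hx).log hσx).add
          ((((hfd x hx).sub (h.hasDerivAt_rate x hx)).mul (hyd x hx hxs)).div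
            ((h.hasDerivAt_rate x hx).const_mul B) (mul_ne_zero hB.ne' hσx))
        refine (h1.div_const r₂).congr_deriv ?_
        have hyx : (f x - σ x) * z x = σ x * ((r₁ - r₂) * y x - r₁ + deriv f x) := by
          simp only [hy]; field_simp; ring
        simp only [Pi.sub_apply, Pi.mul_apply]
        generalize y x = w at *
        field_simp
        linear_combination -w * hyx) hk hne
    have hW₁ := hC.discountedUtility_eq_of_hasDerivAt hM hf hr₁
      (F := fun x => (Real.log (σ x) + (f x - σ x) * (1 - y x) / (A * σ x)) / r₁)
      (F' := fun x => (1 - y x) / (A * σ x))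
      ((hlogc.add (((hfc.sub hσc).mul (continuousOn_const.sub hyc)).div (continuousOn_const.mul hσc)
        fun x hx => mul_ne_zero hA.ne' (hσ0 x hx))).div_const _)
      (fun x hx hxs => by
        have hg0 : f x - σ x ≠ 0 := by rw [← hg]; exact hC.drift_ne_zero hM hf hx hxs
        have hσx := hσ0 x hx
        refine ⟨?_, by rw [hg]; simp only [hS]; field_simp; ring⟩
        have h1 := ((h.hasDerivAt_rate x hx).log hσx).add
          ((((hfd x hx).sub (h.hasDerivAt_rate x hx)).mul ((hyd x hx hxs).const_sub 1)).div
            ((h.hasDerivAt_rate x hx).const_mul A) (mul_ne_zero hA.ne' hσx))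
        refine (h1.div_const r₁).congr_deriv ?_
        have hyx : (f x - σ x) * z x = σ x * ((r₁ - r₂) * y x - r₁ + deriv f x) := by
          simp only [hy]; field_simp; ring
        have hB' : B = 1 - A := by linarith [hw.add_eq]
        simp only [Pi.sub_apply, Pi.mul_apply]
        generalize y x = w at *
        rw [hB']
        field_simp
        linear_combination -(1 - w) * hyx) hk hne
    refine (hC.isMaxOn_P1_iff_of_ne hM hf hw hk hne).2 ?_
    rw [hW₁, hW₂, hg]
    have hσx := hσ0 k hk
    change A * (r₁ * ((Real.log (σ k) + (f k - σ k) * (1 - y k) / (A * σ k)) / r₁)) +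
      B * (r₂ * ((Real.log (σ k) + (f k - σ k) * y k / (B * σ k)) / r₂)) =
        Real.log (σ k) + (f k - σ k) / σ k
    have e1 : A * (r₁ * ((Real.log (σ k) + (f k - σ k) * (1 - y k) / (A * σ k)) / r₁)) =
        A * Real.log (σ k) + (f k - σ k) * (1 - y k) / σ k := by field_simp
    have e2 : B * (r₂ * ((Real.log (σ k) + (f k - σ k) * y k / (B * σ k)) / r₂)) =
        B * Real.log (σ k) + (f k - σ k) * y k / σ k := by field_simp
    rw [e1, e2, hA']
    ring

/-! ### Neighbouring equilibria -/

lemma eventually_forall_abs_sub_le {x : ℝ} {P : ℝ → Prop} (h : ∀ᶠ y in 𝓝 x, P y) :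
    ∀ᶠ η in 𝓝[>] (0 : ℝ), ∀ y, |y - x| ≤ η → P y := by
  obtain ⟨e, he, hP⟩ := Metric.eventually_nhds_iff.1 h
  filter_upwards [Ioo_mem_nhdsGT he] with η hη y hy
  exact hP (by rw [Real.dist_eq]; exact hy.trans_lt hη.2)

lemma eventually_pos : ∀ᶠ η in 𝓝[>] (0 : ℝ), 0 < η := self_mem_nhdsWithin

lemma eventually_mul_lt (c : ℝ) {d : ℝ} (hd : 0 < d) : ∀ᶠ η in 𝓝[>] (0 : ℝ), c * η < d := by
  have h : Tendsto (fun η : ℝ => c * η) (𝓝[>] 0) (𝓝 (c * 0)) :=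
    (tendsto_nhdsWithin_of_tendsto_nhds tendsto_id).const_mul c
  rw [mul_zero] at h
  exact h.eventually_lt_const hd

/-- Lipschitz dependence of the ratio of two variables. -/
lemma abs_div_sub_div_le {z c z' c' C X : ℝ} (hc : 0 < c) (hc' : 0 < c') (hC : 1 / c ≤ C)
    (hX : |z' / c'| ≤ X) :
    |z / c - z' / c'| ≤ C * (1 + X) * (|c - c'| + |z - z'|) := by
  have hX0 : 0 ≤ X := (abs_nonneg _).trans hX
  have h1 : z / c - z' / c' = 1 / c * ((z - z') - z' / c' * (c - c')) := by
    field_simp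
    ring
  have h2 : |(z - z') - z' / c' * (c - c')| ≤ |z - z'| + X * |c - c'| := by
    refine (abs_sub _ _).trans ?_
    rw [abs_mul]
    gcongr
  have h3 : |z - z'| + X * |c - c'| ≤ (1 + X) * (|c - c'| + |z - z'|) := by
    have := mul_nonneg hX0 (abs_nonneg (z - z'))
    have := abs_nonneg (c - c')
    nlinarith
  rw [h1, abs_mul, abs_of_pos (by positivity : 0 < 1 / c), mul_assoc C]
  exact mul_le_mul hC (h2.trans h3) (abs_nonneg _) ((by positivity : 0 < 1 / c).le.trans hC)

section

variable {f : ℝ → ℝ} {S : Strategy} {kbar A B r₁ r₂ : ℝ}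

/-- The equation of the equilibrium strategies satisfies the bounds of a singular field near a point
where `r₂ < f' < A r₁ + B r₂` and the candidate slope exceeds `f'`. -/
lemma exists_isSingularField (hf : ContDiffOn ℝ 2 f (Ioi 0)) (hkbar : 0 < kbar)
    (hfk : 0 < f kbar) (hφ : deriv f kbar < A * r₁ + B * r₂)
    (hgap : deriv f kbar < steadySlope f A B r₁ r₂ kbar) :
    ∃ η K, IsSingularField f (deriv f) (fun k => A * r₁ + B * r₂ - deriv f k)
      (steadySlope f A B r₁ r₂) (slopeCorrection f A B r₁ r₂) kbar η K := by
  set φ := deriv f with hφdef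
  set Λ := A * r₁ + B * r₂ with hΛ
  set ζ := steadySlope f A B r₁ r₂ with hζ
  have hφc := continuousOn_deriv_of_contDiffOn hf
  set d := ζ kbar - φ kbar with hd
  have hd0 : 0 < d := sub_pos.2 hgap
  have hφat : ContinuousAt φ kbar := hφc.continuousAt (Ioi_mem_nhds hkbar)
  have ev₁ : ∀ᶠ y in 𝓝 kbar, 0 < y := lt_mem_nhds hkbar
  have ev₂ : ∀ᶠ y in 𝓝 kbar, φ y < Λ := hφat.eventually_lt_const hφ
  have ev₃ : ∀ᶠ y in 𝓝 kbar, |φ y - φ kbar| < d / 4 := by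
    have h := (hφat.sub (continuousAt_const (y := φ kbar))).abs
    have h2 := h.eventually_lt_const (u := d / 4) (by simp; linarith)
    simpa using h2
  obtain ⟨η, hη, hpos, hα, hclose, hηf, hηd⟩ := (eventually_pos.and
    ((eventually_forall_abs_sub_le ev₁).and ((eventually_forall_abs_sub_le ev₂).and
      ((eventually_forall_abs_sub_le ev₃).and
        ((eventually_mul_lt 2 hfk).and (eventually_mul_lt 4 hd0)))))).exists
  set N := Icc (kbar - η) (kbar + η) with hN
  have hmemN : ∀ k, |k - kbar| ≤ η ↔ k ∈ N := fun k => by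
    rw [abs_le, hN, mem_Icc]
    constructor <;> rintro ⟨h1, h2⟩ <;> constructor <;> linarith
  simp only [hmemN] at hpos hα hclose
  have hNcomp : IsCompact N := isCompact_Icc
  have hNpos : N ⊆ Ioi 0 := hpos
  have hφN : ContinuousOn φ N := hφc.mono hNpos
  have hφ'N : ContinuousOn (deriv φ) N := (continuousOn_deriv_deriv_of_contDiffOn hf).mono hNpos
  have hfN : ContinuousOn f N := fun k hk =>
    (hasDerivAt_of_contDiffOn hf (hpos k hk)).continuousAt.continuousWithinAt
  have hαN : ContinuousOn (fun k => Λ - φ k) N := continuousOn_const.sub hφN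
  have hα0 : ∀ k ∈ N, Λ - φ k ≠ 0 := fun k hk => (sub_pos.2 (hα k hk)).ne'
  -- consumption and its inverse
  have hcpos : ∀ c, |c - f kbar| ≤ η → f kbar / 2 ≤ c ∧ c ≤ 2 * f kbar := fun c hc => by
    have := abs_le.1 hc
    exact ⟨by linarith [this.1], by linarith [this.2]⟩
  have hzb : ∀ z, |z - ζ kbar| ≤ η → |z| ≤ |ζ kbar| + η := fun z hz => by
    have := abs_add_le (z - ζ kbar) (ζ kbar)
    rw [sub_add_cancel] at this
    linarith
  set X := (|ζ kbar| + η) * (2 / f kbar) with hX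
  have hX0 : 0 ≤ X := by positivity
  have hinv : ∀ c, |c - f kbar| ≤ η → 1 / c ≤ 2 / f kbar := fun c hc => by
    have h := (hcpos c hc).1
    have h2 : 0 < f kbar / 2 := by positivity
    calc 1 / c ≤ 1 / (f kbar / 2) := one_div_le_one_div_of_le h2 h
      _ = 2 / f kbar := by field_simp
  have hratio : ∀ c z, |c - f kbar| ≤ η → |z - ζ kbar| ≤ η → |z / c| ≤ X := fun c z hc hz => by
    have h := (hcpos c hc).1
    have hc0 : 0 < c := by linarith [half_pos hfk]
    rw [abs_div, abs_of_pos hc0, div_eq_mul_one_div]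
    exact mul_le_mul (hzb z hz) (hinv c hc) (by positivity) (by positivity)
  -- bounds by compactness
  obtain ⟨C₁, hC₁⟩ := hNcomp.exists_bound_of_continuousOn (hαN.inv₀ hα0)
  set ζ' : ℝ → ℝ := fun k => ((-deriv φ k * (φ k - r₂) + (r₁ - φ k) * deriv φ k) * (Λ - φ k) -
    (r₁ - φ k) * (φ k - r₂) * (-deriv φ k)) / (Λ - φ k) ^ 2 with hζ'
  have hζd : ∀ k ∈ N, HasDerivAt ζ (ζ' k) k := fun k hk => by
    have h := hasDerivAt_deriv_of_contDiffOn hf (hpos k hk)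
    have := (((h.const_sub r₁).mul (h.sub_const r₂)).div (h.const_sub Λ) (hα0 k hk))
    exact this
  have hζ'c : ContinuousOn ζ' N := by
    refine ContinuousOn.div ?_ (hαN.pow 2) fun k hk => pow_ne_zero 2 (hα0 k hk)
    fun_prop
  obtain ⟨C₂, hC₂⟩ := hNcomp.exists_bound_of_continuousOn hζ'c
  set D := {x : ℝ × ℝ × ℝ | |x.1 - kbar| ≤ η ∧ |x.2.1 - f kbar| ≤ η ∧ |x.2.2 - ζ kbar| ≤ η} with hD
  have hDcomp : IsCompact D := by
    have : D = N ×ˢ (Icc (f kbar - η) (f kbar + η) ×ˢ Icc (ζ kbar - η) (ζ kbar + η)) := by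
      ext ⟨x, y, w⟩
      simp only [hD, hN, mem_ofPred_eq, mem_prod, mem_Icc, abs_le]
      constructor
      · rintro ⟨⟨_, _⟩, ⟨_, _⟩, _, _⟩
        refine ⟨⟨?_, ?_⟩, ⟨?_, ?_⟩, ?_, ?_⟩ <;> linarith
      · rintro ⟨⟨_, _⟩, ⟨_, _⟩, _, _⟩
        refine ⟨⟨?_, ?_⟩, ⟨?_, ?_⟩, ?_, ?_⟩ <;> linarith
    rw [this]
    exact hNcomp.prod (isCompact_Icc.prod isCompact_Icc)
  have hQc : ContinuousOn (fun x : ℝ × ℝ × ℝ => slopeCorrection f A B r₁ r₂ x.1 x.2.1 x.2.2) D := by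
    have hmaps : MapsTo (fun x : ℝ × ℝ × ℝ => x.1) D N := fun x hx => (hmemN _).1 hx.1
    have h1 : ContinuousOn (fun x : ℝ × ℝ × ℝ => f x.1) D := hfN.comp continuousOn_fst hmaps
    have h2 : ContinuousOn (fun x : ℝ × ℝ × ℝ => φ x.1) D := hφN.comp continuousOn_fst hmaps
    have h3 : ContinuousOn (fun x : ℝ × ℝ × ℝ => deriv φ x.1) D :=
      hφ'N.comp continuousOn_fst hmaps
    have h4 : ContinuousOn (fun x : ℝ × ℝ × ℝ => x.2.2 / x.2.1) D := by
      refine ContinuousOn.div (by fun_prop) (by fun_prop) fun x hx => ?_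
      have := (hcpos _ hx.2.1).1
      linarith [half_pos hfk]
    exact ((((h1.const_mul 2).mul (h4.pow 2)).add
      ((continuousOn_const.sub (h2.const_mul 3)).mul h4)).add h3).div
      (continuousOn_const.sub h2) fun x hx => hα0 _ (hmaps hx)
  obtain ⟨C₃, hC₃⟩ := hDcomp.exists_bound_of_continuousOn hQc
  obtain ⟨C₄, hC₄⟩ := hNcomp.exists_bound_of_continuousOn ((hfN.const_mul 2).div hαN hα0)
  obtain ⟨C₅, hC₅⟩ := hNcomp.exists_bound_of_continuousOn
    (((continuousOn_const (c := r₁ + r₂)).sub (hφN.const_mul 3)).div hαN hα0)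
  have hk₀ : kbar ∈ N := (hmemN _).1 (by simpa using hη.le)
  have p₁ : 0 ≤ C₁ := (norm_nonneg _).trans (hC₁ _ hk₀)
  have p₂ : 0 ≤ C₂ := (norm_nonneg _).trans (hC₂ _ hk₀)
  have p₃ : 0 ≤ C₃ := (norm_nonneg _).trans (hC₃ (kbar, f kbar, ζ kbar)
    ⟨by simpa using hη.le, by simpa using hη.le, by simpa using hη.le⟩)
  have p₄ : 0 ≤ C₄ := (norm_nonneg _).trans (hC₄ _ hk₀)
  have p₅ : 0 ≤ C₅ := (norm_nonneg _).trans (hC₅ _ hk₀)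
  set C₆ := (C₄ * (2 * X) + C₅) * (2 / f kbar * (1 + X)) with hC₆
  have p₆ : 0 ≤ C₆ := by positivity
  -- one constant that serves all bounds
  obtain ⟨K, k₀, k₁, k₂, k₃, k₆, k₇, k₈, k₉, k₁₀, k₁₁⟩ : ∃ K, 1 ≤ K ∧ C₁ ≤ K ∧ C₂ ≤ K ∧ C₃ ≤ K ∧
      C₆ ≤ K ∧ 2 / f kbar ≤ K ∧ 2 * f kbar ≤ K ∧ |ζ kbar| + η ≤ K ∧ 2 / d ≤ K ∧ 2 * d ≤ K := by
    have q₁ : 0 ≤ 2 / f kbar := by positivity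
    have q₂ : 0 ≤ |ζ kbar| + η := by positivity
    have q₃ : 0 ≤ 2 / d := by positivity
    refine ⟨1 + C₁ + C₂ + C₃ + C₆ + 2 / f kbar + 2 * f kbar + (|ζ kbar| + η) + 2 / d + 2 * d, ?_⟩
    refine ⟨?_, ?_, ?_, ?_, ?_, ?_, ?_, ?_, ?_, ?_⟩ <;> linarith
  have hgapbd : ∀ k z, k ∈ N → |z - ζ kbar| ≤ η → d / 2 ≤ z - φ k ∧ z - φ k ≤ 2 * d := by
    intro k z hk hz
    have h1 := abs_lt.1 (hclose k hk)
    have h2 := abs_le.1 hz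
    exact ⟨by linarith [h1.2, h2.1], by linarith [h1.1, h2.2]⟩
  refine ⟨η, K, ?_⟩
  refine
    { pos := hη
      one_le := k₀
      hasDerivAt := fun k hk => hasDerivAt_of_contDiffOn hf (hpos k ((hmemN k).1 hk))
      continuousOn_α := hαN
      α_lower := fun k hk => ?_
      ζ_lipschitz := fun k k' hk hk' => ?_
      continuousOn_Q := hQc
      Q_le := fun k c z hk hc hz => (hC₃ (k, c, z) ⟨hk, hc, hz⟩).trans k₃
      Q_lipschitz := fun k c z c' z' hk hc hz hc' hz' => ?_
      rate_lower := fun c hc => ?_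
      rate_upper := fun c hc => (hcpos c hc).2.trans k₈
      slope_upper := fun z hz => (hzb z hz).trans k₉
      gap_lower := fun k z hk hz => ?_
      gap_upper := fun k z hk hz => (hgapbd k z ((hmemN k).1 hk) hz).2.trans k₁₁ }
  · have h1 := hC₁ k ((hmemN k).1 hk)
    have h2 : 0 < Λ - φ k := sub_pos.2 (hα k ((hmemN k).1 hk))
    have h3 : (Λ - φ k)⁻¹ ≤ K := (le_abs_self _).trans (h1.trans k₁)
    calc (1 : ℝ) = (Λ - φ k)⁻¹ * (Λ - φ k) := (inv_mul_cancel₀ h2.ne').symm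
      _ ≤ K * (Λ - φ k) := by gcongr
  · have h1 := (convex_Icc (kbar - η) (kbar + η)).norm_image_sub_le_of_norm_hasDerivWithin_le
      (fun x hx => (hζd x hx).hasDerivWithinAt) hC₂ ((hmemN k').1 hk') ((hmemN k).1 hk)
    exact h1.trans (by rw [Real.norm_eq_abs]; gcongr)
  · have hkN := (hmemN k).1 hk
    have hc0 : 0 < c := by linarith [half_pos hfk, (hcpos c hc).1]
    have hc0' : 0 < c' := by linarith [half_pos hfk, (hcpos c' hc').1]
    have h1 := abs_div_sub_div_le (z := z) hc0 hc0' (hinv c hc) (hratio c' z' hc' hz')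
    have h2 : slopeCorrection f A B r₁ r₂ k c z - slopeCorrection f A B r₁ r₂ k c' z' =
        (2 * f k / (Λ - φ k) * (z / c + z' / c') + (r₁ + r₂ - 3 * φ k) / (Λ - φ k)) *
          (z / c - z' / c') := by
      simp only [slopeCorrection]
      rw [← hΛ, ← hφdef, ← sub_div]
      ring
    have h3 : |2 * f k / (Λ - φ k) * (z / c + z' / c') + (r₁ + r₂ - 3 * φ k) / (Λ - φ k)| ≤
        C₄ * (2 * X) + C₅ := by
      refine (abs_add_le _ _).trans (add_le_add ?_ (hC₅ k hkN))
      rw [abs_mul]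
      refine mul_le_mul (hC₄ k hkN) ?_ (abs_nonneg _) p₄
      refine (abs_add_le _ _).trans ?_
      linarith [hratio c z hc hz, hratio c' z' hc' hz']
    rw [h2, abs_mul]
    calc _ ≤ (C₄ * (2 * X) + C₅) * (2 / f kbar * (1 + X) * (|c - c'| + |z - z'|)) :=
          mul_le_mul h3 h1 (abs_nonneg _) (by positivity)
      _ = C₆ * (|c - c'| + |z - z'|) := by rw [hC₆]; ring
      _ ≤ K * (|c - c'| + |z - z'|) := by gcongr
  · have h1 := (hinv c hc).trans k₇
    have hc0 : 0 < c := by linarith [half_pos hfk, (hcpos c hc).1]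
    rwa [div_le_iff₀ hc0] at h1
  · have h1 := (hgapbd k z ((hmemN k).1 hk) hz).1
    calc (1 : ℝ) = 2 / d * (d / 2) := by field_simp
      _ ≤ K * (z - φ k) := mul_le_mul k₁₀ h1 (by positivity) (by linarith)

lemma IsSingularSolution.restrict {f α ζ : ℝ → ℝ} {Q : ℝ → ℝ → ℝ → ℝ} {k₀ η s a b a' b' : ℝ}
    {σ z : ℝ → ℝ} (h : IsSingularSolution f α ζ Q k₀ η s a b σ z) (ha : a ≤ a') (hb : b' ≤ b)
    (hs : s ∈ Icc a' b') : IsSingularSolution f α ζ Q k₀ η s a' b' σ z := by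
  have h1 := Icc_subset_Icc ha hb
  have h2 := Ioo_subset_Ioo ha hb
  exact ⟨hs, h.le_left.trans ha, hb.trans h.right_le, h.continuousOn.mono h1,
    h.continuousOn_rate.mono h1, fun k hk => h.hasDerivAt_rate k (h2 hk), h.rate_eq, h.slope_eq,
    fun k hk => h.rate_mem k (h1 hk), fun k hk => h.slope_mem k (h1 hk),
    fun k hk => h.hasDerivAt k (h2 hk)⟩

/-- Near its steady state, an equilibrium strategy solves the singular equation. -/
lemma IsEquilibrium.exists_isSingularSolution (hw : IsMixture A B r₁ r₂)
    (hf : ContDiffOn ℝ 2 f (Ioi 0))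
    (hS : IsEquilibrium f Real.log (mixedDiscount A B r₁ r₂) S kbar)
    (hφ : r₁ * r₂ < (A * r₂ + B * r₁) * deriv f kbar) {η : ℝ} (hη : 0 < η) {c : ℝ} :
    ∃ r > 0, c * r < 1 ∧ Icc (kbar - r) (kbar + r) ⊆ S.dom ∧
      IsSingularSolution f (fun k => A * r₁ + B * r₂ - deriv f k) (steadySlope f A B r₁ r₂)
        (slopeCorrection f A B r₁ r₂) kbar η kbar (kbar - r) (kbar + r) S.rate (deriv S.rate) := by
  obtain ⟨-, -, hα, hslope, -⟩ := hS.steady_state hw hf hφ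
  have hk := hS.convergesTo.1
  have hM := hS.isMarkov
  have hnhds := hM.isOpen.mem_nhds hk
  have hclose : ∀ g : ℝ → ℝ, ContinuousOn g S.dom → ∀ᶠ y in 𝓝 kbar, |g y - g kbar| < η := by
    intro g hg
    have h := ((hg.continuousAt hnhds).sub (continuousAt_const (y := g kbar))).abs
    have h2 := h.eventually_lt_const (u := η) (by simpa using hη)
    simpa using h2
  have hf' : ContinuousOn (deriv f) S.dom :=
    (continuousOn_deriv_of_contDiffOn hf).mono hM.dom_pos
  have evα := (hf'.continuousAt hnhds).eventually_lt_const hα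
  obtain ⟨r, hr, hrη, hrc, hdom, hrate, hslopeη, hαr⟩ := (eventually_pos.and
    ((eventually_mul_lt 1 hη).and ((eventually_mul_lt c one_pos).and
      ((eventually_forall_abs_sub_le hnhds).and
        ((eventually_forall_abs_sub_le (hclose _ hM.contDiffOn.continuousOn)).and
          ((eventually_forall_abs_sub_le (hclose _ hM.continuousOn_deriv)).and
            (eventually_forall_abs_sub_le evα))))))).exists
  have hmem : ∀ k ∈ Icc (kbar - r) (kbar + r), |k - kbar| ≤ r := fun k hk =>
    abs_le.2 ⟨by linarith [hk.1], by linarith [hk.2]⟩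
  have hsub : Icc (kbar - r) (kbar + r) ⊆ S.dom := fun k hk => hdom k (hmem k hk)
  refine ⟨r, hr, hrc, hsub, ⟨⟨by linarith, by linarith⟩, by linarith, by linarith,
    hM.continuousOn_deriv.mono hsub, hM.contDiffOn.continuousOn.mono hsub,
    fun k hk => hM.hasDerivAt (hsub (Ioo_subset_Icc_self hk)), hS.rate_kstar hf, hslope,
    fun k hk => ?_, fun k hk => ?_, fun k hk hne => ?_⟩⟩
  · rw [← hS.rate_kstar hf]
    exact (hrate k (hmem k hk)).le
  · rw [← hslope]
    exact (hslopeη k (hmem k hk)).le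
  · have hkI := Ioo_subset_Icc_self hk
    exact hS.hasDerivAt_deriv_rate hw hf (hsub hkI) hne (hαr k (hmem k hkI))

/-- An equilibrium strategy converging to `kbar` belongs to a family of equilibrium strategies, on
an interval that does not depend on their steady states `kstar > kbar`, at a distance of order
`kstar - kbar`. The family is pinned by the slope at the right end of the interval. -/
lemma IsEquilibrium.exists_nearby (hw : IsMixture A B r₁ r₂)
    (hf : ContDiffOn ℝ 2 f (Ioi 0))
    (hS : IsEquilibrium f Real.log (mixedDiscount A B r₁ r₂) S kbar)
    (hφ : r₁ * r₂ < (A * r₂ + B * r₁) * deriv f kbar) :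
    ∃ r > 0, ∃ K > 0, Icc (kbar - r) (kbar + r) ⊆ S.dom ∧
      ∀ kstar ∈ Ioo kbar (kbar + r), ∃ S' : Strategy,
        IsEquilibrium f Real.log (mixedDiscount A B r₁ r₂) S' kstar ∧
        S'.dom = Ioo (kbar - r) (kbar + r) ∧
        ∀ k ∈ Ioo (kbar - r) (kbar + r), 1 ≤ K * S.rate k ∧ 1 ≤ K * S'.rate k ∧
          |S'.rate k - S.rate k| ≤ 5 * K ^ 2 * (kstar - kbar) := by
  obtain ⟨hA, -, hα, hslope, hgap⟩ := hS.steady_state hw hf hφ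
  have hM := hS.isMarkov
  have hk := hS.convergesTo.1
  have hfk : 0 < f kbar := by rw [← hS.rate_kstar hf]; exact hM.rate_pos _ hk
  obtain ⟨η, K, hF⟩ := exists_isSingularField hf (hM.pos hk) hfk hα (hslope ▸ hgap)
  have hK := hF.K_pos
  obtain ⟨R, hR, hRK, hdom, hsol⟩ := hS.exists_isSingularSolution hw hf hφ hF.pos (c := 2 * K ^ 4)
  -- a linear bound on the slope, on a first interval
  obtain ⟨M, hM₁, hM₂, hM₃⟩ : ∃ M, 4 * K ^ 2 ≤ M ∧ 4 ≤ M ∧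
      |deriv S.rate (kbar + R) - steadySlope f A B r₁ r₂ kbar| / R ≤ M :=
    ⟨max (max (4 * K ^ 2) 4) _, (le_max_left _ _).trans (le_max_left _ _),
      (le_max_right _ _).trans (le_max_left _ _), le_max_right _ _⟩
  have hbar : ∀ k ∈ Icc kbar (kbar + R),
      |deriv S.rate k - steadySlope f A B r₁ r₂ kbar| ≤ M * (k - kbar) := fun k hk =>
    hsol.right_barrier hF hM₁ (by rw [add_sub_cancel_left]; exact (div_le_iff₀ hR).1 hM₃)
      (by rwa [add_sub_cancel_left]) hk
  -- the interval is then shortened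
  obtain ⟨τ, hτ, hτη, hτK⟩ := (eventually_pos.and
    ((eventually_mul_lt 1 hF.pos).and (eventually_mul_lt (16 * K ^ 5) one_pos))).exists
  obtain ⟨r, hr, h₁, h₂, h₃, h₄, h₅⟩ := (eventually_pos.and
    ((eventually_mul_lt 1 hR).and ((eventually_mul_lt (4 * K) hF.pos).and
      ((eventually_mul_lt (3 * K ^ 2) hτ).and ((eventually_mul_lt M hτ).and
        (eventually_mul_lt (1000 * M ^ 2 * K ^ 9) one_pos)))))).exists
  have hsm : IsSmall η K r τ := ⟨hr, h₂.le, h₃.le, by linarith, hτK.le⟩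
  have hsub : Icc (kbar - r) (kbar + r) ⊆ S.dom :=
    (Icc_subset_Icc (by linarith) (by linarith)).trans hdom
  have hsol' := hsol.restrict (a' := kbar - r) (b' := kbar + r) (by linarith) (by linarith)
    ⟨by linarith, by linarith⟩
  refine ⟨r, hr, K, hK, hsub, fun kstar hks => ?_⟩
  have hzb := (hbar (kbar + r) ⟨by linarith, by linarith⟩).trans
    (show M * (kbar + r - kbar) ≤ τ by rw [add_sub_cancel_left]; exact h₄.le)
  have hks' : kstar ∈ Ioo (kbar - r) (kbar + r) := ⟨by linarith [hks.1], hks.2⟩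
  obtain ⟨σ, z, hnew, hend⟩ := hF.exists_solution hsm hks' hzb
  have hcomp := solution_comparison hF hr h₅.le hM₂ hks hsol' hnew
    (fun k hk => hbar k ⟨hk.1, by linarith [hk.2]⟩) hend
  have ha : 0 < kbar - r := hM.pos (hsub (left_mem_Icc.2 (by linarith)))
  refine ⟨⟨Ioo (kbar - r) (kbar + r), σ⟩, hnew.isEquilibrium hw hf hA ha hks' hF, rfl,
    fun k hk => ?_⟩
  have hkI := Ioo_subset_Icc_self hk
  exact ⟨hF.rate_lower _ (hsol'.rate_mem k hkI), hF.rate_lower _ (hnew.rate_mem k hkI),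
    hcomp k hkI⟩

end

/-! ### Comparison of welfares -/

section

variable {f : ℝ → ℝ} {S : Strategy} {kbar A B r₁ r₂ : ℝ}

lemma IsMixture.marginal_value_pos (hw : IsMixture A B r₁ r₂) {F φ : ℝ} (hF : 0 < F)
    (hφ : r₁ * r₂ < (A * r₂ + B * r₁) * φ) : 0 < ((A / r₁ + B / r₂) * φ - 1) / F := by
  have hr₂ := hw.rate_pos
  have hr₁ : 0 < r₁ := hr₂.trans hw.rate_lt
  refine div_pos (sub_pos.2 ?_) hF
  rw [div_add_div _ _ hr₁.ne' hr₂.ne', div_mul_eq_mul_div, one_lt_div (by positivity),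
    mul_comm r₁ B]
  linarith

lemma IsEquilibrium.f_pos (hf : ContDiffOn ℝ 2 f (Ioi 0)) {h : ℝ → ℝ}
    (hS : IsEquilibrium f Real.log h S kbar) : 0 < f kbar := by
  rw [← hS.rate_kstar hf]
  exact hS.isMarkov.rate_pos _ hS.convergesTo.1

/-- The metaplanner at `kbar` prefers all equilibria with a slightly higher steady state. -/
lemma IsEquilibrium.exists_welfare_lt_at (hw : IsMixture A B r₁ r₂) (hf : ContDiffOn ℝ 2 f (Ioi 0))
    (hS : IsEquilibrium f Real.log (mixedDiscount A B r₁ r₂) S kbar)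
    (hφ : r₁ * r₂ < (A * r₂ + B * r₁) * deriv f kbar) :
    ∃ d > 0, ∃ η > 0, ∀ kstar ∈ Ioo kbar (kbar + η), ∀ S' : Strategy,
      IsEquilibrium f Real.log (mixedDiscount A B r₁ r₂) S' kstar → kbar ∈ S'.dom →
      d * (kstar - kbar) ≤ welfare f Real.log (mixedDiscount A B r₁ r₂) S' kbar -
        welfare f Real.log (mixedDiscount A B r₁ r₂) S kbar := by
  obtain ⟨hA, h₁, h₂, -, -⟩ := hS.steady_state hw hf hφ
  have hd := hw.marginal_value_pos (hS.f_pos hf) hφ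
  obtain ⟨η, hη, hclose⟩ := exists_welfare_close hw hf (hS.isMarkov.pos hS.convergesTo.1) hA
    (hS.f_pos hf) ⟨h₁, h₂⟩ (half_pos hd)
  refine ⟨_, half_pos hd, η, hη, fun kstar hk S' hS' hdom => ?_⟩
  have hpos : 0 < kstar - kbar := sub_pos.2 hk.1
  have h := hclose kstar (by rw [abs_of_pos hpos]; linarith [hk.2]) S' hS' hdom
  rw [abs_of_pos hpos] at h
  rw [hS.welfare_kstar hw hf]
  linarith [(abs_le.1 h).1]

/-- The marginal welfare `1/σ` changes little between the equilibria of the family, so that the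
preference of the metaplanner at `kbar` extends to a neighbourhood. -/
lemma IsEquilibrium.exists_welfare_lt (hw : IsMixture A B r₁ r₂) (hf : ContDiffOn ℝ 2 f (Ioi 0))
    (hS : IsEquilibrium f Real.log (mixedDiscount A B r₁ r₂) S kbar)
    (hφ : r₁ * r₂ < (A * r₂ + B * r₁) * deriv f kbar) :
    ∃ ε₀ > 0, Ioo (kbar - ε₀) (kbar + ε₀) ⊆ S.dom ∧ ∀ ε ∈ Ioc 0 ε₀,
      ∀ kstar ∈ Ioo kbar (kbar + ε), ∃ S' : Strategy,
        IsEquilibrium f Real.log (mixedDiscount A B r₁ r₂) S' kstar ∧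
        Ioo (kbar - ε) (kbar + ε) ⊆ S'.dom ∧ ∀ k ∈ Ioo (kbar - ε) (kbar + ε),
          welfare f Real.log (mixedDiscount A B r₁ r₂) S k <
            welfare f Real.log (mixedDiscount A B r₁ r₂) S' k := by
  obtain ⟨d, hd, η, hη, hat⟩ := hS.exists_welfare_lt_at hw hf hφ
  obtain ⟨r, hr, K, hK, hdom, hnear⟩ := hS.exists_nearby hw hf hφ
  obtain ⟨ε₀, hε₀, e₁, e₂, e₃⟩ := (eventually_pos.and ((eventually_mul_lt 1 hη).and
    ((eventually_mul_lt 1 hr).and (eventually_mul_lt (5 * K ^ 4) hd)))).exists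
  rw [one_mul] at e₁ e₂
  have hsub : ∀ ε ≤ ε₀, Ioo (kbar - ε) (kbar + ε) ⊆ Ioo (kbar - r) (kbar + r) := fun ε hε =>
    Ioo_subset_Ioo (by linarith) (by linarith)
  refine ⟨ε₀, hε₀, ((hsub ε₀ le_rfl).trans Ioo_subset_Icc_self).trans hdom,
    fun ε hε kstar hk => ?_⟩
  obtain ⟨S', hS', hdom', hrate⟩ := hnear kstar ⟨hk.1, by linarith [hk.2, hε.2]⟩
  have hs := hsub ε hε.2
  refine ⟨S', hS', hdom' ▸ hs, fun k hkε => ?_⟩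
  set x := kstar - kbar with hx
  have hx0 : 0 < x := sub_pos.2 hk.1
  have hkbarε : kbar ∈ Ioo (kbar - ε) (kbar + ε) := ⟨by linarith [hε.1], by linarith [hε.1]⟩
  have h0 := hat kstar ⟨hk.1, by linarith [hk.2, hε.2]⟩ S' hS' (by rw [hdom']; exact hs hkbarε)
  have hbound : ∀ y ∈ Ioo (kbar - ε) (kbar + ε),
      ‖1 / S'.rate y - 1 / S.rate y‖ ≤ 5 * K ^ 4 * x := by
    intro y hy
    obtain ⟨h1, h2, h3⟩ := hrate y (hs hy)
    have p1 : 0 < S.rate y := (mul_pos_iff_of_pos_left hK).1 (one_pos.trans_le h1)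
    have p2 : 0 < S'.rate y := (mul_pos_iff_of_pos_left hK).1 (one_pos.trans_le h2)
    have q1 : 1 / S.rate y ≤ K := (div_le_iff₀ p1).2 h1
    have q2 : 1 / S'.rate y ≤ K := (div_le_iff₀ p2).2 h2
    rw [Real.norm_eq_abs, show 1 / S'.rate y - 1 / S.rate y =
      1 / S'.rate y * (1 / S.rate y) * -(S'.rate y - S.rate y) by field_simp; ring,
      abs_mul, abs_neg, abs_of_pos (by positivity)]
    calc 1 / S'.rate y * (1 / S.rate y) * |S'.rate y - S.rate y|
        ≤ K * K * (5 * K ^ 2 * x) := by gcongr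
      _ = 5 * K ^ 4 * x := by ring
  have hmvt := (convex_Ioo (kbar - ε) (kbar + ε)).norm_image_sub_le_of_norm_hasDerivWithin_le
    (fun y hy => ((hS'.hasDerivAt_welfare hw hf (by rw [hdom']; exact hs hy)).sub
      (hS.hasDerivAt_welfare hw hf (hdom (Ioo_subset_Icc_self (hs hy))))).hasDerivWithinAt)
    hbound hkbarε hkε
  rw [Real.norm_eq_abs, Real.norm_eq_abs] at hmvt
  simp only [Pi.sub_apply] at hmvt
  have hdist : |k - kbar| ≤ ε₀ := abs_le.2 ⟨by linarith [hkε.1, hε.2], by linarith [hkε.2, hε.2]⟩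
  have h4 : 5 * K ^ 4 * x * |k - kbar| ≤ 5 * K ^ 4 * x * ε₀ := by gcongr
  have h5 : 5 * K ^ 4 * ε₀ * x < d * x := by gcongr
  have h6 := (abs_le.1 hmvt).1
  linarith

lemma IsEquilibrium.exists_forall_welfare_lt_flow (hw : IsMixture A B r₁ r₂)
    (hf : ContDiffOn ℝ 2 f (Ioi 0))
    (hS : IsEquilibrium f Real.log (mixedDiscount A B r₁ r₂) S kbar) {S' : Strategy} {kstar : ℝ}
    (hS' : IsEquilibrium f Real.log (mixedDiscount A B r₁ r₂) S' kstar) (hdom : kbar ∈ S'.dom)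
    (hlt : welfare f Real.log (mixedDiscount A B r₁ r₂) S kbar <
      welfare f Real.log (mixedDiscount A B r₁ r₂) S' kbar) {k : ℝ} (hk : k ∈ S.dom) :
    ∃ T : ℝ, 0 ≤ T ∧ ∀ t, T ≤ t → flow f S k t ∈ S'.dom ∧
      welfare f Real.log (mixedDiscount A B r₁ r₂) S (flow f S k t) <
        welfare f Real.log (mixedDiscount A B r₁ r₂) S' (flow f S k t) := by
  have h1 := (hS.hasDerivAt_welfare hw hf hS.convergesTo.1).continuousAt.eventually_lt
    (hS'.hasDerivAt_welfare hw hf hdom).continuousAt hlt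
  have h2 := (hS.convergesTo.tendsto_flow hk).eventually
    ((hS'.isMarkov.isOpen.eventually_mem hdom).and h1)
  obtain ⟨T, hT⟩ := eventually_atTop.1 h2
  exact ⟨max T 0, le_max_right _ _, fun t ht => hT t ((le_max_left _ _).trans ht)⟩

lemma IsEquilibrium.hasDerivAt_welfare_kstar (hw : IsMixture A B r₁ r₂)
    (hf : ContDiffOn ℝ 2 f (Ioi 0))
    (hS : IsEquilibrium f Real.log (mixedDiscount A B r₁ r₂) S kbar)
    (hφ : r₁ * r₂ < (A * r₂ + B * r₁) * deriv f kbar) {E : ℝ → Strategy}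
    (hE : ∀ᶠ kstar in 𝓝 kbar, IsEquilibrium f Real.log (mixedDiscount A B r₁ r₂) (E kstar) kstar ∧
      kbar ∈ (E kstar).dom) :
    HasDerivAt (fun kstar => welfare f Real.log (mixedDiscount A B r₁ r₂) (E kstar) kbar)
      (((A / r₁ + B / r₂) * deriv f kbar - 1) / f kbar) kbar := by
  obtain ⟨hA, h₁, h₂, -, -⟩ := hS.steady_state hw hf hφ
  rw [hasDerivAt_iff_isLittleO, Asymptotics.isLittleO_iff]
  intro ε hε
  obtain ⟨η, hη, hclose⟩ := exists_welfare_close hw hf (hS.isMarkov.pos hS.convergesTo.1) hA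
    (hS.f_pos hf) ⟨h₁, h₂⟩ hε
  filter_upwards [hE, Metric.ball_mem_nhds kbar hη] with kstar hk hdist
  have h := hclose kstar (by rwa [Metric.mem_ball, Real.dist_eq] at hdist) (E kstar) hk.1 hk.2
  rw [hE.self_of_nhds.1.welfare_kstar hw hf, Real.norm_eq_abs, Real.norm_eq_abs, smul_eq_mul,
    mul_comm (kstar - kbar)]
  exact h

end

lemma isMixture_discount {δ p ρ : ℝ} (hρ : 0 < ρ) (hp : 0 < p) (hδ : ρ ≤ δ) :
    IsMixture ((δ - ρ) / (p + δ - ρ)) (p / (p + δ - ρ)) (δ + p) ρ := by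
  have h : 0 < p + δ - ρ := by linarith
  exact ⟨by rw [← add_div, div_eq_one_iff_eq h.ne']; ring,
    div_nonneg (sub_nonneg.2 hδ) h.le, div_pos hp h, hρ, by linarith⟩

end RamseyGame

theorem proposition3 (δ p ρ : ℝ) (hρ : 0 < ρ) (hp : 0 < p) (hδ : ρ ≤ δ)
    (f : ℝ → ℝ) (hf : ContDiffOn ℝ 2 f (Set.Ioi 0))
    (S : RamseyGame.Strategy) (kbar : ℝ)
    (hS : RamseyGame.IsEquilibrium f Real.log (RamseyGame.discount δ p ρ) S kbar)
    (hkbar : ρ * (p + δ) / (p + ρ) < deriv f kbar) :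
    -- the strategy is not locally renegotiation-proof
    ¬ RamseyGame.LocallyRenegotiationProof f Real.log (RamseyGame.discount δ p ρ) S kbar ∧
    (∃ ε > 0, Set.Ioo (kbar - ε) (kbar + ε) ⊆ S.dom ∧
      ∀ kstar ∈ Set.Ioo kbar (kbar + ε),
        -- there is a new equilibrium converging to `kstar`, better on a whole neighbourhood
        -- of `kbar` that does not depend on `kstar`
        (∃ S' : RamseyGame.Strategy,
          RamseyGame.IsEquilibrium f Real.log (RamseyGame.discount δ p ρ) S' kstar ∧
          Set.Ioo (kbar - ε) (kbar + ε) ⊆ S'.dom ∧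
          ∀ k₀ ∈ Set.Ioo (kbar - ε) (kbar + ε),
            RamseyGame.welfare f Real.log (RamseyGame.discount δ p ρ) S k₀ <
              RamseyGame.welfare f Real.log (RamseyGame.discount δ p ρ) S' k₀) ∧
        -- along any path of the status quo, all distant metaplanners strictly prefer to switch to
        -- any equilibrium converging to `kstar` that is defined at `kbar`
        (∀ S' : RamseyGame.Strategy,
          RamseyGame.IsEquilibrium f Real.log (RamseyGame.discount δ p ρ) S' kstar →
          kbar ∈ S'.dom →
          ∀ k₀ ∈ S.dom, ∃ T : ℝ, 0 ≤ T ∧ ∀ t, T ≤ t →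
            RamseyGame.flow f S k₀ t ∈ S'.dom ∧
            RamseyGame.welfare f Real.log (RamseyGame.discount δ p ρ) S
                (RamseyGame.flow f S k₀ t) <
              RamseyGame.welfare f Real.log (RamseyGame.discount δ p ρ) S'
                (RamseyGame.flow f S k₀ t))) ∧
    -- the marginal value of a higher steady state is positive at `kbar`, for any selection
    -- of equilibrium strategies
    0 < ((p + ρ) / (ρ * (p + δ)) * deriv f kbar - 1) / f kbar ∧
    (∀ E : ℝ → RamseyGame.Strategy,
      (∀ᶠ kstar in nhds kbar,
        RamseyGame.IsEquilibrium f Real.log (RamseyGame.discount δ p ρ) (E kstar) kstar ∧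
        kbar ∈ (E kstar).dom) →
      HasDerivAt
        (fun kstar =>
          RamseyGame.welfare f Real.log (RamseyGame.discount δ p ρ) (E kstar) kbar)
        (((p + ρ) / (ρ * (p + δ)) * deriv f kbar - 1) / f kbar) kbar) := by
  obtain ⟨hw, hdisc⟩ : RamseyGame.IsMixture ((δ - ρ) / (p + δ - ρ)) (p / (p + δ - ρ)) (δ + p) ρ ∧
      RamseyGame.discount δ p ρ = RamseyGame.mixedDiscount ((δ - ρ) / (p + δ - ρ))
        (p / (p + δ - ρ)) (δ + p) ρ := ⟨RamseyGame.isMixture_discount hρ hp hδ, rfl⟩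
  have hΔ : 0 < p + δ - ρ := by linarith
  have hpδ : 0 < p + δ := by linarith
  have hH : (p + ρ) / (ρ * (p + δ)) =
      (δ - ρ) / (p + δ - ρ) / (δ + p) + p / (p + δ - ρ) / ρ := by
    have : δ + p ≠ 0 := by linarith
    field_simp
    ring
  have hφ : (δ + p) * ρ <
      ((δ - ρ) / (p + δ - ρ) * ρ + p / (p + δ - ρ) * (δ + p)) * deriv f kbar := by
    have h1 : (δ - ρ) / (p + δ - ρ) * ρ + p / (p + δ - ρ) * (δ + p) = p + ρ := by
      field_simp
      ring
    rw [h1]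
    rw [div_lt_iff₀ (by positivity)] at hkbar
    linarith
  rw [hH, hdisc] at *
  obtain ⟨ε₀, hε₀, hdom, hlt⟩ := hS.exists_welfare_lt hw hf hφ
  obtain ⟨d, hd, η, hη, hat⟩ := hS.exists_welfare_lt_at hw hf hφ
  refine ⟨?_, ⟨min ε₀ η, lt_min hε₀ hη, ?_, fun kstar hk => ⟨?_, ?_⟩⟩,
    hw.marginal_value_pos (hS.f_pos hf) hφ, fun E hE => hS.hasDerivAt_welfare_kstar hw hf hφ hE⟩
  -- a better steady state can be chosen in any neighbourhood `Ω`; `kbar` itself lies in both domains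
  · rintro ⟨Ω, hΩ, hkΩ, -, hbest⟩
    obtain ⟨ε, hε, hball⟩ := Metric.isOpen_iff.1 hΩ kbar hkΩ
    have hm : 0 < min ε₀ ε := lt_min hε₀ hε
    have hk : kbar + min ε₀ ε / 2 ∈ Ioo kbar (kbar + min ε₀ ε) := ⟨by linarith, by linarith⟩
    obtain ⟨S', hS', hdom', hlt'⟩ := hlt _ ⟨hm, min_le_left _ _⟩ _ hk
    have hkbar' : kbar ∈ Ioo (kbar - min ε₀ ε) (kbar + min ε₀ ε) := ⟨by linarith, by linarith⟩
    have hkΩ' : kbar + min ε₀ ε / 2 ∈ Ω := hball (by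
      rw [Metric.mem_ball, Real.dist_eq, add_sub_cancel_left, abs_of_pos (half_pos hm)]
      linarith [min_le_right ε₀ ε])
    exact absurd (hlt' kbar hkbar') (not_lt.2
      (hbest _ hkΩ' hk.1.ne' S' hS' kbar ⟨hkΩ, hdom' hkbar'⟩))
  · exact (Ioo_subset_Ioo (by linarith [min_le_left ε₀ η]) (by linarith [min_le_left ε₀ η])).trans
      hdom
  · exact hlt _ ⟨lt_min hε₀ hη, min_le_left _ _⟩ kstar hk
  · intro S' hS' hdom' k₀ hk₀
    have h1 := hat kstar ⟨hk.1, by linarith [hk.2, min_le_right ε₀ η]⟩ S' hS' hdom'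
    have h2 := mul_pos hd (sub_pos.2 hk.1)
    exact hS.exists_forall_welfare_lt_flow hw hf hS' hdom' (by linarith) hk₀
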